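/- **Theorem 2.5 (convergence of solutions as $\nu\to0$).** Let $d\ge 2$, $\mathbb T^d=[0,2\pi]^d$ (periodic), and consider for $\nu\ge0$ $$\partial_t\theta^\nu+u^\nu\cdot\nabla\theta^\nu=S,\qquad u^\nu_j=\sum_i\partial_{x_i}T^\nu_{ij}[\theta^\nu],\qquad \theta^\nu(\cdot,0)=\theta_0, \tag{1}$$ where $\theta_0,S\in L^2(\mathbb T^d)$ are real and independent of $\nu$ and of time, and $\theta_0$, $S$, $\theta^\nu(\cdot,t)$ have zero mean. The $T_{ij}^\nu$ are Fourier multiplier operators with symbols $\widehat T^\nu_{ij}(k)$, $k\in\mathbb Z^d$, acting on real functions, such that * (A1) $\sum_{i,j}\partial_i\partial_jT^\nu_{ij}f=0$ for all smooth $f$ and all $\nu\ge0$; * (A2) $T^\nu_{ij}:L^\infty(\mathbb T^d)\to BMO(\mathbb T^d)$ is bounded for all $\nu\ge0$; * (A3) for each $\nu>0$ there is $C_\nu>0$ with $|\widehat T^\nu_{ij}(k)|\le C_\nu|k|^{-3}$ for all $i,j$ and all $k\ne0$; * (A4) $\lim_{\nu\to0^+}\sum_k|\widehat T^\nu_{ij}(k)-\widehat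 T^0_{ij}(k)|^2|\widehat g(k)|^2=0$ for all $i,j$ and all $g\in L^2$. Solutions of (1) on $[0,T]$ are weak solutions: for each smooth test function the equation, in divergence form and integrated in time from $0$ to $t$, holds for every $t\in[0,T]$. Write $\Lambda=(-\Delta)^{1/2}$ and $$\|\Lambda^re^{\tau\Lambda^{1/s}}f\|_{L^2}^2=\sum_{k\ne0}|k|^{2r}e^{2\tau|k|^{1/s}}|\widehat f(k)|^2 .$$ A Gevrey-class $s$ solution on $[0,\bar T]$ with radius of convergence at least $\bar\tau$ is a solution with $\sup_{t\in[0,\bar T]}\|\Lambda^re^{\bar\tau\Lambda^{1/s}}\theta(\cdot,t)\|_{L^2}<\infty$. 1. Assume (A5$_1$): there is $C_0>0$ with $|\widehat T_{ij}^\nu(k)|\le C_0$ for all $i,j,k$ and all $\nu\in[0,1]$. Let $s\ge1$, $r>\frac d2+\frac32$, $K_0,\tau_0>0$, with $\|\Lambda^re^{\tau_0\Lambda^{1/s}}\theta_0\|_{L^2}\le K_0$ and $\|\Lambda^re^{\tau_0\Lambda^{1/s}}S\|_{L^2}\le K_0$. Let $\bar T,\bar\tau>0$ and, for $\nu\in[0,1]$,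 let $\theta^\nu$ be a Gevrey-class $s$ solution of (1) on $[0,\bar T]$ with radius of convergence at least $\bar\tau$. If $s>1$, let moreover the solutions have the common bound $\|\Lambda^re^{\bar\tau\Lambda^{1/s}}\theta^\nu(\cdot,t)\|_{L^2}\le C$ for all $\nu\in[0,1]$, $t\in[0,\bar T]$, and let $\theta^0$ be the unique Gevrey-class $s$ solution of (1) with $\nu=0$ on $[0,\bar T]$ with radius of convergence at least $\bar\tau$ (for $s=1$ neither is assumed). Then there are $0<T<\bar T$ and $\tau=\tau(t)$ with $0<\tau(t)<\bar\tau$ on $[0,T]$, independent of $\nu$, such that for every $t\in[0,T]$ $$\lim_{\nu\to0^+}\big\|\big(\Lambda^re^{\tau\Lambda^{1/s}}\theta^\nu-\Lambda^re^{\tau\Lambda^{1/s}}\theta^0\big)(\cdot,t)\big\|_{L^2}=0 .$$ 2. Assume (A5$_2$): there is $C_0>0$ with $|k_i\widehat T_{ij}^\nu(k)|\le C_0$ for all $i,j,k$ and all $\nu\in[0,1]$. Let $s>\frac d2+1$, $\theta_0,S\in H^s(\mathbb T^d)$, $T>0$, and for $\nu\in[0,1]$ let $\theta^\nu\in L^\infty(0,T;H^s)$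 be a solution of (1) on $[0,T]$. Then for every $t\in[0,T]$ $$\lim_{\nu\to0^+}\|(\theta^\nu-\theta^0)(\cdot,t)\|_{H^{s-1}}=0 .$$ -/

import Mathlib

open MeasureTheory Filter Topology
open scoped ENNReal ContDiff

noncomputable section

instance fact_two_pi_pos : Fact ((0 : ℝ) < 2 * Real.pi) := ⟨Real.two_pi_pos⟩

/-- The torus `[0, 2π]^d` with opposite faces identified. -/
abbrev Torus (d : ℕ) : Type := Fin d → AddCircle (2 * Real.pi)

/-- The character `x ↦ exp (i k · x)`. -/
def wave {d : ℕ} (k : Fin d → ℤ) (x : Torus d) : ℂ := ∏ i, fourier (k i) (x i)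

/-- The Euclidean length `|k|` of a frequency. -/
def freqAbs {d : ℕ} (k : Fin d → ℤ) : ℝ := Real.sqrt (∑ i, (k i : ℝ) ^ 2)

/-- The Fourier coefficient `(2π)^(-d) ∫ f(x) exp (-i k · x) dx` of a real function. -/
def fourierCoef {d : ℕ} (f : Torus d → ℝ) (k : Fin d → ℤ) : ℂ :=
  (((2 * Real.pi) ^ d : ℝ) : ℂ)⁻¹ * ∫ x, (f x : ℂ) * wave (-k) x

/-- `f` is `C^∞` on the torus: its periodic lift to `ℝ^d` is. -/
def IsSmooth {d : ℕ} (f : Torus d → ℝ) : Prop :=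
  ContDiff ℝ ∞ (fun y : Fin d → ℝ => f (fun i => (y i : AddCircle (2 * Real.pi))))

/-- The partial derivative `∂f/∂x_j` on the torus. -/
def partialDeriv {d : ℕ} (j : Fin d) (f : Torus d → ℝ) (x : Torus d) : ℝ :=
  deriv (fun h : ℝ => f (x + Pi.single j (h : AddCircle (2 * Real.pi)))) 0

/-- `‖Λ^r exp (τ Λ^(1/s)) f‖_{L²}`, with value `∞` allowed:
the square root of `∑_{k ≠ 0} |k|^(2r) exp (2 τ |k|^(1/s)) |f̂(k)|²`. -/
def gevreyNorm {d : ℕ} (s r τ : ℝ) (f : Torus d → ℝ) : ℝ≥0∞ :=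
  (∑' k : {k : Fin d → ℤ // k ≠ 0},
    ENNReal.ofReal (freqAbs k.1 ^ (2 * r) * Real.exp (2 * τ * freqAbs k.1 ^ (1 / s))
      * ‖fourierCoef f k.1‖ ^ 2)) ^ (1 / 2 : ℝ)

/-- The inhomogeneous Sobolev norm `‖f‖_{H^s}`, with value `∞` allowed. -/
def sobolevNorm {d : ℕ} (s : ℝ) (f : Torus d → ℝ) : ℝ≥0∞ :=
  (∑' k : Fin d → ℤ,
    ENNReal.ofReal ((1 + freqAbs k ^ 2) ^ s * ‖fourierCoef f k‖ ^ 2)) ^ (1 / 2 : ℝ)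

/-- `f ∈ L²` with zero mean. -/
def IsL2MeanZero {d : ℕ} (f : Torus d → ℝ) : Prop :=
  MemLp f 2 volume ∧ ∫ x, f x = 0

/-- The symbols `k ↦ T̂_ij(k)` of a matrix of Fourier multiplier operators `T_ij`. -/
abbrev SymbolMatrix (d : ℕ) : Type := Fin d → Fin d → (Fin d → ℤ) → ℂ

/-- `∑_{i,j} ∂_i ∂_j T_ij f = 0` for all smooth `f`, read on the Fourier side. -/
def DoubleDivFree {d : ℕ} (m : SymbolMatrix d) : Prop :=
  ∀ f : Torus d → ℝ, IsSmooth f → ∀ k : Fin d → ℤ,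
    ∑ i, ∑ j, (Complex.I * (k i : ℂ)) * (Complex.I * (k j : ℂ)) * m i j k * fourierCoef f k = 0

/-- `f` is integrable with mean oscillation at most `M` over every cube of the torus
(the distance on `Torus d` is the sup distance, so its closed balls are the cubes). -/
def BMOBound {d : ℕ} (f : Torus d → ℝ) (M : ℝ) : Prop :=
  Integrable f volume ∧ ∀ (x : Torus d) (ρ : ℝ), 0 < ρ →
    (⨍ y in Metric.closedBall x ρ, |f y - ⨍ z in Metric.closedBall x ρ, f z|) ≤ M

/-- The Fourier multiplier operator with symbol `m` maps (real) `L^∞` boundedly to (real) `BMO`. -/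
def MapsLinftyToBMO {d : ℕ} (m : (Fin d → ℤ) → ℂ) : Prop :=
  ∃ C : ℝ, ∀ f : Torus d → ℝ, MemLp f ∞ volume →
    ∃ g : Torus d → ℝ, (∀ k, fourierCoef g k = m k * fourierCoef f k) ∧
      BMOBound g (C * (eLpNorm f ∞ volume).toReal)

/-- `|T̂_ij(k)| ≤ C |k|^(-3)` for all `k ≠ 0`. -/
def SmoothingSymbol {d : ℕ} (m : SymbolMatrix d) : Prop :=
  ∃ C : ℝ, 0 < C ∧ ∀ i j (k : Fin d → ℤ), k ≠ 0 → ‖m i j k‖ ≤ C * freqAbs k ^ (-3 : ℤ)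

/-- `∑_k |T̂^ν_ij(k) - T̂^0_ij(k)|² |ĝ(k)|² → 0` as `ν → 0+`, for each `g ∈ L²`. -/
def SymbolsConverge {d : ℕ} (m : ℝ → SymbolMatrix d) : Prop :=
  ∀ i j, ∀ g : Torus d → ℝ, MemLp g 2 volume →
    Tendsto (fun ν : ℝ => ∑' k : Fin d → ℤ,
      ENNReal.ofReal (‖m ν i j k - m 0 i j k‖ ^ 2 * ‖fourierCoef g k‖ ^ 2)) (𝓝[>] 0) (𝓝 0)

/-- The symbols `T̂^ν_ij(k)` are bounded uniformly in `ν ∈ (0, 1]`, `ν = 0` and `k`. -/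
def UniformlyBoundedSymbols {d : ℕ} (m : ℝ → SymbolMatrix d) : Prop :=
  ∃ C₀ : ℝ, 0 < C₀ ∧ ∀ i j (k : Fin d → ℤ),
    (∀ ν : ℝ, 0 < ν → ν ≤ 1 → ‖m ν i j k‖ ≤ C₀) ∧ ‖m 0 i j k‖ ≤ C₀

/-- The symbols `k_i T̂^ν_ij(k)` are bounded uniformly in `ν ∈ (0, 1]`, `ν = 0` and `k`. -/
def UniformlyBoundedGradSymbols {d : ℕ} (m : ℝ → SymbolMatrix d) : Prop :=
  ∃ C₀ : ℝ, 0 < C₀ ∧ ∀ i j (k : Fin d → ℤ),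
    (∀ ν : ℝ, 0 < ν → ν ≤ 1 → ‖(k i : ℂ) * m ν i j k‖ ≤ C₀) ∧ ‖(k i : ℂ) * m 0 i j k‖ ≤ C₀

/-- `v` is the velocity of `f`: `v_j = ∑_i ∂_i T_ij f`, in `L²`. -/
def IsVelocity {d : ℕ} (m : SymbolMatrix d) (f : Torus d → ℝ) (v : Fin d → Torus d → ℝ) : Prop :=
  ∀ j, MemLp (v j) 2 volume ∧
    ∀ k, fourierCoef (v j) k = ∑ i, (Complex.I * (k i : ℂ)) * (m i j k * fourierCoef f k)

/-- `θ` solves `∂_t θ + u · ∇θ = S`, `u_j = ∑_i ∂_i T_ij θ`, `θ(0) = θ₀` on `[0, T]`, in the weak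
sense: each `θ(t)` is in `L²` with zero mean and, for every smooth test function `φ`, the equation
(in divergence form, `u` being divergence free) tested with `φ` holds integrated from `0` to any
`t ∈ [0, T]`. -/
def IsSolution {d : ℕ} (m : SymbolMatrix d) (θ₀ S : Torus d → ℝ) (T : ℝ)
    (θ : ℝ → Torus d → ℝ) : Prop :=
  (∀ t ∈ Set.Icc 0 T, IsL2MeanZero (θ t)) ∧
  ∃ u : ℝ → Fin d → Torus d → ℝ,
    (∀ t ∈ Set.Icc 0 T, IsVelocity m (θ t) (u t)) ∧
    ∀ φ : Torus d → ℝ, IsSmooth φ →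
      IntervalIntegrable (fun σ : ℝ => ∫ x, θ σ x * ∑ j, u σ j x * partialDeriv j φ x)
        volume 0 T ∧
      ∀ t ∈ Set.Icc 0 T,
        ∫ x, θ t x * φ x = (∫ x, θ₀ x * φ x)
          + ∫ σ in (0 : ℝ)..t,
              ((∫ x, θ σ x * ∑ j, u σ j x * partialDeriv j φ x) + ∫ x, S x * φ x)

/-- A Gevrey-class `s` solution on `[0, T]` with radius of convergence at least `τ`:
`‖Λ^r exp (τ Λ^(1/s)) θ(t)‖_{L²}` is bounded on `[0, T]`. -/
def IsGevreySolution {d : ℕ} (m : SymbolMatrix d) (θ₀ S : Torus d → ℝ) (s r T τ : ℝ)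
    (θ : ℝ → Torus d → ℝ) : Prop :=
  IsSolution m θ₀ S T θ ∧
    ∃ M : ℝ, ∀ t ∈ Set.Icc 0 T, gevreyNorm s r τ (θ t) ≤ ENNReal.ofReal M

/-- A solution on `[0, T]` that is bounded in `H^s`. -/
def IsSobolevSolution {d : ℕ} (m : SymbolMatrix d) (θ₀ S : Torus d → ℝ) (s T : ℝ)
    (θ : ℝ → Torus d → ℝ) : Prop :=
  IsSolution m θ₀ S T θ ∧
    ∃ M : ℝ, ∀ t ∈ Set.Icc 0 T, sobolevNorm s (θ t) ≤ ENNReal.ofReal M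

end

/-! Everything happens on the Fourier side. Testing the weak equation with the real and imaginary
parts of the characters, and using that the velocity is divergence free, shows that the coefficients
a_k of a solution satisfy a_k' = S_k - (u · ∇θ)_k classically on the whole interval
(`IsSolution.hasDerivWithinAt_fourierCoef`); the decay of the coefficients makes the convolution in
the advection term continuous in time. Testing (A1) and (A4) with Re exp(i k · x) gives, frequency
by frequency, the divergence condition and the convergence of the symbols. In every case the limit
in norm then follows from two facts: the coefficients converge at each fixed time, and a bound in a
stronger norm holds uniformly for small ν, so that the high frequencies contribute little.

Gevrey case, s = 1. The velocity costs a derivative, so a plain weighted norm does not close. The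
analyticity radius is therefore taken to be τ - B t. Integrating exp((τ - B t)|k|) against the
nonlinearity returns one factor 1/(B |k|) (`shrinking_radius_bound`), exactly the lost derivative,
with a small constant if B is large. In the norm Z = ∑ |k| exp((τ - B t)|k|) |a_k|, with the maximum
over past times taken inside the sum, this reads Z ≤ c + b Z² with 4bc < 1, and continuity keeps Z
below 2c, uniformly in ν (`analytic_bound`). The same computation for the difference of two
solutions bounds it by half of itself plus a symbol error (`analytic_difference`), and that error
tends to zero by dominated convergence.

Gevrey case, s > 1. The common bound is a hypothesis. The coefficients are equibounded and
equi-Lipschitz in time, so every sequence ν → 0 has a subsequence along which they converge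
(`exists_subseq_tendsto_of_lipschitz`). The limit is a Gevrey solution for ν = 0
(`IsSolution.of_tendsto`), and the assumed uniqueness identifies it with θ^0 (`tendsto_of_unique`).

Sobolev case. The individual H^s bounds may depend on ν, so a uniform one is obtained by a bootstrap
on A = ∑ |k| |a_k|. As long as A stays below a fixed R, a commutator estimate bounds the H^s norm
(`sobolev_bound`), and an L² estimate bounds the difference from θ^0 by a multiple of the symbol
error (`l2_stability`). Between an H^s bound and small coefficients, A of the difference is small,
hence A < R strictly for small ν, and the bootstrap closes (`lt_of_continuous_induction`). The same
interpolation gives the convergence in H^{s-1}. Since a solution is only known to be bounded in H^s,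
the energy estimates are made with truncated weights and the truncation is removed by an iteration
(`weighted_gronwall`). -/

open scoped ComplexConjugate

/-! ### Fourier series on the torus: completeness, synthesis, products. -/

section Waves

variable {d : ℕ}

lemma wave_zero (x : Torus d) : wave 0 x = 1 := by simp [wave]

lemma wave_add (k l : Fin d → ℤ) (x : Torus d) : wave (k + l) x = wave k x * wave l x := by
  simp only [wave, Pi.add_apply, fourier_add, Finset.prod_mul_distrib]

lemma wave_neg (k : Fin d → ℤ) (x : Torus d) : wave (-k) x = conj (wave k x) := by
  simp only [wave, Pi.neg_apply, fourier_neg, map_prod]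

lemma norm_wave (k : Fin d → ℤ) (x : Torus d) : ‖wave k x‖ = 1 := by
  simp only [wave, norm_prod, fourier_apply, Circle.norm_coe, Finset.prod_const_one]

lemma continuous_wave (k : Fin d → ℤ) : Continuous (wave k) := by
  unfold wave; fun_prop

/-- For n ≠ 0 the integrand changes sign under a translation by half its own period, while the
measure is invariant. -/
lemma integral_fourier_two_pi (n : ℤ) :
    ∫ x : AddCircle (2 * Real.pi), fourier n x = if n = 0 then ((2 * Real.pi : ℝ) : ℂ) else 0 := by
  split_ifs with h
  · subst h
    simp only [fourier_zero, integral_const, measureReal_def, AddCircle.measure_univ]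
    rw [ENNReal.toReal_ofReal (by positivity)]
    simp
  · have h0 : ∫ x : AddCircle (2 * Real.pi), fourier n x ∂AddCircle.haarAddCircle = 0 :=
      integral_eq_zero_of_add_right_eq_neg (fourier_add_half_inv_index h Real.two_pi_pos)
    rw [AddCircle.volume_eq_smul_haarAddCircle, integral_smul_measure, h0, smul_zero]

lemma integral_wave (k : Fin d → ℤ) :
    ∫ x : Torus d, wave k x = if k = 0 then (((2 * Real.pi) ^ d : ℝ) : ℂ) else 0 := by
  unfold wave
  rw [MeasureTheory.integral_fintype_prod_volume_eq_prod
    (f := fun i (y : AddCircle (2 * Real.pi)) => fourier (k i) y)]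
  split_ifs with h
  · subst h
    simp only [Pi.zero_apply, integral_fourier_two_pi, if_true]
    simp
  · obtain ⟨i, hi⟩ := Function.ne_iff.mp h
    refine Finset.prod_eq_zero (Finset.mem_univ i) ?_
    rw [integral_fourier_two_pi]
    exact if_neg hi

/-- The characters as continuous maps. -/
noncomputable def waveMap (k : Fin d → ℤ) : C(Torus d, ℂ) := ⟨wave k, continuous_wave k⟩

/-- The star subalgebra of trigonometric polynomials. -/
noncomputable def waveSubalgebra (d : ℕ) : StarSubalgebra ℂ C(Torus d, ℂ) where
  toSubalgebra := Algebra.adjoin ℂ (Set.range waveMap)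
  star_mem' := by
    change Algebra.adjoin ℂ (Set.range waveMap) ≤ star (Algebra.adjoin ℂ (Set.range waveMap))
    refine Algebra.adjoin_le ?_
    rintro _ ⟨n, rfl⟩
    refine Algebra.subset_adjoin ⟨-n, ?_⟩
    ext1 x
    simp [waveMap, wave_neg]

lemma waveSubalgebra_coe :
    Subalgebra.toSubmodule (waveSubalgebra d).toSubalgebra
      = Submodule.span ℂ (Set.range (waveMap (d := d))) := by
  apply Algebra.adjoin_eq_span_of_subset
  refine .trans (fun x ↦ Submonoid.closure_induction (fun _ ↦ id) ⟨0, ?_⟩ ?_) Submodule.subset_span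
  · ext z
    simp [waveMap, wave_zero]
  · rintro _ _ _ _ ⟨m, rfl⟩ ⟨n, rfl⟩
    refine ⟨m + n, ?_⟩
    ext z
    simp [waveMap, wave_add]

lemma waveSubalgebra_separatesPoints : (waveSubalgebra d).SeparatesPoints := by
  intro x y hxy
  obtain ⟨i, hi⟩ := Function.ne_iff.mp hxy
  refine ⟨_, ⟨waveMap (Pi.single i 1), Algebra.subset_adjoin ⟨Pi.single i 1, rfl⟩, rfl⟩, ?_⟩
  have key : ∀ z : Torus d, wave (Pi.single i 1) z = fourier 1 (z i) := by
    intro z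
    unfold wave
    rw [Finset.prod_eq_single i]
    · simp
    · intro j _ hj
      simp [Pi.single_eq_of_ne hj]
    · simp
  change wave _ x ≠ wave _ y
  rw [key, key, fourier_one, fourier_one]
  intro h
  exact hi (AddCircle.injective_toCircle Real.two_pi_pos.ne' (Circle.coe_injective h))

/-- Stone–Weierstrass: the characters are closed under products and conjugation, so their span is a
star subalgebra, and the coordinate characters separate points. -/
lemma span_waveMap_closure_eq_top :
    (Submodule.span ℂ (Set.range (waveMap (d := d)))).topologicalClosure = ⊤ := by
  rw [← waveSubalgebra_coe]
  exact congr_arg (Subalgebra.toSubmodule <| StarSubalgebra.toSubalgebra ·)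
    (ContinuousMap.starSubalgebra_topologicalClosure_eq_top_of_separatesPoints _
      waveSubalgebra_separatesPoints)

/-- The characters as elements of `L²`. -/
noncomputable abbrev waveLp (k : Fin d → ℤ) : Lp ℂ 2 (volume : Measure (Torus d)) :=
  ContinuousMap.toLp (E := ℂ) 2 volume ℂ (waveMap k)

lemma span_waveLp_closure_eq_top :
    (Submodule.span ℂ (Set.range (waveLp (d := d)))).topologicalClosure = ⊤ := by
  simpa only [Submodule.map_span, ContinuousLinearMap.coe_coe, ← Set.range_comp,
    Function.comp_def] using
    (ContinuousMap.toLp_denseRange ℂ (volume : Measure (Torus d)) ℂ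
      (p := 2) (by simp)).topologicalClosure_map_submodule span_waveMap_closure_eq_top

lemma two_pi_pow_ne_zero : (((2 * Real.pi) ^ d : ℝ) : ℂ) ≠ 0 := by
  exact_mod_cast (pow_pos Real.two_pi_pos d).ne'

/-- An `L²` function all of whose Fourier coefficients vanish is zero. -/
lemma ae_eq_zero_of_fourierCoef {f : Torus d → ℝ} (hf : MemLp f 2 volume)
    (h : ∀ k, fourierCoef f k = 0) : f =ᵐ[volume] 0 := by
  have hF : MemLp (fun x => (f x : ℂ)) 2 (volume : Measure (Torus d)) := hf.ofReal
  set F : Lp ℂ 2 (volume : Measure (Torus d)) := hF.toLp _ with hFdef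
  have hperp : F ∈ (Submodule.span ℂ (Set.range (waveLp (d := d))))ᗮ := by
    rw [Submodule.mem_orthogonal]
    intro u hu
    induction hu using Submodule.span_induction with
    | zero => simp
    | add x y _ _ hx hy => rw [inner_add_left, hx, hy, add_zero]
    | smul a x _ hx => rw [inner_smul_left, hx, mul_zero]
    | mem x hx =>
      obtain ⟨k, rfl⟩ := hx
      rw [MeasureTheory.L2.inner_def]
      have h1 : ∫ x, (f x : ℂ) * wave (-k) x = 0 := by
        have := h k
        unfold fourierCoef at this
        rcases mul_eq_zero.mp this with h2 | h2
        · exact absurd (inv_eq_zero.mp h2) two_pi_pow_ne_zero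
        · exact h2
      rw [← h1]
      refine integral_congr_ae ?_
      filter_upwards [ContinuousMap.coeFn_toLp (𝕜 := ℂ) (p := 2) volume (waveMap k),
        hF.coeFn_toLp] with x hx1 hx2
      rw [hx1, hFdef, hx2]
      simp [waveMap, wave_neg]
  rw [(Submodule.topologicalClosure_eq_top_iff).mp span_waveLp_closure_eq_top,
    Submodule.mem_bot] at hperp
  have h3 : (fun x => (f x : ℂ)) =ᵐ[volume] 0 := by
    refine hF.coeFn_toLp.symm.trans ?_
    rw [← hFdef, hperp]
    exact Lp.coeFn_zero _ _ _
  filter_upwards [h3] with x hx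
  simpa using hx

lemma integrable_ofReal_mul_wave {f : Torus d → ℝ} (hf : Integrable f volume) (k : Fin d → ℤ) :
    Integrable (fun x => (f x : ℂ) * wave k x) volume :=
  hf.ofReal.mul_bdd (c := 1) (continuous_wave k).aestronglyMeasurable
    (Eventually.of_forall fun x => (norm_wave k x).le)

lemma fourierCoef_sub {f g : Torus d → ℝ} (hf : Integrable f volume) (hg : Integrable g volume)
    (k : Fin d → ℤ) :
    fourierCoef (fun x => f x - g x) k = fourierCoef f k - fourierCoef g k := by
  unfold fourierCoef
  rw [← mul_sub, ← integral_sub (integrable_ofReal_mul_wave hf _) (integrable_ofReal_mul_wave hg _)]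
  simp only [Complex.ofReal_sub, sub_mul]

lemma fourierCoef_congr {f g : Torus d → ℝ} (h : f =ᵐ[volume] g) (k : Fin d → ℤ) :
    fourierCoef f k = fourierCoef g k := by
  unfold fourierCoef
  congr 1
  refine integral_congr_ae ?_
  filter_upwards [h] with x hx
  rw [hx]

lemma fourierCoef_neg (f : Torus d → ℝ) (k : Fin d → ℤ) :
    fourierCoef f (-k) = conj (fourierCoef f k) := by
  unfold fourierCoef
  rw [map_mul, ← integral_conj, map_inv₀, Complex.conj_ofReal]
  congr 2
  ext x
  rw [map_mul, Complex.conj_ofReal, wave_neg (-k)]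

lemma fourierCoef_zero (f : Torus d → ℝ) :
    fourierCoef f 0 = (((2 * Real.pi) ^ d : ℝ) : ℂ)⁻¹ * ((∫ x, f x : ℝ) : ℂ) := by
  unfold fourierCoef
  simp only [neg_zero, wave_zero, mul_one, integral_complex_ofReal]

/-- The (real part of the) sum of the Fourier series with coefficients `c`. -/
noncomputable def synth (c : (Fin d → ℤ) → ℂ) (x : Torus d) : ℝ := (∑' k, c k * wave k x).re

lemma continuous_synth {c : (Fin d → ℤ) → ℂ} (hc : Summable fun k => ‖c k‖) :
    Continuous (synth c) := by
  unfold synth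
  refine Complex.continuous_re.comp
    (continuous_tsum (fun k => continuous_const.mul (continuous_wave k)) hc fun k x => ?_)
  simp [norm_wave]

lemma abs_synth_le {c : (Fin d → ℤ) → ℂ} (hc : Summable fun k => ‖c k‖) (x : Torus d) :
    |synth c x| ≤ ∑' k, ‖c k‖ := by
  refine (Complex.abs_re_le_norm _).trans
    ((norm_tsum_le_tsum_norm (by simpa [norm_wave] using hc)).trans ?_)
  simp [norm_wave]

/-- Pairing k with -k shows that the series is its own conjugate, so the real part taken in `synth`
loses nothing. -/
lemma ofReal_synth {c : (Fin d → ℤ) → ℂ} (hconj : ∀ k, c (-k) = conj (c k)) (x : Torus d) :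
    ((synth c x : ℝ) : ℂ) = ∑' k, c k * wave k x := by
  unfold synth
  rw [← Complex.conj_eq_iff_re, Complex.conj_tsum, ← (Equiv.neg _).tsum_eq]
  simp [hconj, wave_neg]

/-- One interchange of sum and integral serves two purposes: f = 1 gives the coefficients of a
synthesized series, general f the convolution formula for products. -/
lemma tsum_mul_integral_wave {f : Torus d → ℝ} (hf : Integrable f volume)
    {c : (Fin d → ℤ) → ℂ} (hc : Summable fun k => ‖c k‖) (k : Fin d → ℤ) :
    ∫ x, (f x : ℂ) * (∑' l, c l * wave l x) * wave (-k) x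
      = ∑' l, c l * ∫ x, (f x : ℂ) * wave (-(k - l)) x := by
  have h1 : ∀ l, Integrable (fun x => c l * ((f x : ℂ) * wave (-(k - l)) x)) volume :=
    fun l => (integrable_ofReal_mul_wave hf _).const_mul _
  have h2 := integral_tsum_of_summable_integral_norm h1 (by
    have : ∀ l, ∫ x, ‖c l * ((f x : ℂ) * wave (-(k - l)) x)‖ = ‖c l‖ * ∫ x, ‖f x‖ := by
      intro l
      rw [← integral_const_mul]
      congr 1; ext x
      simp [norm_wave]
    simp only [this]
    exact hc.mul_right _)
  simp only [integral_const_mul] at h2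
  rw [h2]
  congr 1; ext x
  rw [mul_assoc, ← tsum_mul_right, ← tsum_mul_left]
  congr 1; ext l
  rw [neg_sub, sub_eq_add_neg, wave_add]
  ring

lemma fourierCoef_synth {c : (Fin d → ℤ) → ℂ} (hc : Summable fun k => ‖c k‖)
    (hconj : ∀ k, c (-k) = conj (c k)) (k : Fin d → ℤ) : fourierCoef (synth c) k = c k := by
  unfold fourierCoef
  simp only [ofReal_synth hconj]
  have h := tsum_mul_integral_wave (f := fun _ : Torus d => (1 : ℝ)) (integrable_const _) hc k
  simp only [Complex.ofReal_one, one_mul, integral_wave] at h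
  rw [h, tsum_eq_single k]
  · rw [if_pos (by simp), mul_comm (c k), inv_mul_cancel_left₀ two_pi_pow_ne_zero]
  · intro l hl
    rw [if_neg, mul_zero]
    rw [neg_eq_zero, sub_eq_zero]
    exact fun h => hl h.symm

/-- An `L²` function with absolutely summable Fourier coefficients is the sum of its series. -/
lemma ae_eq_synth {f : Torus d → ℝ} (hf : MemLp f 2 volume)
    (hc : Summable fun k => ‖fourierCoef f k‖) : f =ᵐ[volume] synth (fourierCoef f) := by
  have hs : MemLp (synth (fourierCoef f)) 2 (volume : Measure (Torus d)) :=
    MemLp.of_bound (continuous_synth hc).aestronglyMeasurable _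
      (Eventually.of_forall fun x => abs_synth_le hc x)
  have h := ae_eq_zero_of_fourierCoef (hf.sub hs) fun k => by
    have := fourierCoef_sub (hf.integrable one_le_two) (hs.integrable one_le_two) k
    rw [fourierCoef_synth hc (fourierCoef_neg f), sub_self] at this
    exact this
  filter_upwards [h] with x hx
  simpa [sub_eq_zero] using hx

/-- The Fourier coefficients of a product. -/
lemma fourierCoef_mul {f g : Torus d → ℝ} (hf : Integrable f volume) (hg : MemLp g 2 volume)
    (hc : Summable fun k => ‖fourierCoef g k‖) (k : Fin d → ℤ) :
    fourierCoef (fun x => f x * g x) k = ∑' l, fourierCoef g (k - l) * fourierCoef f l := by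
  rw [← (Equiv.subLeft k).tsum_eq]
  simp only [Equiv.subLeft_apply, sub_sub_cancel]
  have h := tsum_mul_integral_wave hf hc k
  have h1 : ∫ x, ((f x * g x : ℝ) : ℂ) * wave (-k) x
      = ∫ x, (f x : ℂ) * (∑' l, fourierCoef g l * wave l x) * wave (-k) x := by
    refine integral_congr_ae ?_
    filter_upwards [ae_eq_synth hg hc] with x hx
    rw [← ofReal_synth (fourierCoef_neg g), ← hx]
    push_cast; ring
  unfold fourierCoef at *
  rw [h1, h, ← tsum_mul_left]
  congr 1; ext l; ring

end Waves

/-! ### Characters as smooth test functions. -/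

section TestFunctions

variable {d : ℕ}

/-- The projection of `ℝ^d` onto the torus. -/
noncomputable def torusMk (y : Fin d → ℝ) : Torus d := fun i => (y i : AddCircle (2 * Real.pi))

/-- Continuity of a function on the torus, or of its partial derivatives, can thus be checked on the
periodic lift, which is where smoothness is defined. -/
lemma torusMk_isOpenQuotientMap : IsOpenQuotientMap (torusMk (d := d)) :=
  IsOpenQuotientMap.piMap fun _ => QuotientAddGroup.isOpenQuotientMap_mk

lemma torusMk_add_single (y : Fin d → ℝ) (j : Fin d) (h : ℝ) :
    torusMk y + Pi.single j (h : AddCircle (2 * Real.pi)) = torusMk (y + h • Pi.single j 1) := by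
  ext i
  by_cases hij : i = j
  · subst hij
    simp [torusMk]
  · simp [torusMk, Pi.single_eq_of_ne hij]

lemma partialDeriv_torusMk {f : Torus d → ℝ} (hf : IsSmooth f) (j : Fin d) (y : Fin d → ℝ) :
    partialDeriv j f (torusMk y) = fderiv ℝ (fun y => f (torusMk y)) y (Pi.single j 1) := by
  have hf' : ContDiff ℝ ∞ (fun y : Fin d → ℝ => f (torusMk y)) := hf
  have hd : DifferentiableAt ℝ (fun y : Fin d → ℝ => f (torusMk y)) (y + (0 : ℝ) • Pi.single j 1) :=
    hf'.differentiable (by simp) _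
  have h1 : HasDerivAt (fun h : ℝ => y + h • (Pi.single j 1 : Fin d → ℝ)) (Pi.single j 1) 0 := by
    simpa using ((hasDerivAt_id (0 : ℝ)).smul_const (Pi.single j 1 : Fin d → ℝ)).const_add y
  have h2 := hd.hasFDerivAt.comp_hasDerivAt (0 : ℝ) h1
  simp only [zero_smul, add_zero] at h2
  unfold partialDeriv
  simp only [torusMk_add_single]
  exact h2.deriv

lemma IsSmooth.continuous {f : Torus d → ℝ} (hf : IsSmooth f) : Continuous f := by
  rw [torusMk_isOpenQuotientMap.isQuotientMap.continuous_iff]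
  exact ContDiff.continuous (𝕜 := ℝ) hf

lemma IsSmooth.continuous_partialDeriv {f : Torus d → ℝ} (hf : IsSmooth f) (j : Fin d) :
    Continuous (partialDeriv j f) := by
  rw [torusMk_isOpenQuotientMap.isQuotientMap.continuous_iff]
  have hf' : ContDiff ℝ ∞ (fun y : Fin d → ℝ => f (torusMk y)) := hf
  have : partialDeriv j f ∘ torusMk = fun y => fderiv ℝ (fun y => f (torusMk y)) y (Pi.single j 1) :=
    funext fun y => partialDeriv_torusMk hf j y
  rw [this]
  exact (hf'.continuous_fderiv (by simp)).clm_apply continuous_const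

lemma wave_torusMk (k : Fin d → ℤ) (y : Fin d → ℝ) :
    wave k (torusMk y) = Complex.exp (∑ i, Complex.I * (k i : ℂ) * (y i : ℂ)) := by
  unfold wave torusMk
  rw [Complex.exp_sum]
  refine Finset.prod_congr rfl fun i _ => ?_
  rw [fourier_coe_apply]
  congr 1
  have : (Real.pi : ℂ) ≠ 0 := by exact_mod_cast Real.pi_ne_zero
  push_cast
  field_simp

lemma contDiff_wave_torusMk (k : Fin d → ℤ) :
    ContDiff ℝ ∞ (fun y : Fin d → ℝ => wave k (torusMk y)) := by
  simp only [wave_torusMk]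
  refine ContDiff.cexp (ContDiff.sum fun i _ => contDiff_const.mul ?_)
  exact Complex.ofRealCLM.contDiff.comp (contDiff_apply ℝ ℝ i)

lemma isSmooth_re_wave (k : Fin d → ℤ) : IsSmooth (fun x => (wave k x).re) :=
  Complex.reCLM.contDiff.comp (contDiff_wave_torusMk k)

lemma isSmooth_im_wave (k : Fin d → ℤ) : IsSmooth (fun x => (wave k x).im) :=
  Complex.imCLM.contDiff.comp (contDiff_wave_torusMk k)

lemma hasDerivAt_wave (k : Fin d → ℤ) (j : Fin d) (x : Torus d) :
    HasDerivAt (fun h : ℝ => wave k (x + Pi.single j (h : AddCircle (2 * Real.pi))))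
      (Complex.I * (k j : ℂ) * wave k x) 0 := by
  obtain ⟨y, rfl⟩ := torusMk_isOpenQuotientMap.surjective x
  simp only [torusMk_add_single, wave_torusMk]
  have h1 : HasDerivAt (fun h : ℝ => ∑ i, Complex.I * (k i : ℂ) *
      (((y + h • (Pi.single j 1 : Fin d → ℝ)) i : ℝ) : ℂ))
      (∑ i, Complex.I * (k i : ℂ) * (((Pi.single j 1 : Fin d → ℝ) i : ℝ) : ℂ)) 0 := by
    refine HasDerivAt.fun_sum fun i _ => HasDerivAt.const_mul _ ?_
    have : HasDerivAt (fun h : ℝ => (y + h • (Pi.single j 1 : Fin d → ℝ)) i)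
        ((Pi.single j 1 : Fin d → ℝ) i) 0 := by
      simpa using ((hasDerivAt_id (0 : ℝ)).mul_const ((Pi.single j 1 : Fin d → ℝ) i)).const_add (y i)
    exact this.ofReal_comp
  have h2 := h1.cexp
  have h3 : ∑ i, Complex.I * (k i : ℂ) * (((Pi.single j 1 : Fin d → ℝ) i : ℝ) : ℂ)
      = Complex.I * (k j : ℂ) := by
    rw [Finset.sum_eq_single j]
    · simp
    · intro i _ hi; simp [Pi.single_eq_of_ne hi]
    · simp
  rw [h3] at h2
  simpa [mul_comm] using h2

lemma partialDeriv_re_wave (k : Fin d → ℤ) (j : Fin d) (x : Torus d) :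
    partialDeriv j (fun x => (wave k x).re) x = (Complex.I * (k j : ℂ) * wave k x).re :=
  (Complex.reCLM.hasFDerivAt.comp_hasDerivAt (0 : ℝ) (hasDerivAt_wave k j x)).deriv

lemma partialDeriv_im_wave (k : Fin d → ℤ) (j : Fin d) (x : Torus d) :
    partialDeriv j (fun x => (wave k x).im) x = (Complex.I * (k j : ℂ) * wave k x).im :=
  (Complex.imCLM.hasFDerivAt.comp_hasDerivAt (0 : ℝ) (hasDerivAt_wave k j x)).deriv

lemma memLp_re_wave (k : Fin d → ℤ) (p : ℝ≥0∞) :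
    MemLp (fun x : Torus d => (wave k x).re) p volume :=
  MemLp.of_bound (Complex.continuous_re.comp (continuous_wave k)).aestronglyMeasurable 1
    (Eventually.of_forall fun x => (Complex.abs_re_le_norm _).trans (norm_wave k x).le)

/-- This supplies a real test function that sees the frequency k, also for k = 0; hypotheses
quantified over functions become statements about the symbol at k. -/
lemma fourierCoef_re_wave_ne_zero (k : Fin d → ℤ) :
    fourierCoef (fun x : Torus d => (wave k x).re) k ≠ 0 := by
  unfold fourierCoef
  refine mul_ne_zero (inv_ne_zero two_pi_pow_ne_zero) ?_
  have h : ∀ x : Torus d, (((wave k x).re : ℝ) : ℂ) * wave (-k) x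
      = (1 / 2 : ℂ) * wave 0 x + (1 / 2 : ℂ) * wave (-k + -k) x := by
    intro x
    rw [Complex.re_eq_add_conj, ← wave_neg, wave_add (-k) (-k), ← add_neg_cancel k, wave_add]
    ring
  have hi : ∀ l : Fin d → ℤ, Integrable (fun x : Torus d => (1 / 2 : ℂ) * wave l x) volume :=
    fun l => (continuous_const.mul (continuous_wave l)).integrable_of_hasCompactSupport
      (HasCompactSupport.of_compactSpace _)
  simp only [h]
  rw [integral_add (hi _) (hi _), integral_const_mul, integral_const_mul, integral_wave,
    integral_wave, if_pos rfl, ← mul_add]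
  refine mul_ne_zero (by norm_num) ?_
  split_ifs
  · rw [← two_mul]; exact mul_ne_zero two_ne_zero two_pi_pow_ne_zero
  · rw [add_zero]; exact two_pi_pow_ne_zero

end TestFunctions

/-! ### Length of a frequency and summability of weights on the lattice. -/

section Frequencies

variable {d : ℕ}

lemma freqAbs_eq_norm (k : Fin d → ℤ) :
    freqAbs k = ‖WithLp.toLp 2 (fun i => (k i : ℝ))‖ := by
  simp [freqAbs, EuclideanSpace.norm_eq]

lemma freqAbs_nonneg (k : Fin d → ℤ) : 0 ≤ freqAbs k := Real.sqrt_nonneg _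

lemma freqAbs_zero : freqAbs (0 : Fin d → ℤ) = 0 := by simp [freqAbs]

lemma freqAbs_neg (k : Fin d → ℤ) : freqAbs (-k) = freqAbs k := by simp [freqAbs]

lemma freqAbs_add_le (k l : Fin d → ℤ) : freqAbs (k + l) ≤ freqAbs k + freqAbs l := by
  simp only [freqAbs_eq_norm]
  refine le_trans (le_of_eq ?_) (norm_add_le _ _)
  congr 1
  ext i; simp

lemma freqAbs_le_sub_add (k l : Fin d → ℤ) : freqAbs k ≤ freqAbs (k - l) + freqAbs l := by
  simpa using freqAbs_add_le (k - l) l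

lemma freqAbs_sub_comm (k l : Fin d → ℤ) : freqAbs (k - l) = freqAbs (l - k) := by
  rw [← freqAbs_neg, neg_sub]

lemma abs_freqAbs_sub_le (k l : Fin d → ℤ) : |freqAbs k - freqAbs l| ≤ freqAbs (k - l) := by
  rw [abs_le]
  have h1 := freqAbs_le_sub_add k l
  have h2 := freqAbs_le_sub_add l k
  rw [freqAbs_sub_comm] at h2
  constructor <;> linarith

lemma abs_coord_le_freqAbs (k : Fin d → ℤ) (i : Fin d) : |(k i : ℝ)| ≤ freqAbs k := by
  rw [freqAbs_eq_norm]
  exact PiLp.norm_apply_le (WithLp.toLp 2 (fun i => (k i : ℝ))) i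

lemma one_le_freqAbs {k : Fin d → ℤ} (hk : k ≠ 0) : 1 ≤ freqAbs k := by
  obtain ⟨i, hi⟩ := Function.ne_iff.mp hk
  refine le_trans ?_ (abs_coord_le_freqAbs k i)
  exact_mod_cast Int.one_le_abs hi

lemma freqAbs_pos {k : Fin d → ℤ} (hk : k ≠ 0) : 0 < freqAbs k :=
  zero_lt_one.trans_le (one_le_freqAbs hk)

/-- The frequencies embed in the lattice spanned by the standard basis of ℝ^d, where summability is
known for the sup norm. That norm is at most the Euclidean one, which is the right direction for a
negative exponent. -/
lemma summable_freqAbs_rpow {p : ℝ} (hp : (d : ℝ) < p) :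
    Summable fun k : Fin d → ℤ => freqAbs k ^ (-p) := by
  let b := Pi.basisFun ℝ (Fin d)
  let L := Submodule.span ℤ (Set.range b)
  have hr : Module.finrank ℤ L = d := by
    rw [ZLattice.rank ℝ L]; simp
  have h1 := ZLattice.summable_norm_rpow (L := L) (-p) (by rw [hr]; linarith)
  have hmem : ∀ k : Fin d → ℤ, (fun i => (k i : ℝ)) ∈ L := by
    intro k
    rw [Module.Basis.mem_span_iff_repr_mem]
    intro i
    exact ⟨k i, by simp [b]⟩
  let e : (Fin d → ℤ) → L := fun k => ⟨fun i => (k i : ℝ), hmem k⟩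
  have he : Function.Injective e := by
    intro k l h
    ext i
    have := congrFun (congrArg Subtype.val h) i
    exact Int.cast_injective (α := ℝ) this
  have h2 := h1.comp_injective he
  refine Summable.of_nonneg_of_le (fun k => Real.rpow_nonneg (freqAbs_nonneg k) _) (fun k => ?_) h2
  by_cases hk : k = 0
  · subst hk
    have hp0 : p ≠ 0 := by have : (0 : ℝ) ≤ d := Nat.cast_nonneg d; linarith
    rw [freqAbs_zero, Real.zero_rpow (by simpa using hp0)]
    exact Real.rpow_nonneg (norm_nonneg _) _
  · have hne : e k ≠ 0 := by
      intro h
      apply hk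
      ext i
      have := congrFun (congrArg Subtype.val h) i
      simpa [e] using this
    refine Real.rpow_le_rpow_of_nonpos (norm_pos_iff.mpr hne) ?_ ?_
    · change ‖fun i => (k i : ℝ)‖ ≤ _
      exact (pi_norm_le_iff_of_nonneg (freqAbs_nonneg k)).mpr fun i => abs_coord_le_freqAbs k i
    · have : (0 : ℝ) ≤ d := Nat.cast_nonneg d
      linarith

lemma summable_ite_zero (c : ℝ) : Summable fun k : Fin d → ℤ => if k = 0 then c else 0 :=
  summable_of_ne_finset_zero (s := {0}) fun k hk => if_neg (by simpa using hk)

/-- A single term of the exponential series, of degree n ≥ p/q, already dominates x^p. -/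
lemma exp_neg_le_rpow {c q : ℝ} (hc : 0 < c) (hq : 0 < q) (p : ℝ) :
    ∃ C : ℝ, 0 ≤ C ∧ ∀ x : ℝ, 1 ≤ x → Real.exp (-c * x ^ q) ≤ C * x ^ (-p) := by
  obtain ⟨n, hn⟩ := exists_nat_ge (p / q)
  refine ⟨n.factorial / c ^ n, by positivity, fun x hx => ?_⟩
  have hx0 : 0 < x := by linarith
  have h1 : (c * x ^ q) ^ n / n.factorial ≤ Real.exp (c * x ^ q) :=
    Real.pow_div_factorial_le_exp _ (by positivity) n
  have h2 : x ^ p ≤ (x ^ q) ^ n := by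
    rw [← Real.rpow_natCast, ← Real.rpow_mul hx0.le]
    refine Real.rpow_le_rpow_of_exponent_le hx ?_
    rw [div_le_iff₀ hq] at hn
    linarith
  rw [neg_mul, Real.exp_neg, Real.rpow_neg hx0.le]
  have h3 : c ^ n * x ^ p ≤ n.factorial * Real.exp (c * x ^ q) := by
    rw [div_le_iff₀ (by positivity), mul_pow] at h1
    nlinarith [mul_le_mul_of_nonneg_left h2 (pow_pos hc n).le]
  rw [← div_eq_mul_inv, inv_eq_one_div, div_div, div_le_div_iff₀ (by positivity) (by positivity)]
  linarith

lemma summable_freqAbs_rpow_mul_exp {c q : ℝ} (hc : 0 < c) (hq : 0 < q) {p : ℝ} (hp : 0 ≤ p) :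
    Summable fun k : Fin d → ℤ => freqAbs k ^ p * Real.exp (-c * freqAbs k ^ q) := by
  obtain ⟨C, hC, h⟩ := exp_neg_le_rpow hc hq (p + (d + 1))
  have hs := ((summable_freqAbs_rpow (d := d) (p := d + 1) (by linarith)).mul_left C).add
    (summable_ite_zero 1)
  refine Summable.of_nonneg_of_le
    (fun k => mul_nonneg (Real.rpow_nonneg (freqAbs_nonneg k) _) (Real.exp_pos _).le)
    (fun k => ?_) hs
  by_cases hk : k = 0
  · subst hk
    rw [freqAbs_zero, Real.zero_rpow hq.ne', if_pos rfl]
    have h1 : (0 : ℝ) ^ p ≤ 1 := Real.rpow_le_one le_rfl zero_le_one hp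
    have h2 : (0 : ℝ) ≤ C * 0 ^ (-(d + 1 : ℝ)) := by positivity
    simp only [mul_zero, Real.exp_zero, mul_one]
    linarith
  · have hx := freqAbs_pos hk
    rw [if_neg hk, add_zero]
    calc freqAbs k ^ p * Real.exp (-c * freqAbs k ^ q)
        ≤ freqAbs k ^ p * (C * freqAbs k ^ (-(p + (d + 1)))) :=
          mul_le_mul_of_nonneg_left (h _ (one_le_freqAbs hk)) (Real.rpow_nonneg hx.le _)
      _ = C * (freqAbs k ^ p * freqAbs k ^ (-(p + (d + 1)))) := by ring
      _ = C * freqAbs k ^ (-(d + 1 : ℝ)) := by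
          rw [← Real.rpow_add hx]; congr 2; ring

end Frequencies

/-! ### Extended-valued norms through finite partial sums. -/

section Norms

lemma le_sq_of_rpow_half_le {X : ℝ≥0∞} {M : ℝ} (h : X ^ (1 / 2 : ℝ) ≤ ENNReal.ofReal M) :
    X ≤ ENNReal.ofReal (M ^ 2) := by
  have h1 : X ^ (1 / 2 : ℝ) ≤ ENNReal.ofReal |M| := h.trans (ENNReal.ofReal_le_ofReal (le_abs_self M))
  have h2 := ENNReal.rpow_le_rpow h1 (z := 2) (by norm_num)
  rwa [← ENNReal.rpow_mul, one_div, inv_mul_cancel₀ two_ne_zero, ENNReal.rpow_one,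
    ENNReal.rpow_two, ← ENNReal.ofReal_pow (abs_nonneg M), sq_abs] at h2

lemma rpow_half_le_of_le_sq {X : ℝ≥0∞} {M : ℝ} (hM : 0 ≤ M) (h : X ≤ ENNReal.ofReal (M ^ 2)) :
    X ^ (1 / 2 : ℝ) ≤ ENNReal.ofReal M := by
  have h2 := ENNReal.rpow_le_rpow h (z := 1 / 2) (by norm_num)
  refine h2.trans (le_of_eq ?_)
  rw [ENNReal.ofReal_pow hM, ← ENNReal.rpow_two, ← ENNReal.rpow_mul]
  norm_num

/-- Bounds on finite partial sums are the form in which norms are used below: they need no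
summability and pass to limits term by term. -/
lemma tsum_ofReal_le_iff {ι : Type*} {x : ι → ℝ} (hx : ∀ i, 0 ≤ x i) {M : ℝ} (hM : 0 ≤ M) :
    ∑' i, ENNReal.ofReal (x i) ≤ ENNReal.ofReal M ↔ ∀ F : Finset ι, ∑ i ∈ F, x i ≤ M := by
  rw [ENNReal.tsum_eq_iSup_sum, iSup_le_iff]
  refine forall_congr' fun F => ?_
  rw [← ENNReal.ofReal_sum_of_nonneg fun i _ => hx i, ENNReal.ofReal_le_ofReal_iff hM]

lemma tendsto_rpow_half_tsum {α ι : Type*} {l : Filter α} {x : α → ι → ℝ}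
    (hx : ∀ a i, 0 ≤ x a i)
    (h : ∀ ε : ℝ, 0 < ε → ∀ᶠ a in l, ∀ F : Finset ι, ∑ i ∈ F, x a i ≤ ε) :
    Tendsto (fun a => (∑' i, ENNReal.ofReal (x a i)) ^ (1 / 2 : ℝ)) l (𝓝 0) := by
  rw [ENNReal.tendsto_nhds_zero]
  intro ε hε
  obtain ⟨δ, hδ, hδε⟩ : ∃ δ : ℝ, 0 < δ ∧ ENNReal.ofReal δ ≤ ε := by
    by_cases hε' : ε = ⊤
    · exact ⟨1, one_pos, by simp [hε']⟩
    · exact ⟨ε.toReal, ENNReal.toReal_pos hε.ne' hε', (ENNReal.ofReal_toReal hε').le⟩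
  filter_upwards [h (δ ^ 2) (by positivity)] with a ha
  refine (rpow_half_le_of_le_sq hδ.le ?_).trans hδε
  exact (tsum_ofReal_le_iff (hx a) (by positivity)).mpr ha

variable {d : ℕ}

/-- Only one term of the sum is kept, and its factor |k|^(2r) ≥ 1 is dropped. The polynomial weight
is recovered later at the price of a smaller radius. -/
lemma norm_fourierCoef_le_of_gevreyNorm {s r τ M : ℝ} (hr : 0 ≤ r) {f : Torus d → ℝ}
    (h : gevreyNorm s r τ f ≤ ENNReal.ofReal M) {k : Fin d → ℤ} (hk : k ≠ 0) :
    ‖fourierCoef f k‖ ≤ |M| * Real.exp (-τ * freqAbs k ^ (1 / s)) := by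
  have h1 := (tsum_ofReal_le_iff (ι := {k : Fin d → ℤ // k ≠ 0}) (fun k => by
    have := freqAbs_nonneg k.1; positivity) (sq_nonneg M)).mp (le_sq_of_rpow_half_le h) {⟨k, hk⟩}
  rw [Finset.sum_singleton] at h1
  have h2 : (1 : ℝ) ≤ freqAbs k ^ (2 * r) :=
    Real.one_le_rpow (one_le_freqAbs hk) (by linarith)
  set E := Real.exp (τ * freqAbs k ^ (1 / s)) with hE
  have hE2 : Real.exp (2 * τ * freqAbs k ^ (1 / s)) = E ^ 2 := by
    rw [hE, ← Real.exp_nat_mul]; congr 1; push_cast; ring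
  have hE0 : 0 < E := Real.exp_pos _
  rw [neg_mul, Real.exp_neg, ← hE, ← div_eq_mul_inv, le_div_iff₀ hE0]
  refine abs_le_of_sq_le_sq' ?_ (abs_nonneg M) |>.2
  rw [sq_abs, mul_pow]
  refine le_trans ?_ h1
  simp only [hE2]
  have : 0 ≤ E ^ 2 * ‖fourierCoef f k‖ ^ 2 := by positivity
  nlinarith

lemma sum_le_of_sobolevNorm {s M : ℝ} {f : Torus d → ℝ}
    (h : sobolevNorm s f ≤ ENNReal.ofReal M) (F : Finset (Fin d → ℤ)) :
    ∑ k ∈ F, (1 + freqAbs k ^ 2) ^ s * ‖fourierCoef f k‖ ^ 2 ≤ M ^ 2 :=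
  (tsum_ofReal_le_iff (fun k => by positivity) (sq_nonneg M)).mp (le_sq_of_rpow_half_le h) F

end Norms

/-! ### Symbols, velocity coefficients and their divergence. -/

section Symbols

variable {d : ℕ}

/-- The Fourier coefficients of the velocity generated by the Fourier coefficients `a`. -/
noncomputable def velCoef (m : SymbolMatrix d) (a : (Fin d → ℤ) → ℂ) (j : Fin d)
    (k : Fin d → ℤ) : ℂ :=
  ∑ i, (Complex.I * (k i : ℂ)) * (m i j k * a k)

lemma DoubleDivFree.sum_eq_zero {m : SymbolMatrix d} (hm : DoubleDivFree m) (k : Fin d → ℤ) :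
    ∑ i, ∑ j, (k i : ℂ) * (k j : ℂ) * m i j k = 0 := by
  have h := hm _ (isSmooth_re_wave k) k
  have h2 : ∀ i j, (Complex.I * (k i : ℂ)) * (Complex.I * (k j : ℂ)) * m i j k *
      fourierCoef (fun x => (wave k x).re) k
      = ((k i : ℂ) * (k j : ℂ) * m i j k) * (-fourierCoef (fun x => (wave k x).re) k) := by
    intro i j
    linear_combination ((k i : ℂ) * (k j : ℂ) * m i j k *
      fourierCoef (fun x => (wave k x).re) k) * Complex.I_mul_I
  simp only [h2, ← Finset.sum_mul] at h
  exact (mul_eq_zero.mp h).resolve_right (neg_ne_zero.mpr (fourierCoef_re_wave_ne_zero k))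

/-- This identity is used twice: it exchanges the divergence form and the advective form of the
nonlinearity, and it makes the advection kernel antisymmetric in the energy estimates. -/
lemma DoubleDivFree.velCoef_div {m : SymbolMatrix d} (hm : DoubleDivFree m)
    (a : (Fin d → ℤ) → ℂ) (k : Fin d → ℤ) : ∑ j, velCoef m a j k * (k j : ℂ) = 0 := by
  have h := hm.sum_eq_zero k
  unfold velCoef
  simp only [Finset.sum_mul]
  rw [Finset.sum_comm]
  calc ∑ i, ∑ j, Complex.I * (k i : ℂ) * (m i j k * a k) * (k j : ℂ)
      = ∑ i, ∑ j, (Complex.I * a k) * ((k i : ℂ) * (k j : ℂ) * m i j k) := by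
        refine Finset.sum_congr rfl fun i _ => Finset.sum_congr rfl fun j _ => by ring
    _ = 0 := by simp only [← Finset.mul_sum]; rw [h, mul_zero]

/-- With g = Re exp(i k · x) the k-th term of the sum in (A4) is the symbol difference squared times
a nonzero constant, and a single term is at most the sum. -/
lemma SymbolsConverge.tendsto {m : ℝ → SymbolMatrix d} (hm : SymbolsConverge m) (i j : Fin d)
    (k : Fin d → ℤ) : Tendsto (fun ν => ‖m ν i j k - m 0 i j k‖) (𝓝[>] 0) (𝓝 0) := by
  set c := fourierCoef (fun x : Torus d => (wave k x).re) k with hc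
  have hc0 : 0 < ‖c‖ := norm_pos_iff.mpr (fourierCoef_re_wave_ne_zero k)
  have h1 := hm i j _ (memLp_re_wave k 2)
  have h2 : Tendsto (fun ν => ENNReal.ofReal (‖m ν i j k - m 0 i j k‖ ^ 2 * ‖c‖ ^ 2))
      (𝓝[>] 0) (𝓝 0) :=
    tendsto_of_tendsto_of_tendsto_of_le_of_le tendsto_const_nhds h1 (fun _ => zero_le)
      fun ν => ENNReal.le_tsum (f := fun l => ENNReal.ofReal (‖m ν i j l - m 0 i j l‖ ^ 2 *
        ‖fourierCoef (fun x : Torus d => (wave k x).re) l‖ ^ 2)) k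
  have h3 := (ENNReal.tendsto_toReal ENNReal.zero_ne_top).comp h2
  have h4 : Tendsto (fun ν => (‖m ν i j k - m 0 i j k‖ ^ 2 * ‖c‖ ^ 2) / ‖c‖ ^ 2)
      (𝓝[>] 0) (𝓝 (0 / ‖c‖ ^ 2)) := by
    refine Tendsto.div_const ?_ _
    convert h3 using 2 with ν
    · simp only [Function.comp]
      rw [ENNReal.toReal_ofReal (by positivity)]
    · simp
  rw [zero_div] at h4
  have h5 := (Real.continuous_sqrt.tendsto 0).comp h4
  rw [Real.sqrt_zero] at h5
  refine h5.congr fun ν => ?_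
  simp only [Function.comp]
  rw [mul_div_cancel_right₀ _ (by positivity), Real.sqrt_sq (norm_nonneg _)]

/-- The bound is asked of k_i times the symbol so that both uniform assumptions fit: under (A5₂) C
is the constant itself, under (A5₁) it carries a factor |k|. -/
lemma norm_velCoef_le {m : SymbolMatrix d} {C : ℝ}
    (a : (Fin d → ℤ) → ℂ) (j : Fin d) (k : Fin d → ℤ) (hC : ∀ i, ‖(k i : ℂ) * m i j k‖ ≤ C) :
    ‖velCoef m a j k‖ ≤ d * C * ‖a k‖ := by
  unfold velCoef
  refine (norm_sum_le _ _).trans ?_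
  calc ∑ i, ‖Complex.I * (k i : ℂ) * (m i j k * a k)‖ ≤ ∑ _i : Fin d, C * ‖a k‖ := by
        refine Finset.sum_le_sum fun i _ => ?_
        have : Complex.I * (k i : ℂ) * (m i j k * a k)
          = Complex.I * (((k i : ℂ) * m i j k) * a k) := by ring
        rw [this, norm_mul, Complex.norm_I, one_mul, norm_mul]
        exact mul_le_mul_of_nonneg_right (hC i) (norm_nonneg _)
    _ = d * C * ‖a k‖ := by simp [mul_assoc]

lemma norm_coord_mul_le (k : Fin d → ℤ) (i : Fin d) {z : ℂ} {C : ℝ} (h : ‖z‖ ≤ C) :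
    ‖(k i : ℂ) * z‖ ≤ freqAbs k * C := by
  rw [norm_mul, Complex.norm_intCast]
  exact mul_le_mul (abs_coord_le_freqAbs k i) h (norm_nonneg _) (freqAbs_nonneg k)

end Symbols

/-! ### From the weak formulation to differential equations for the coefficients. -/

section Flow

variable {d : ℕ}

/-- The Fourier coefficients of `v · ∇a`. -/
noncomputable def advection (v : Fin d → (Fin d → ℤ) → ℂ) (a : (Fin d → ℤ) → ℂ)
    (k : Fin d → ℤ) : ℂ :=
  ∑' l, (∑ j, v j (k - l) * (Complex.I * (l j : ℂ))) * a l

lemma summable_mul_sub_of_sq {w : (Fin d → ℤ) → ℝ} (hw : Summable fun k => w k ^ 2)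
    (hw0 : ∀ k, 0 ≤ w k) (k : Fin d → ℤ) : Summable fun l => w (k - l) * w l := by
  have h1 : Summable fun l => w (k - l) ^ 2 := (Equiv.subLeft k).summable_iff.mpr hw
  refine Summable.of_nonneg_of_le (fun l => mul_nonneg (hw0 _) (hw0 _)) (fun l => ?_) (h1.add hw)
  nlinarith [sq_nonneg (w (k - l) - w l), sq_nonneg (w (k - l)), sq_nonneg (w l)]

/-- The weak formulation admits real test functions only; here the real and imaginary parts of a
complex test function are recombined. -/
lemma integral_mul_conj {g : Torus d → ℝ} (hg : Integrable g volume) {ψ : Torus d → ℂ}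
    (hψ : Continuous ψ) :
    ∫ x, (g x : ℂ) * conj (ψ x) = ((∫ x, g x * (ψ x).re : ℝ) : ℂ)
      - Complex.I * ((∫ x, g x * (ψ x).im : ℝ) : ℂ) := by
  obtain ⟨C, hC⟩ := (isCompact_range hψ).isBounded.exists_norm_le
  have hC' : ∀ x, ‖ψ x‖ ≤ C := fun x => hC _ ⟨x, rfl⟩
  have h1 : Integrable (fun x => g x * (ψ x).re) volume :=
    hg.mul_bdd (c := C) (Complex.continuous_re.comp hψ).aestronglyMeasurable
      (Eventually.of_forall fun x => (Complex.abs_re_le_norm _).trans (hC' x))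
  have h2 : Integrable (fun x => g x * (ψ x).im) volume :=
    hg.mul_bdd (c := C) (Complex.continuous_im.comp hψ).aestronglyMeasurable
      (Eventually.of_forall fun x => (Complex.abs_im_le_norm _).trans (hC' x))
  rw [← integral_complex_ofReal, ← integral_complex_ofReal, ← integral_const_mul,
    ← integral_sub h1.ofReal (h2.ofReal.const_mul _)]
  congr 1; ext x
  push_cast
  conv_lhs => rw [← Complex.re_add_im (ψ x)]
  simp only [map_add, Complex.conj_ofReal, map_mul, Complex.conj_I]
  ring

lemma fourierCoef_eq_re_im {f : Torus d → ℝ} (hf : Integrable f volume) (k : Fin d → ℤ) :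
    fourierCoef f k = (((2 * Real.pi) ^ d : ℝ) : ℂ)⁻¹ *
      (((∫ x, f x * (wave k x).re : ℝ) : ℂ) - Complex.I * ((∫ x, f x * (wave k x).im : ℝ) : ℂ)) := by
  unfold fourierCoef
  rw [← integral_mul_conj hf (continuous_wave k)]
  simp only [wave_neg]

/-- The Fourier coefficients of the flux term of the weak formulation. -/
lemma flux_eq {θ : Torus d → ℝ} {u : Fin d → Torus d → ℝ} (hθ : MemLp θ 2 volume)
    (hu : ∀ j, MemLp (u j) 2 volume) (k : Fin d → ℤ) :
    (((2 * Real.pi) ^ d : ℝ) : ℂ)⁻¹ *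
      (((∫ x, θ x * ∑ j, u j x * partialDeriv j (fun x => (wave k x).re) x : ℝ) : ℂ)
      - Complex.I * ((∫ x, θ x * ∑ j, u j x * partialDeriv j (fun x => (wave k x).im) x : ℝ) : ℂ))
      = ∑ j, -(Complex.I * (k j : ℂ)) * fourierCoef (fun x => θ x * u j x) k := by
  have hi : ∀ j, Integrable (fun x => θ x * u j x) volume := fun j => hθ.integrable_mul (hu j)
  have hc : ∀ j, Continuous fun x : Torus d => Complex.I * (k j : ℂ) * wave k x :=
    fun j => continuous_const.mul (continuous_wave k)
  have hb : ∀ j (x : Torus d), ‖Complex.I * (k j : ℂ) * wave k x‖ ≤ |(k j : ℝ)| := by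
    intro j x
    simp [norm_wave]
  have h1 : ∀ j, Integrable (fun x => θ x * u j x * (Complex.I * (k j : ℂ) * wave k x).re) volume :=
    fun j => (hi j).mul_bdd (c := |(k j : ℝ)|)
      (Complex.continuous_re.comp (hc j)).aestronglyMeasurable
      (Eventually.of_forall fun x => (Complex.abs_re_le_norm _).trans (hb j x))
  have h2 : ∀ j, Integrable (fun x => θ x * u j x * (Complex.I * (k j : ℂ) * wave k x).im) volume :=
    fun j => (hi j).mul_bdd (c := |(k j : ℝ)|)
      (Complex.continuous_im.comp (hc j)).aestronglyMeasurable
      (Eventually.of_forall fun x => (Complex.abs_im_le_norm _).trans (hb j x))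
  simp only [partialDeriv_re_wave, partialDeriv_im_wave, Finset.mul_sum, ← mul_assoc] at h1 h2 ⊢
  rw [integral_finsetSum _ fun j _ => h1 j, integral_finsetSum _ fun j _ => h2 j]
  push_cast
  rw [Finset.mul_sum, ← Finset.sum_sub_distrib, Finset.mul_sum]
  refine Finset.sum_congr rfl fun j _ => ?_
  have h3 := integral_mul_conj (hi j) (hc j)
  have h4 : ∫ x, ((θ x * u j x : ℝ) : ℂ) * conj (Complex.I * (k j : ℂ) * wave k x)
      = -(Complex.I * (k j : ℂ)) * ∫ x, ((θ x * u j x : ℝ) : ℂ) * wave (-k) x := by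
    rw [← integral_const_mul]
    congr 1
    funext x
    simp only [map_mul, Complex.conj_I, map_intCast, wave_neg]
    ring
  rw [← h3, h4]
  unfold fourierCoef
  push_cast
  ring

/-- The Weierstrass M-test with majorant w(k - l) w(l), summable because w is square summable. -/
lemma continuousOn_advection {T : ℝ} {a : ℝ → (Fin d → ℤ) → ℂ}
    {v : ℝ → Fin d → (Fin d → ℤ) → ℂ} {w : (Fin d → ℤ) → ℝ}
    (hw : Summable fun k => w k ^ 2) (ha : ∀ t ∈ Set.Icc 0 T, ∀ k, ‖a t k‖ ≤ w k)
    (hv : ∀ t ∈ Set.Icc 0 T, ∀ j k, ‖v t j k‖ ≤ w k) (j : Fin d) (k : Fin d → ℤ)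
    (hac : ∀ l, ContinuousOn (fun t => a t l) (Set.Icc 0 T))
    (hvc : ∀ l, ContinuousOn (fun t => v t j l) (Set.Icc 0 T)) (hT : 0 ≤ T) :
    ContinuousOn (fun t => ∑' l, v t j (k - l) * a t l) (Set.Icc 0 T) := by
  have hw0 : ∀ k, 0 ≤ w k := fun k =>
    (norm_nonneg _).trans (ha 0 (Set.left_mem_Icc.mpr hT) k)
  refine continuousOn_tsum (fun l => (hvc _).mul (hac l)) (summable_mul_sub_of_sq hw hw0 k) ?_
  intro l t ht
  rw [norm_mul]
  exact mul_le_mul (hv t ht j _) (ha t ht l) (norm_nonneg _) (hw0 _)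

lemma IsSolution.fourierCoef_zero_time {m : SymbolMatrix d} {θ₀ S : Torus d → ℝ} {T : ℝ}
    {θ : ℝ → Torus d → ℝ} (hT : 0 ≤ T) (h : IsSolution m θ₀ S T θ) (h₀ : IsL2MeanZero θ₀)
    (k : Fin d → ℤ) : fourierCoef (θ 0) k = fourierCoef θ₀ k := by
  have h0 : (0 : ℝ) ∈ Set.Icc 0 T := Set.left_mem_Icc.mpr hT
  obtain ⟨hL2, u, -, hweak⟩ := h
  rw [fourierCoef_eq_re_im ((hL2 0 h0).1.integrable one_le_two),
    fourierCoef_eq_re_im (h₀.1.integrable one_le_two)]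
  have h1 := (hweak _ (isSmooth_re_wave k)).2 0 h0
  have h2 := (hweak _ (isSmooth_im_wave k)).2 0 h0
  rw [intervalIntegral.integral_same, add_zero] at h1 h2
  rw [h1, h2]

/-- The weak equation is tested with the real and imaginary parts of the k-th character. Absolute
summability of the velocity coefficients turns the coefficients of each flux θ u_j into a
convolution. -/
lemma IsSolution.fourierCoef_eq_integral {m : SymbolMatrix d} {θ₀ S : Torus d → ℝ} {T : ℝ}
    {θ : ℝ → Torus d → ℝ} (hT : 0 ≤ T) (h : IsSolution m θ₀ S T θ) (h₀ : IsL2MeanZero θ₀)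
    (hS : IsL2MeanZero S)
    (hv1 : ∀ t ∈ Set.Icc 0 T, ∀ j, Summable fun k => ‖velCoef m (fourierCoef (θ t)) j k‖)
    (k : Fin d → ℤ) :
    IntervalIntegrable (fun σ => (∑ j, -(Complex.I * (k j : ℂ)) *
        ∑' l, velCoef m (fourierCoef (θ σ)) j (k - l) * fourierCoef (θ σ) l) + fourierCoef S k)
        volume 0 T ∧
    ∀ t ∈ Set.Icc 0 T, fourierCoef (θ t) k = fourierCoef θ₀ k
      + ∫ σ in (0 : ℝ)..t, ((∑ j, -(Complex.I * (k j : ℂ)) *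
        ∑' l, velCoef m (fourierCoef (θ σ)) j (k - l) * fourierCoef (θ σ) l) + fourierCoef S k) := by
  obtain ⟨hL2, u, hu, hweak⟩ := h
  obtain ⟨hic, hc⟩ := hweak _ (isSmooth_re_wave k)
  obtain ⟨his, hs⟩ := hweak _ (isSmooth_im_wave k)
  set Nc : ℝ → ℝ := fun σ => ∫ x, θ σ x * ∑ j, u σ j x *
    partialDeriv j (fun x => (wave k x).re) x with hNc
  set Ns : ℝ → ℝ := fun σ => ∫ x, θ σ x * ∑ j, u σ j x *
    partialDeriv j (fun x => (wave k x).im) x with hNs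
  set c : ℂ := (((2 * Real.pi) ^ d : ℝ) : ℂ)⁻¹ with hcdef
  set Sc : ℝ := ∫ x, S x * (wave k x).re with hSc
  set Ss : ℝ := ∫ x, S x * (wave k x).im with hSs
  have hSk : fourierCoef S k = c * ((Sc : ℂ) - Complex.I * (Ss : ℂ)) :=
    fourierCoef_eq_re_im (hS.1.integrable one_le_two) k
  have hG : ∀ σ ∈ Set.Icc 0 T, (∑ j, -(Complex.I * (k j : ℂ)) *
        ∑' l, velCoef m (fourierCoef (θ σ)) j (k - l) * fourierCoef (θ σ) l) + fourierCoef S k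
      = c * (((Nc σ + Sc : ℝ) : ℂ) - Complex.I * ((Ns σ + Ss : ℝ) : ℂ)) := by
    intro σ hσ
    have hf : c * ((Nc σ : ℂ) - Complex.I * (Ns σ : ℂ)) = _ :=
      flux_eq (hL2 σ hσ).1 (fun j => (hu σ hσ j).1) k
    have hm : ∀ j, fourierCoef (fun x => θ σ x * u σ j x) k
        = ∑' l, velCoef m (fourierCoef (θ σ)) j (k - l) * fourierCoef (θ σ) l := by
      intro j
      have hv : ∀ l, fourierCoef (u σ j) l = velCoef m (fourierCoef (θ σ)) j l := (hu σ hσ j).2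
      rw [fourierCoef_mul ((hL2 σ hσ).1.integrable one_le_two) (hu σ hσ j).1]
      · simp only [hv]
      · simp only [hv]
        exact hv1 σ hσ j
    simp only [hm] at hf
    rw [← hf, hSk]
    push_cast; ring
  have hIc : IntervalIntegrable (fun σ => ((Nc σ + Sc : ℝ) : ℂ)) volume 0 T := by
    have := hic.add (intervalIntegrable_const (c := Sc))
    exact ⟨this.1.ofReal, this.2.ofReal⟩
  have hIs : IntervalIntegrable (fun σ => ((Ns σ + Ss : ℝ) : ℂ)) volume 0 T := by
    have := his.add (intervalIntegrable_const (c := Ss))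
    exact ⟨this.1.ofReal, this.2.ofReal⟩
  have hc' : ∀ t ∈ Set.Icc 0 T, ∫ x, θ t x * (wave k x).re
      = (∫ x, θ₀ x * (wave k x).re) + ∫ σ in (0 : ℝ)..t, (Nc σ + Sc) := hc
  have hs' : ∀ t ∈ Set.Icc 0 T, ∫ x, θ t x * (wave k x).im
      = (∫ x, θ₀ x * (wave k x).im) + ∫ σ in (0 : ℝ)..t, (Ns σ + Ss) := hs
  refine ⟨?_, fun t ht => ?_⟩
  · refine ((hIc.sub (hIs.const_mul Complex.I)).const_mul c).congr_ae ?_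
    refine (ae_restrict_iff' measurableSet_uIoc).mpr (Eventually.of_forall fun σ hσ => ?_)
    rw [Set.uIoc_of_le hT] at hσ
    exact (hG σ (Set.Ioc_subset_Icc_self hσ)).symm
  · have hsub : Set.uIcc 0 t ⊆ Set.uIcc 0 T := by
      rw [Set.uIcc_of_le ht.1, Set.uIcc_of_le hT]
      exact Set.Icc_subset_Icc le_rfl ht.2
    rw [intervalIntegral.integral_congr (g := fun σ => c * (((Nc σ + Sc : ℝ) : ℂ)
      - Complex.I * ((Ns σ + Ss : ℝ) : ℂ))) (fun σ hσ => hG σ (by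
        have := hsub hσ; rwa [Set.uIcc_of_le hT] at this)), intervalIntegral.integral_const_mul,
      intervalIntegral.integral_sub (hIc.mono_set hsub) ((hIs.mono_set hsub).const_mul _),
      intervalIntegral.integral_const_mul, intervalIntegral.integral_ofReal,
      intervalIntegral.integral_ofReal,
      fourierCoef_eq_re_im ((hL2 t ht).1.integrable one_le_two),
      fourierCoef_eq_re_im (h₀.1.integrable one_le_two), hc' t ht, hs' t ht,
      ← hcdef]
    simp only [Complex.ofReal_add]
    ring

/-- The Fourier coefficients of a solution satisfy the equation classically. -/
theorem IsSolution.hasDerivWithinAt_fourierCoef {m : SymbolMatrix d} (hm : DoubleDivFree m)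
    {θ₀ S : Torus d → ℝ} {T : ℝ}
    {θ : ℝ → Torus d → ℝ} (hT : 0 < T) (h : IsSolution m θ₀ S T θ) (h₀ : IsL2MeanZero θ₀)
    (hS : IsL2MeanZero S) {w : (Fin d → ℤ) → ℝ} (hw : Summable fun k => w k ^ 2)
    (ha : ∀ t ∈ Set.Icc 0 T, ∀ k, ‖fourierCoef (θ t) k‖ ≤ w k)
    (hv : ∀ t ∈ Set.Icc 0 T, ∀ j k, ‖velCoef m (fourierCoef (θ t)) j k‖ ≤ w k)
    (hv1 : ∀ t ∈ Set.Icc 0 T, ∀ j, Summable fun k => ‖velCoef m (fourierCoef (θ t)) j k‖)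
    (k : Fin d → ℤ) {t : ℝ} (ht : t ∈ Set.Icc 0 T) :
    HasDerivWithinAt (fun t => fourierCoef (θ t) k)
      (fourierCoef S k - advection (velCoef m (fourierCoef (θ t))) (fourierCoef (θ t)) k)
      (Set.Icc 0 T) t := by
  have hac : ∀ l, ContinuousOn (fun t => fourierCoef (θ t) l) (Set.Icc 0 T) := by
    intro l
    obtain ⟨hi, heq⟩ := h.fourierCoef_eq_integral hT.le h₀ hS hv1 l
    have := intervalIntegral.continuousOn_primitive_interval' hi Set.left_mem_uIcc
    rw [Set.uIcc_of_le hT.le] at this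
    exact (continuousOn_const.add this).congr heq
  have hvc : ∀ j l, ContinuousOn (fun t => velCoef m (fourierCoef (θ t)) j l) (Set.Icc 0 T) := by
    intro j l
    unfold velCoef
    exact continuousOn_finsetSum _ fun i _ =>
      continuousOn_const.mul (continuousOn_const.mul (hac l))
  obtain ⟨hi, heq⟩ := h.fourierCoef_eq_integral hT.le h₀ hS hv1 k
  set G : ℝ → ℂ := fun σ => (∑ j, -(Complex.I * (k j : ℂ)) *
        ∑' l, velCoef m (fourierCoef (θ σ)) j (k - l) * fourierCoef (θ σ) l) + fourierCoef S k
    with hGdef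
  have hGc : ContinuousOn G (Set.Icc 0 T) :=
    (continuousOn_finsetSum _ fun j _ => continuousOn_const.mul
      (continuousOn_advection hw ha hv j k hac (hvc j) hT.le)).add continuousOn_const
  have hGt : G t
      = fourierCoef S k - advection (velCoef m (fourierCoef (θ t))) (fourierCoef (θ t)) k := by
    have hw0 : ∀ k, 0 ≤ w k := fun k => (norm_nonneg _).trans (ha t ht k)
    have hsum : ∀ j, Summable fun l =>
        velCoef m (fourierCoef (θ t)) j (k - l) * fourierCoef (θ t) l := fun j =>
      Summable.of_norm_bounded (summable_mul_sub_of_sq hw hw0 k) fun l => by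
        rw [norm_mul]
        exact mul_le_mul (hv t ht j _) (ha t ht l) (norm_nonneg _) (hw0 _)
    rw [hGdef]
    simp only
    rw [add_comm, sub_eq_add_neg]
    congr 1
    unfold advection
    simp only [← tsum_mul_left]
    rw [← Summable.tsum_finsetSum fun j _ => (hsum j).mul_left _, ← tsum_neg]
    congr 1; ext l
    -- The divergence condition at the frequency k - l allows k to be replaced by l next to the
    -- velocity: div(uθ) becomes u · ∇θ.
    have hdiv := hm.velCoef_div (fourierCoef (θ t)) (k - l)
    simp only [Pi.sub_apply, Int.cast_sub, mul_sub, Finset.sum_sub_distrib, sub_eq_zero] at hdiv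
    calc ∑ j, -(Complex.I * (k j : ℂ)) *
          (velCoef m (fourierCoef (θ t)) j (k - l) * fourierCoef (θ t) l)
        = -(Complex.I * fourierCoef (θ t) l) *
          ∑ j, velCoef m (fourierCoef (θ t)) j (k - l) * (k j : ℂ) := by
          rw [Finset.mul_sum]; exact Finset.sum_congr rfl fun j _ => by ring
      _ = _ := by
          rw [hdiv, Finset.mul_sum, Finset.sum_mul, ← Finset.sum_neg_distrib]
          exact Finset.sum_congr rfl fun j _ => by ring
  rw [← hGt]
  -- The fundamental theorem of calculus relative to a closed interval finds the membership of t
  -- through this instance, so that the endpoints are included.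
  have : Fact (t ∈ Set.Icc 0 T) := ⟨ht⟩
  have hsub : Set.uIcc 0 t ⊆ Set.uIcc 0 T := by
    rw [Set.uIcc_of_le ht.1, Set.uIcc_of_le hT.le]
    exact Set.Icc_subset_Icc le_rfl ht.2
  have hd := intervalIntegral.integral_hasDerivWithinAt_right (hi.mono_set hsub)
    (s := Set.Icc 0 T) (t := Set.Icc 0 T)
    (hGc.stronglyMeasurableAtFilter_nhdsWithin measurableSet_Icc t) (hGc t ht)
  exact (hd.const_add (fourierCoef θ₀ k)).congr heq (heq t ht)

end Flow

/-! ### Convolutions and bounds for the advection term in summable norms. -/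

section Convolution

variable {d : ℕ}

/-- Convolution of sequences indexed by frequencies. -/
noncomputable def conv (P Q : (Fin d → ℤ) → ℝ) (k : Fin d → ℤ) : ℝ := ∑' l, P (k - l) * Q l

/-- The shear (k, l) ↦ (k - l, l) is a bijection that carries this family to the plain product P ⊗
Q. -/
lemma summable_conv_prod {P Q : (Fin d → ℤ) → ℝ} (hP0 : ∀ k, 0 ≤ P k) (hQ0 : ∀ k, 0 ≤ Q k)
    (hP : Summable P) (hQ : Summable Q) :
    Summable fun x : (Fin d → ℤ) × (Fin d → ℤ) => P (x.1 - x.2) * Q x.2 := by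
  have h := hP.mul_of_nonneg hQ hP0 hQ0
  let e : (Fin d → ℤ) × (Fin d → ℤ) ≃ (Fin d → ℤ) × (Fin d → ℤ) :=
    { toFun := fun x => (x.1 - x.2, x.2)
      invFun := fun x => (x.1 + x.2, x.2)
      left_inv := fun x => by simp
      right_inv := fun x => by simp }
  exact e.summable_iff.mpr h

lemma summable_conv_term {P Q : (Fin d → ℤ) → ℝ} (hP0 : ∀ k, 0 ≤ P k) (hQ0 : ∀ k, 0 ≤ Q k)
    (hP : Summable P) (hQ : Summable Q) (k : Fin d → ℤ) : Summable fun l => P (k - l) * Q l :=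
  (summable_conv_prod hP0 hQ0 hP hQ).prod_factor k

lemma summable_conv {P Q : (Fin d → ℤ) → ℝ} (hP0 : ∀ k, 0 ≤ P k) (hQ0 : ∀ k, 0 ≤ Q k)
    (hP : Summable P) (hQ : Summable Q) : Summable (conv P Q) :=
  (summable_conv_prod hP0 hQ0 hP hQ).prod

lemma conv_nonneg {P Q : (Fin d → ℤ) → ℝ} (hP0 : ∀ k, 0 ≤ P k) (hQ0 : ∀ k, 0 ≤ Q k)
    (k : Fin d → ℤ) : 0 ≤ conv P Q k := tsum_nonneg fun _ => mul_nonneg (hP0 _) (hQ0 _)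

lemma tsum_conv {P Q : (Fin d → ℤ) → ℝ} (hP0 : ∀ k, 0 ≤ P k) (hQ0 : ∀ k, 0 ≤ Q k)
    (hP : Summable P) (hQ : Summable Q) : ∑' k, conv P Q k = (∑' k, P k) * ∑' k, Q k := by
  have h := summable_conv_prod hP0 hQ0 hP hQ
  have h' : Summable (Function.uncurry fun k l => P (k - l) * Q l) := h
  unfold conv
  rw [← h'.tsum_comm, ← tsum_mul_left]
  congr 1; ext l
  rw [tsum_mul_right]
  congr 1
  exact (Equiv.subRight l).tsum_eq P

lemma norm_advection_kernel_le {v : Fin d → (Fin d → ℤ) → ℂ} {k l : Fin d → ℤ} {p : ℝ}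
    (h : ∀ j, ‖v j k‖ ≤ p) : ‖∑ j, v j k * (Complex.I * (l j : ℂ))‖ ≤ d * p * freqAbs l := by
  refine (norm_sum_le _ _).trans ?_
  calc ∑ j, ‖v j k * (Complex.I * (l j : ℂ))‖ ≤ ∑ _j : Fin d, p * freqAbs l := by
        refine Finset.sum_le_sum fun j _ => ?_
        rw [norm_mul, norm_mul, Complex.norm_I, one_mul, Complex.norm_intCast]
        exact mul_le_mul (h j) (abs_coord_le_freqAbs l j) (abs_nonneg _)
          ((norm_nonneg _).trans (h j))
    _ = d * p * freqAbs l := by simp [mul_assoc]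

lemma summable_advection {v : Fin d → (Fin d → ℤ) → ℂ} {b : (Fin d → ℤ) → ℂ}
    {P Q : (Fin d → ℤ) → ℝ} (hP0 : ∀ k, 0 ≤ P k) (hP : Summable P) (hQ : Summable Q)
    (hvP : ∀ j k, ‖v j k‖ ≤ P k) (hbQ : ∀ k, freqAbs k * ‖b k‖ ≤ Q k) (k : Fin d → ℤ) :
    Summable fun l => (∑ j, v j (k - l) * (Complex.I * (l j : ℂ))) * b l := by
  have hQ0 : ∀ k, 0 ≤ Q k := fun k =>
    (mul_nonneg (freqAbs_nonneg _) (norm_nonneg _)).trans (hbQ k)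
  refine Summable.of_norm_bounded ((summable_conv_term hP0 hQ0 hP hQ k).mul_left (d : ℝ))
    fun l => ?_
  rw [norm_mul]
  calc _ ≤ (d * P (k - l) * freqAbs l) * ‖b l‖ :=
        mul_le_mul_of_nonneg_right (norm_advection_kernel_le fun j => hvP j _) (norm_nonneg _)
    _ = d * (P (k - l) * (freqAbs l * ‖b l‖)) := by ring
    _ ≤ _ := by
        have := hbQ l
        have := hP0 (k - l)
        gcongr

/-- The splitting v · ∇b - v' · ∇b' = v · ∇(b - b') + (v - v') · ∇b'. The derivative of the
difference falls only on the first term, where the energy method cancels it; the second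
differentiates the fixed function b'. -/
lemma advection_sub {v v' : Fin d → (Fin d → ℤ) → ℂ} {b b' : (Fin d → ℤ) → ℂ} {k : Fin d → ℤ}
    (h1 : Summable fun l => (∑ j, v j (k - l) * (Complex.I * (l j : ℂ))) * b l)
    (h2 : Summable fun l => (∑ j, v' j (k - l) * (Complex.I * (l j : ℂ))) * b' l)
    (h3 : Summable fun l => (∑ j, v j (k - l) * (Complex.I * (l j : ℂ))) * b' l) :
    advection v b k - advection v' b' k
      = advection v (fun l => b l - b' l) k + advection (fun j l => v j l - v' j l) b' k := by
  unfold advection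
  have e1 : ∀ l, (∑ j, v j (k - l) * (Complex.I * (l j : ℂ))) * (b l - b' l)
    = (∑ j, v j (k - l) * (Complex.I * (l j : ℂ))) * b l
      - (∑ j, v j (k - l) * (Complex.I * (l j : ℂ))) * b' l := fun l => mul_sub _ _ _
  have e2 : ∀ l, (∑ j, (v j (k - l) - v' j (k - l)) * (Complex.I * (l j : ℂ))) * b' l
    = (∑ j, v j (k - l) * (Complex.I * (l j : ℂ))) * b' l
      - (∑ j, v' j (k - l) * (Complex.I * (l j : ℂ))) * b' l := fun l => by
    simp only [sub_mul, Finset.sum_sub_distrib]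
  simp only [e1, e2]
  rw [h1.tsum_sub h3, h3.tsum_sub h2]
  ring

/-- The analytic weight is submultiplicative, so it passes through the advection term. -/
lemma exp_mul_norm_advection_le {v : Fin d → (Fin d → ℤ) → ℂ} {b : (Fin d → ℤ) → ℂ}
    {P Q : (Fin d → ℤ) → ℝ} {τ : ℝ} (hτ : 0 ≤ τ) (hP0 : ∀ k, 0 ≤ P k)
    (hP : Summable P) (hQ : Summable Q)
    (hvP : ∀ j k, Real.exp (τ * freqAbs k) * ‖v j k‖ ≤ P k)
    (hbQ : ∀ k, freqAbs k * (Real.exp (τ * freqAbs k) * ‖b k‖) ≤ Q k) (k : Fin d → ℤ) :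
    Real.exp (τ * freqAbs k) * ‖advection v b k‖ ≤ d * conv P Q k := by
  have hQ0 : ∀ k, 0 ≤ Q k := fun k =>
    (mul_nonneg (freqAbs_nonneg _) (mul_nonneg (Real.exp_pos _).le (norm_nonneg _))).trans (hbQ k)
  have hs := (summable_conv_term hP0 hQ0 hP hQ k).mul_left (d : ℝ)
  have hterm : ∀ l, Real.exp (τ * freqAbs k) *
      ‖(∑ j, v j (k - l) * (Complex.I * (l j : ℂ))) * b l‖ ≤ d * (P (k - l) * Q l) := by
    intro l
    have hexp : Real.exp (τ * freqAbs k)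
        ≤ Real.exp (τ * freqAbs (k - l)) * Real.exp (τ * freqAbs l) := by
      rw [← Real.exp_add, ← mul_add]
      exact Real.exp_le_exp.mpr (mul_le_mul_of_nonneg_left (freqAbs_le_sub_add k l) hτ)
    have hv' : ∀ j, ‖v j (k - l)‖ ≤ P (k - l) / Real.exp (τ * freqAbs (k - l)) := fun j => by
      rw [le_div_iff₀ (Real.exp_pos _), mul_comm]
      exact hvP j (k - l)
    have hk := norm_advection_kernel_le (l := l) hv'
    rw [norm_mul]
    have hP' := hP0 (k - l)
    have hn := freqAbs_nonneg l
    calc Real.exp (τ * freqAbs k) * (‖∑ j, v j (k - l) * (Complex.I * (l j : ℂ))‖ * ‖b l‖)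
        ≤ (Real.exp (τ * freqAbs (k - l)) * Real.exp (τ * freqAbs l)) *
          ((d * (P (k - l) / Real.exp (τ * freqAbs (k - l))) * freqAbs l) * ‖b l‖) := by
          gcongr
      _ = d * (P (k - l) * (freqAbs l * (Real.exp (τ * freqAbs l) * ‖b l‖))) := by
          field_simp
      _ ≤ d * (P (k - l) * Q l) := by
          have := hbQ l
          gcongr
  have hsn : Summable fun l => ‖(∑ j, v j (k - l) * (Complex.I * (l j : ℂ))) * b l‖ := by
    have : Summable fun l => Real.exp (τ * freqAbs k) *
      ‖(∑ j, v j (k - l) * (Complex.I * (l j : ℂ))) * b l‖ :=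
      Summable.of_nonneg_of_le (fun l => by positivity) hterm hs
    exact (summable_mul_left_iff (Real.exp_pos _).ne').mp this
  calc Real.exp (τ * freqAbs k) * ‖advection v b k‖
      ≤ Real.exp (τ * freqAbs k) * ∑' l, ‖(∑ j, v j (k - l) * (Complex.I * (l j : ℂ))) * b l‖ :=
        mul_le_mul_of_nonneg_left (norm_tsum_le_tsum_norm hsn) (Real.exp_pos _).le
    _ = ∑' l, Real.exp (τ * freqAbs k) *
          ‖(∑ j, v j (k - l) * (Complex.I * (l j : ℂ))) * b l‖ := by rw [tsum_mul_left]
    _ ≤ ∑' l, d * (P (k - l) * Q l) := (hsn.mul_left _).tsum_le_tsum hterm hs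
    _ = d * conv P Q k := by rw [tsum_mul_left]; rfl

end Convolution

/-! ### Scalar tools: shrinking radius, running maxima, quadratic inequalities. -/

section Calculus

/-- The smoothing effect of an analyticity radius that shrinks at speed `B`. -/
lemma shrinking_radius_bound {f f' : ℝ → ℂ} {T τ B κ G S : ℝ} (hB : 0 < B) (hκ : 0 < κ)
    (hS : 0 ≤ S) (hG : 0 ≤ G)
    (hf : ∀ t ∈ Set.Icc 0 T, HasDerivWithinAt f (f' t) (Set.Icc 0 T) t)
    (hb : ∀ t ∈ Set.Icc 0 T, Real.exp ((τ - B * t) * κ) * ‖f' t‖ ≤ G + S)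
    {t : ℝ} (ht : t ∈ Set.Icc 0 T) :
    κ * (Real.exp ((τ - B * t) * κ) * ‖f t‖)
      ≤ κ * (Real.exp (τ * κ) * ‖f 0‖) + G / B + T * (κ * S) := by
  -- A comparison function with H' ≥ ‖f'‖. The growing exponential exp(-(τ - B t)κ) has primitive
  -- itself divided by Bκ, which is the source of the gain on G; the part S is merely multiplied by
  -- time.
  set H : ℝ → ℝ := fun t => ‖f 0‖ + Real.exp (-((τ - B * t) * κ)) * (G / (B * κ) + S * t) with hH
  set H' : ℝ → ℝ := fun t => Real.exp (-((τ - B * t) * κ)) * (B * κ) * (G / (B * κ) + S * t)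
    + Real.exp (-((τ - B * t) * κ)) * S with hH'
  have hder : ∀ x, HasDerivAt H (H' x) x := by
    intro x
    have h1 : HasDerivAt (fun t : ℝ => -((τ - B * t) * κ)) (B * κ) x := by
      have := ((((hasDerivAt_id' x).const_mul B).const_sub τ).mul_const κ).fun_neg
      simpa using this
    have h2 : HasDerivAt (fun t : ℝ => G / (B * κ) + S * t) S x := by
      simpa using ((hasDerivAt_id x).const_mul S).const_add (G / (B * κ))
    exact (h1.exp.mul h2).const_add ‖f 0‖
  have key := image_norm_le_of_norm_deriv_right_le_deriv_boundary' (f := f) (f' := f')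
    (a := 0) (b := T) (B := H) (B' := H') (fun x hx => (hf x hx).continuousWithinAt)
    (fun x hx => (hf x (Set.Ico_subset_Icc_self hx)).mono_of_mem_nhdsWithin
      (Icc_mem_nhdsGE_of_mem hx)) (by
        simp only [hH]
        have : 0 ≤ Real.exp (-((τ - B * 0) * κ)) * (G / (B * κ) + S * 0) := by positivity
        linarith)
    (fun x _ => (hder x).continuousAt.continuousWithinAt)
    (fun x _ => (hder x).hasDerivWithinAt) (fun x hx => by
      have h := hb x (Set.Ico_subset_Icc_self hx)
      have hx0 : 0 ≤ x := hx.1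
      have h3 : ‖f' x‖ ≤ Real.exp (-((τ - B * x) * κ)) * (G + S) := by
        rw [Real.exp_neg, inv_mul_eq_div, le_div_iff₀ (Real.exp_pos _), mul_comm]
        exact h
      refine h3.trans ?_
      simp only [hH']
      have h4 : B * κ * (G / (B * κ) + S * x) = G + B * κ * S * x := by field_simp
      rw [mul_assoc, h4, ← mul_add]
      refine mul_le_mul_of_nonneg_left ?_ (Real.exp_pos _).le
      have : 0 ≤ B * κ * S * x := by positivity
      linarith) ht
  have ht0 : 0 ≤ t := ht.1
  have hE : Real.exp ((τ - B * t) * κ) * Real.exp (-((τ - B * t) * κ)) = 1 := by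
    rw [← Real.exp_add]; simp
  have hexp : Real.exp ((τ - B * t) * κ) ≤ Real.exp (τ * κ) := by
    refine Real.exp_le_exp.mpr (mul_le_mul_of_nonneg_right ?_ hκ.le)
    nlinarith
  calc κ * (Real.exp ((τ - B * t) * κ) * ‖f t‖)
      ≤ κ * (Real.exp ((τ - B * t) * κ) * H t) := by gcongr
    _ = κ * (Real.exp ((τ - B * t) * κ) * ‖f 0‖) + κ * (G / (B * κ) + S * t) := by
        simp only [hH]
        linear_combination κ * (G / (B * κ) + S * t) * hE
    _ ≤ κ * (Real.exp (τ * κ) * ‖f 0‖) + (G / B + T * (κ * S)) := by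
        have h5 : κ * (G / (B * κ) + S * t) = G / B + t * (κ * S) := by field_simp
        rw [h5]
        have := ht.2
        gcongr
    _ = _ := by ring

/-- The running maximum of a continuous function. -/
lemma exists_running_max {g : ℝ → ℝ} {T : ℝ} (hT : 0 ≤ T) (hg : ContinuousOn g (Set.Icc 0 T)) :
    ∃ y : ℝ → ℝ, ContinuousOn y (Set.Icc 0 T) ∧
      (∀ t ∈ Set.Icc 0 T, ∀ σ ∈ Set.Icc 0 t, g σ ≤ y t) ∧
      ∀ t ∈ Set.Icc 0 T, ∃ σ ∈ Set.Icc 0 t, y t = g σ := by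
  set g' : ℝ → ℝ := Set.IccExtend hT (Set.domRestrict (Set.Icc 0 T) g) with hg'
  have hc : Continuous g' := hg.domRestrict.Icc_extend'
  have hgg : ∀ σ ∈ Set.Icc 0 T, g' σ = g σ := fun σ hσ => by
    rw [hg', Set.IccExtend_of_mem hT _ hσ]; rfl
  have hK : IsCompact (Set.Icc (0 : ℝ) 1) := isCompact_Icc
  have hne : (Set.Icc (0 : ℝ) 1).Nonempty := ⟨0, by simp⟩
  have hcl : ∀ t, ContinuousOn (fun c : ℝ => g' (c * t)) (Set.Icc 0 1) := fun t => by fun_prop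
  -- The maximum over [0, t] is written as a maximum over the fixed compact interval [0, 1] of g'(c
  -- t), so that its continuity in t is a standard fact.
  refine ⟨fun t => sSup ((fun c : ℝ => g' (c * t)) '' Set.Icc 0 1), ?_, ?_, ?_⟩
  · exact (hK.continuous_sSup (f := fun t c => g' (c * t)) (by fun_prop)).continuousOn
  · intro t ht σ hσ
    obtain ⟨c, hc, hcσ⟩ : ∃ c ∈ Set.Icc (0 : ℝ) 1, c * t = σ := by
      rcases ht.1.eq_or_lt with h0 | h0
      · refine ⟨0, by simp, ?_⟩
        have := hσ.1; have := hσ.2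
        linarith
      · exact ⟨σ / t, ⟨div_nonneg hσ.1 h0.le, (div_le_one h0).mpr hσ.2⟩, div_mul_cancel₀ _ h0.ne'⟩
    rw [← hgg σ ⟨hσ.1, hσ.2.trans ht.2⟩, ← hcσ]
    exact le_csSup (hK.bddAbove_image (hcl t)) ⟨c, hc, rfl⟩
  · intro t ht
    obtain ⟨c, hc, hcs⟩ := hK.exists_sSup_image_eq hne (hcl t)
    have hmem : c * t ∈ Set.Icc 0 t :=
      ⟨mul_nonneg hc.1 ht.1, mul_le_of_le_one_left ht.1 hc.2⟩
    exact ⟨c * t, hmem, hcs.trans (by rw [hgg _ ⟨hmem.1, hmem.2.trans ht.2⟩])⟩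

/-- A continuous quantity with `Z ≤ c + b Z²` and `4 b c < 1` that starts below `2 c` stays there. -/
lemma le_two_mul_of_quadratic {Z : ℝ → ℝ} {T b c : ℝ} (hZ : ContinuousOn Z (Set.Icc 0 T))
    (hc : 0 < c) (hb : 4 * b * c < 1) (h0 : Z 0 ≤ c)
    (h : ∀ t ∈ Set.Icc 0 T, Z t ≤ c + b * Z t ^ 2) {t : ℝ} (ht : t ∈ Set.Icc 0 T) :
    Z t ≤ 2 * c := by
  by_contra! hlt
  have hsub : Set.Icc 0 t ⊆ Set.Icc 0 T := Set.Icc_subset_Icc le_rfl ht.2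
  -- To exceed 2c the function would have to take the value 2c, where the inequality reads 2c ≤ c +
  -- 4bc², contradicting 4bc < 1.
  obtain ⟨σ, hσ, hσ2⟩ := intermediate_value_Icc ht.1 (hZ.mono hsub)
    (show 2 * c ∈ Set.Icc (Z 0) (Z t) from ⟨by linarith, hlt.le⟩)
  have := h σ (hsub hσ)
  rw [hσ2] at this
  nlinarith

end Calculus

/-! ### A priori bound and stability with a shrinking analyticity radius. -/

section Analytic

variable {d : ℕ}

lemma continuousOn_analytic_weight {a : ℝ → (Fin d → ℤ) → ℂ} {T τ B : ℝ} {k : Fin d → ℤ}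
    (ha : ContinuousOn (fun t => a t k) (Set.Icc 0 T)) :
    ContinuousOn (fun t => freqAbs k * (Real.exp ((τ - B * t) * freqAbs k) * ‖a t k‖))
      (Set.Icc 0 T) :=
  continuousOn_const.mul ((Continuous.continuousOn (by fun_prop)).mul ha.norm)

/-- A priori bound in analytic norms, uniform in the solution. -/
lemma analytic_bound {T τ τ' B V c M : ℝ} (hT : 0 < T) (hB : 0 < B) (hV : 0 ≤ V) (hττ' : τ < τ')
    (hBT : B * T ≤ τ) (hc : 0 < c) (hsmall : 4 * (d * V / B) * c < 1)
    {v : ℝ → Fin d → (Fin d → ℤ) → ℂ} {a : ℝ → (Fin d → ℤ) → ℂ} {S : (Fin d → ℤ) → ℂ}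
    (hder : ∀ k, ∀ t ∈ Set.Icc 0 T, HasDerivWithinAt (fun t => a t k)
      (S k - advection (v t) (a t) k) (Set.Icc 0 T) t)
    (hv : ∀ t ∈ Set.Icc 0 T, ∀ j k, ‖v t j k‖ ≤ V * (freqAbs k * ‖a t k‖))
    (hM : ∀ t ∈ Set.Icc 0 T, ∀ k, k ≠ 0 → ‖a t k‖ ≤ M * Real.exp (-τ' * freqAbs k))
    (hs0 : Summable fun k => freqAbs k * (Real.exp (τ * freqAbs k) * ‖a 0 k‖))
    (hsS : Summable fun k => freqAbs k * (Real.exp (τ * freqAbs k) * ‖S k‖))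
    (hcb : ∑' k, freqAbs k * (Real.exp (τ * freqAbs k) * ‖a 0 k‖)
      + T * ∑' k, freqAbs k * (Real.exp (τ * freqAbs k) * ‖S k‖) ≤ c) :
    ∃ Y : (Fin d → ℤ) → ℝ, (∀ k, 0 ≤ Y k) ∧ Summable Y ∧ ∑' k, Y k ≤ 2 * c ∧
      ∀ t ∈ Set.Icc 0 T, ∀ k,
        freqAbs k * (Real.exp ((τ - B * t) * freqAbs k) * ‖a t k‖) ≤ Y k := by
  set g : (Fin d → ℤ) → ℝ → ℝ := fun k t =>
    freqAbs k * (Real.exp ((τ - B * t) * freqAbs k) * ‖a t k‖) with hg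
  have hg0 : ∀ k t, 0 ≤ g k t := fun k t =>
    mul_nonneg (freqAbs_nonneg k) (mul_nonneg (Real.exp_pos _).le (norm_nonneg _))
  have hgc : ∀ k, ContinuousOn (g k) (Set.Icc 0 T) := fun k =>
    continuousOn_analytic_weight fun t ht => (hder k t ht).continuousWithinAt
  -- The running maximum is taken at each frequency before summing. The convolution of these maxima
  -- then bounds the nonlinearity at all earlier times by a constant, as `shrinking_radius_bound`
  -- requires.
  choose y hyc hyle hyatt using fun k => exists_running_max hT.le (hgc k)
  have hy0 : ∀ k, ∀ t ∈ Set.Icc 0 T, 0 ≤ y k t := fun k t ht => by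
    obtain ⟨σ, -, h⟩ := hyatt k t ht
    rw [h]; exact hg0 k σ
  -- A qualitative majorant, coming from the larger radius τ' and possibly different for each
  -- solution. It gives continuity in time of the summed maxima but does not enter the final bound.
  set W : (Fin d → ℤ) → ℝ := fun k => M * (freqAbs k * Real.exp (-(τ' - τ) * freqAbs k)) with hW
  have hWs : Summable W := by
    have := summable_freqAbs_rpow_mul_exp (d := d) (c := τ' - τ) (q := 1) (p := 1)
      (by linarith) one_pos zero_le_one
    simp only [Real.rpow_one] at this
    exact this.mul_left M
  have hgW : ∀ k, ∀ t ∈ Set.Icc 0 T, g k t ≤ W k := by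
    intro k t ht
    by_cases hk : k = 0
    · subst hk; simp [hg, hW, freqAbs_zero]
    · have hn := freqAbs_nonneg k
      have h1 : Real.exp ((τ - B * t) * freqAbs k) ≤ Real.exp (τ * freqAbs k) := by
        refine Real.exp_le_exp.mpr (mul_le_mul_of_nonneg_right ?_ hn)
        nlinarith [ht.1]
      calc g k t ≤ freqAbs k * (Real.exp (τ * freqAbs k) * (M * Real.exp (-τ' * freqAbs k))) := by
            have := hM t ht k hk
            simp only [hg]
            gcongr
        _ = W k := by
            simp only [hW]
            rw [show -(τ' - τ) * freqAbs k = τ * freqAbs k + -τ' * freqAbs k by ring, Real.exp_add]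
            ring
  have hyW : ∀ k, ∀ t ∈ Set.Icc 0 T, y k t ≤ W k := fun k t ht => by
    obtain ⟨σ, hσ, h⟩ := hyatt k t ht
    rw [h]; exact hgW k σ ⟨hσ.1, hσ.2.trans ht.2⟩
  have hys : ∀ t ∈ Set.Icc 0 T, Summable fun k => y k t := fun t ht =>
    Summable.of_nonneg_of_le (fun k => hy0 k t ht) (fun k => hyW k t ht) hWs
  have hZc : ContinuousOn (fun t => ∑' k, y k t) (Set.Icc 0 T) :=
    continuousOn_tsum hyc hWs fun k t ht => by
      rw [Real.norm_of_nonneg (hy0 k t ht)]; exact hyW k t ht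
  have h00 : (0 : ℝ) ∈ Set.Icc 0 T := Set.left_mem_Icc.mpr hT.le
  have hTT : T ∈ Set.Icc 0 T := Set.right_mem_Icc.mpr hT.le
  have hSs0 : 0 ≤ ∑' k, freqAbs k * (Real.exp (τ * freqAbs k) * ‖S k‖) :=
    tsum_nonneg fun k => mul_nonneg (freqAbs_nonneg k) (by positivity)
  have hmain : ∀ t ∈ Set.Icc 0 T,
      ∑' k, y k t ≤ c + (d * V / B) * (∑' k, y k t) ^ 2 := by
    intro t ht
    have htT : Set.Icc 0 t ⊆ Set.Icc 0 T := Set.Icc_subset_Icc le_rfl ht.2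
    have hVy0 : ∀ k, 0 ≤ V * y k t := fun k => mul_nonneg hV (hy0 k t ht)
    have hVys : Summable fun k => V * y k t := (hys t ht).mul_left V
    have hpt : ∀ k, y k t ≤ freqAbs k * (Real.exp (τ * freqAbs k) * ‖a 0 k‖)
        + d * conv (fun k => V * y k t) (fun k => y k t) k / B
        + T * (freqAbs k * (Real.exp (τ * freqAbs k) * ‖S k‖)) := by
      intro k
      have hcn : 0 ≤ conv (fun k => V * y k t) (fun k => y k t) k :=
        conv_nonneg hVy0 (fun k => hy0 k t ht) k
      obtain ⟨σ, hσ, h⟩ := hyatt k t ht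
      by_cases hk : k = 0
      · rw [h]
        subst hk
        simp only [hg, freqAbs_zero, zero_mul, mul_zero, zero_add, add_zero]
        positivity
      · rw [h]
        -- The estimate is made on [0, t] and read at the time σ where the maximum is attained.
        have hbd := shrinking_radius_bound (f := fun t => a t k)
          (f' := fun t => S k - advection (v t) (a t) k) (T := t) (τ := τ) (B := B)
          (κ := freqAbs k) (G := d * conv (fun k => V * y k t) (fun k => y k t) k)
          (S := Real.exp (τ * freqAbs k) * ‖S k‖) hB (freqAbs_pos hk) (by positivity)
          (by positivity) (fun x hx => (hder k x (htT hx)).mono htT) (fun x hx => by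
            have hx0 := hx.1
            have hxT := (htT hx).2
            have h1 := exp_mul_norm_advection_le (v := v x) (b := a x)
              (P := fun k => V * y k t) (Q := fun k => y k t) (τ := τ - B * x)
              (by nlinarith) hVy0 hVys (hys t ht) (fun j l => by
                have h2 := hyle l t ht x hx
                have h3 := hv x (htT hx) j l
                calc Real.exp ((τ - B * x) * freqAbs l) * ‖v x j l‖
                    ≤ Real.exp ((τ - B * x) * freqAbs l) * (V * (freqAbs l * ‖a x l‖)) := by
                      gcongr
                  _ = V * g l x := by simp only [hg]; ring
                  _ ≤ V * y l t := by gcongr) (fun l => hyle l t ht x hx) k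
            have h4 : Real.exp ((τ - B * x) * freqAbs k) ≤ Real.exp (τ * freqAbs k) := by
              refine Real.exp_le_exp.mpr (mul_le_mul_of_nonneg_right ?_ (freqAbs_nonneg k))
              nlinarith
            calc Real.exp ((τ - B * x) * freqAbs k) * ‖S k - advection (v x) (a x) k‖
                ≤ Real.exp ((τ - B * x) * freqAbs k) * (‖S k‖ + ‖advection (v x) (a x) k‖) := by
                  gcongr; exact norm_sub_le _ _
              _ = Real.exp ((τ - B * x) * freqAbs k) * ‖advection (v x) (a x) k‖
                  + Real.exp ((τ - B * x) * freqAbs k) * ‖S k‖ := by ring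
              _ ≤ _ := by gcongr) hσ
        refine hbd.trans ?_
        have h5 : 0 ≤ freqAbs k * (Real.exp (τ * freqAbs k) * ‖S k‖) :=
          mul_nonneg (freqAbs_nonneg k) (by positivity)
        have := ht.2
        gcongr
    have hcs : Summable (conv (fun k => V * y k t) (fun k => y k t)) :=
      summable_conv hVy0 (fun k => hy0 k t ht) hVys (hys t ht)
    have hs1 := (hcs.mul_left (d : ℝ)).div_const B
    have hs2 := hsS.mul_left T
    have := (hys t ht).tsum_le_tsum hpt ((hs0.add hs1).add hs2)
    rw [(hs0.add hs1).tsum_add hs2, hs0.tsum_add hs1, tsum_div_const, tsum_mul_left, tsum_mul_left,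
      tsum_conv hVy0 (fun k => hy0 k t ht) hVys (hys t ht), tsum_mul_left] at this
    have e : (d : ℝ) * (V * ∑' k, y k t) * (∑' k, y k t) / B
        = (d * V / B) * (∑' k, y k t) ^ 2 := by ring
    rw [← mul_assoc (d : ℝ), e] at this
    linarith
  have hZ0 : ∑' k, y k 0 ≤ c := by
    have h1 : ∀ k, y k 0 = freqAbs k * (Real.exp (τ * freqAbs k) * ‖a 0 k‖) := by
      intro k
      obtain ⟨σ, hσ, h⟩ := hyatt k 0 h00
      have : σ = 0 := le_antisymm hσ.2 hσ.1
      rw [h, this]; simp [hg]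
    simp only [h1]
    have := mul_nonneg hT.le hSs0
    linarith
  refine ⟨fun k => y k T, fun k => hy0 k T hTT, hys T hTT,
    le_two_mul_of_quadratic hZc hc hsmall hZ0 hmain hTT, fun t ht k => hyle k T hTT t ht⟩

/-- Stability in analytic norms. -/
lemma analytic_difference {T τ B V R : ℝ} (hT : 0 < T) (hB : 0 < B) (hV : 0 ≤ V)
    (hBT : B * T ≤ τ) (hsmall : d * V * R / B ≤ 1 / 4)
    {v v' : ℝ → Fin d → (Fin d → ℤ) → ℂ} {a a' : ℝ → (Fin d → ℤ) → ℂ} {S : (Fin d → ℤ) → ℂ}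
    (hder : ∀ k, ∀ t ∈ Set.Icc 0 T, HasDerivWithinAt (fun t => a t k)
      (S k - advection (v t) (a t) k) (Set.Icc 0 T) t)
    (hder' : ∀ k, ∀ t ∈ Set.Icc 0 T, HasDerivWithinAt (fun t => a' t k)
      (S k - advection (v' t) (a' t) k) (Set.Icc 0 T) t)
    (hinit : ∀ k, a 0 k = a' 0 k)
    (hv : ∀ t ∈ Set.Icc 0 T, ∀ j k, ‖v t j k‖ ≤ V * (freqAbs k * ‖a t k‖))
    (hv' : ∀ t ∈ Set.Icc 0 T, ∀ j k, ‖v' t j k‖ ≤ V * (freqAbs k * ‖a' t k‖))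
    {δ : (Fin d → ℤ) → ℝ} (hδ0 : ∀ k, 0 ≤ δ k)
    (hvv' : ∀ t ∈ Set.Icc 0 T, ∀ j k, ‖v t j k - v' t j k‖
      ≤ V * (freqAbs k * ‖a t k - a' t k‖) + δ k * (freqAbs k * ‖a' t k‖))
    {Y Y' : (Fin d → ℤ) → ℝ} (hYs : Summable Y) (hYs' : Summable Y')
    (hYR : ∑' k, Y k ≤ R) (hYR' : ∑' k, Y' k ≤ R) (hδs : Summable fun k => δ k * Y' k)
    (hY : ∀ t ∈ Set.Icc 0 T, ∀ k,
        freqAbs k * (Real.exp ((τ - B * t) * freqAbs k) * ‖a t k‖) ≤ Y k)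
    (hY' : ∀ t ∈ Set.Icc 0 T, ∀ k,
        freqAbs k * (Real.exp ((τ - B * t) * freqAbs k) * ‖a' t k‖) ≤ Y' k)
    {t : ℝ} (ht : t ∈ Set.Icc 0 T) (k : Fin d → ℤ) :
    freqAbs k * (Real.exp ((τ - B * t) * freqAbs k) * ‖a t k - a' t k‖)
      ≤ 2 * (d * R / B) * ∑' k, δ k * Y' k := by
  have hTT : T ∈ Set.Icc 0 T := Set.right_mem_Icc.mpr hT.le
  have hnn : ∀ (k : Fin d → ℤ) (x y : ℝ), 0 ≤ y → 0 ≤ freqAbs k * (Real.exp x * y) :=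
    fun k x y hy => mul_nonneg (freqAbs_nonneg k) (mul_nonneg (Real.exp_pos _).le hy)
  have hY0 : ∀ k, 0 ≤ Y k := fun k => (hnn _ _ _ (norm_nonneg _)).trans (hY T hTT k)
  have hY0' : ∀ k, 0 ≤ Y' k := fun k => (hnn _ _ _ (norm_nonneg _)).trans (hY' T hTT k)
  have hR0 : 0 ≤ R := (tsum_nonneg hY0).trans hYR
  set g : (Fin d → ℤ) → ℝ → ℝ := fun k t =>
    freqAbs k * (Real.exp ((τ - B * t) * freqAbs k) * ‖a t k - a' t k‖) with hg
  have hg0 : ∀ k t, 0 ≤ g k t := fun k t => hnn _ _ _ (norm_nonneg _)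
  have hgc : ∀ k, ContinuousOn (g k) (Set.Icc 0 T) := fun k =>
    continuousOn_analytic_weight (a := fun t k => a t k - a' t k) fun t ht =>
      ((hder k t ht).continuousWithinAt.sub (hder' k t ht).continuousWithinAt)
  choose y hyc hyle hyatt using fun k => exists_running_max hT.le (hgc k)
  set D : (Fin d → ℤ) → ℝ := fun k => y k T with hD
  have hgD : ∀ k, ∀ t ∈ Set.Icc 0 T, g k t ≤ D k := fun k t ht => hyle k T hTT t ht
  have hD0 : ∀ k, 0 ≤ D k := fun k => (hg0 k T).trans (hgD k T hTT)
  -- This crude bound makes the sum of D finite, without which D could not be absorbed into the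
  -- left-hand side at the end.
  have hDY : ∀ k, D k ≤ Y k + Y' k := by
    intro k
    obtain ⟨σ, hσ, h⟩ := hyatt k T hTT
    rw [hD]; simp only; rw [h]
    have hn := freqAbs_nonneg k
    calc g k σ ≤ freqAbs k * (Real.exp ((τ - B * σ) * freqAbs k) * (‖a σ k‖ + ‖a' σ k‖)) := by
          simp only [hg]
          gcongr; exact norm_sub_le _ _
      _ ≤ Y k + Y' k := by
          have := hY σ hσ k
          have := hY' σ hσ k
          linarith
  have hDs : Summable D := Summable.of_nonneg_of_le hD0 hDY (hYs.add hYs')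
  have hE0 : ∀ k, 0 ≤ δ k * Y' k := fun k => mul_nonneg (hδ0 k) (hY0' k)
  have hVs : Summable fun k => V * Y k := hYs.mul_left V
  have hV0 : ∀ k, 0 ≤ V * Y k := fun k => mul_nonneg hV (hY0 k)
  have hVs' : Summable fun k => V * Y' k := hYs'.mul_left V
  have hV0' : ∀ k, 0 ≤ V * Y' k := fun k => mul_nonneg hV (hY0' k)
  have hQs : Summable fun k => V * D k + δ k * Y' k := (hDs.mul_left V).add hδs
  have hQ0 : ∀ k, 0 ≤ V * D k + δ k * Y' k := fun k => add_nonneg (mul_nonneg hV (hD0 k)) (hE0 k)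
  set G : (Fin d → ℤ) → ℝ := fun k => d * conv (fun k => V * Y k) D k
    + d * conv (fun k => V * D k + δ k * Y' k) Y' k with hG
  have hG0 : ∀ k, 0 ≤ G k := fun k => by
    have h1 := conv_nonneg hV0 hD0 k
    have h2 := conv_nonneg hQ0 hY0' k
    positivity
  have hpt : ∀ k, D k ≤ G k / B := by
    intro k
    obtain ⟨σ, hσ, h⟩ := hyatt k T hTT
    rw [hD]; simp only; rw [h]
    by_cases hk : k = 0
    · subst hk
      simp only [hg, freqAbs_zero, zero_mul]
      exact div_nonneg (hG0 0) hB.le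
    · have hbd := shrinking_radius_bound (f := fun t => a t k - a' t k)
          (f' := fun t => (S k - advection (v t) (a t) k) - (S k - advection (v' t) (a' t) k))
          (T := T) (τ := τ) (B := B)
          (κ := freqAbs k) (G := G k)
          (S := 0) hB (freqAbs_pos hk) le_rfl
          (hG0 k) (fun x hx => (hder k x hx).sub (hder' k x hx)) (fun x hx => by
            have hx0 := hx.1
            have hxT := hx.2
            have hτx : 0 ≤ τ - B * x := by nlinarith
            have hexp1 : ∀ l : Fin d → ℤ, 1 ≤ Real.exp ((τ - B * x) * freqAbs l) := fun l =>
              Real.one_le_exp (mul_nonneg hτx (freqAbs_nonneg l))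
            have hle : ∀ (l : Fin d → ℤ) (z : ℂ), freqAbs l * ‖z‖
                ≤ freqAbs l * (Real.exp ((τ - B * x) * freqAbs l) * ‖z‖) := fun l z =>
              mul_le_mul_of_nonneg_left (le_mul_of_one_le_left (norm_nonneg _) (hexp1 l))
                (freqAbs_nonneg l)
            have hva : ∀ j l, ‖v x j l‖ ≤ V * Y l := fun j l => (hv x hx j l).trans
              (mul_le_mul_of_nonneg_left ((hle l _).trans (hY x hx l)) hV)
            have hva' : ∀ j l, ‖v' x j l‖ ≤ V * Y' l := fun j l => (hv' x hx j l).trans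
              (mul_le_mul_of_nonneg_left ((hle l _).trans (hY' x hx l)) hV)
            have hadv := advection_sub (k := k)
              (summable_advection hV0 hVs hYs hva (fun l => (hle l _).trans (hY x hx l)) k)
              (summable_advection hV0' hVs' hYs' hva' (fun l => (hle l _).trans (hY' x hx l)) k)
              (summable_advection hV0 hVs hYs' hva (fun l => (hle l _).trans (hY' x hx l)) k)
            have h1 := exp_mul_norm_advection_le (v := v x) (b := fun l => a x l - a' x l)
              hτx hV0 hVs hDs (fun j l => by
                calc Real.exp ((τ - B * x) * freqAbs l) * ‖v x j l‖
                    ≤ Real.exp ((τ - B * x) * freqAbs l) * (V * (freqAbs l * ‖a x l‖)) := by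
                      gcongr; exact hv x hx j l
                  _ = V * (freqAbs l * (Real.exp ((τ - B * x) * freqAbs l) * ‖a x l‖)) := by ring
                  _ ≤ V * Y l := by gcongr; exact hY x hx l) (fun l => hgD l x hx) k
            have h2 := exp_mul_norm_advection_le (v := fun j l => v x j l - v' x j l) (b := a' x)
              hτx hQ0 hQs hYs' (fun j l => by
                calc Real.exp ((τ - B * x) * freqAbs l) * ‖v x j l - v' x j l‖
                    ≤ Real.exp ((τ - B * x) * freqAbs l) * (V * (freqAbs l * ‖a x l - a' x l‖)
                        + δ l * (freqAbs l * ‖a' x l‖)) := by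
                      gcongr; exact hvv' x hx j l
                  _ = V * g l x + δ l *
                      (freqAbs l * (Real.exp ((τ - B * x) * freqAbs l) * ‖a' x l‖)) := by
                      simp only [hg]; ring
                  _ ≤ V * D l + δ l * Y' l := by
                      have := hgD l x hx
                      have := hY' x hx l
                      have := hδ0 l
                      gcongr) (fun l => hY' x hx l) k
            rw [show (S k - advection (v x) (a x) k) - (S k - advection (v' x) (a' x) k)
              = -(advection (v x) (a x) k - advection (v' x) (a' x) k) by ring, norm_neg, hadv]
            calc _ ≤ Real.exp ((τ - B * x) * freqAbs k) *
                  (‖advection (v x) (fun l => a x l - a' x l) k‖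
                    + ‖advection (fun j l => v x j l - v' x j l) (a' x) k‖) := by
                  gcongr; exact norm_add_le _ _
              _ ≤ G k + 0 := by rw [mul_add, add_zero]; exact add_le_add h1 h2) hσ
      simp only [hinit, sub_self, norm_zero, mul_zero, zero_add, add_zero] at hbd
      exact hbd
  have hc1 := (summable_conv hV0 hD0 hVs hDs).mul_left (d : ℝ)
  have hc2 := (summable_conv hQ0 hY0' hQs hYs').mul_left (d : ℝ)
  have hsum := hDs.tsum_le_tsum hpt ((hc1.add hc2).div_const B)
  rw [tsum_div_const, hc1.tsum_add hc2, tsum_mul_left, tsum_mul_left, tsum_conv hV0 hD0 hVs hDs,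
    tsum_conv hQ0 hY0' hQs hYs', tsum_mul_left, (hDs.mul_left V).tsum_add hδs, tsum_mul_left] at hsum
  set X := ∑' k, D k
  set E := ∑' k, δ k * Y' k
  have hX0 : 0 ≤ X := tsum_nonneg hD0
  have hE : 0 ≤ E := tsum_nonneg hE0
  -- Both convolutions contain X with coefficient at most d V R / B ≤ 1/4; together they are
  -- absorbed as X/2.
  have hX : X ≤ 2 * (d * R / B) * E := by
    have h1 : (d * (V * (∑' k, Y k) * X) + d * ((V * X + E) * ∑' k, Y' k)) / B
        ≤ (d * (V * R * X) + d * ((V * X + E) * R)) / B := by gcongr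
    have h2 : (d * (V * R * X) + d * ((V * X + E) * R)) / B
        = 2 * (d * V * R / B) * X + (d * R / B) * E := by ring
    have h3 : 2 * (d * V * R / B) * X ≤ 2 * (1 / 4) * X := by gcongr
    linarith
  exact (hgD k t ht).trans ((hDs.le_tsum k fun l _ => hD0 l).trans hX)

end Analytic

/-! ### Gevrey solutions: flow, convergence in norm, and the analytic case s = 1. -/

section GevreyCase

variable {d : ℕ}

lemma summable_sq_of_summable {ι : Type*} {w : ι → ℝ} (h0 : ∀ i, 0 ≤ w i) (h : Summable w) :
    Summable fun i => w i ^ 2 := by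
  refine Summable.of_nonneg_of_le (fun i => sq_nonneg _) (fun i => ?_) (h.mul_left (∑' i, w i))
  rw [sq]
  exact mul_le_mul_of_nonneg_right (h.le_tsum i fun j _ => h0 j) (h0 i)

lemma IsL2MeanZero.fourierCoef_zero {f : Torus d → ℝ} (hf : IsL2MeanZero f) :
    fourierCoef f 0 = 0 := by
  rw [_root_.fourierCoef_zero, hf.2]; simp

lemma norm_velCoef_le_freqAbs {m : SymbolMatrix d} {C : ℝ} (hC : ∀ i j k, ‖m i j k‖ ≤ C)
    (a : (Fin d → ℤ) → ℂ) (j : Fin d) (k : Fin d → ℤ) :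
    ‖velCoef m a j k‖ ≤ (d * C) * (freqAbs k * ‖a k‖) := by
  refine (norm_velCoef_le a j k fun i => norm_coord_mul_le k i (hC i j k)).trans (le_of_eq ?_)
  ring

/-- The total symbol difference at a frequency. -/
noncomputable def symbolGap (m m' : SymbolMatrix d) (k : Fin d → ℤ) : ℝ :=
  ∑ i, ∑ j, ‖m i j k - m' i j k‖

lemma symbolGap_nonneg (m m' : SymbolMatrix d) (k : Fin d → ℤ) : 0 ≤ symbolGap m m' k :=
  Finset.sum_nonneg fun _ _ => Finset.sum_nonneg fun _ _ => norm_nonneg _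

lemma symbolGap_le {m m' : SymbolMatrix d} {C : ℝ} {k : Fin d → ℤ} (h : ∀ i j, ‖m i j k‖ ≤ C)
    (h' : ∀ i j, ‖m' i j k‖ ≤ C) : symbolGap m m' k ≤ d * (d * (C + C)) := by
  calc symbolGap m m' k ≤ ∑ _i : Fin d, ∑ _j : Fin d, (C + C) :=
        Finset.sum_le_sum fun i _ => Finset.sum_le_sum fun j _ =>
          (norm_sub_le _ _).trans (add_le_add (h i j) (h' i j))
    _ = d * (d * (C + C)) := by simp [mul_add]

lemma tendsto_symbolGap {m : ℝ → SymbolMatrix d} (hm : SymbolsConverge m) (k : Fin d → ℤ) :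
    Tendsto (fun ν => symbolGap (m ν) (m 0) k) (𝓝[>] 0) (𝓝 0) := by
  have : Tendsto (fun ν => ∑ i, ∑ j, ‖m ν i j k - m 0 i j k‖) (𝓝[>] 0)
      (𝓝 (∑ _i : Fin d, ∑ _j : Fin d, (0 : ℝ))) :=
    tendsto_finsetSum _ fun i _ => tendsto_finsetSum _ fun j _ => hm.tendsto i j k
  simpa [symbolGap] using this

lemma velCoef_sub (m m' : SymbolMatrix d) (a a' : (Fin d → ℤ) → ℂ) (j : Fin d) (k : Fin d → ℤ) :
    velCoef m a j k - velCoef m' a' j k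
      = velCoef m (fun k => a k - a' k) j k + velCoef (fun i j k => m i j k - m' i j k) a' j k := by
  unfold velCoef
  rw [← Finset.sum_sub_distrib, ← Finset.sum_add_distrib]
  exact Finset.sum_congr rfl fun i _ => by ring

lemma norm_velCoef_gap_le (m m' : SymbolMatrix d) (a : (Fin d → ℤ) → ℂ) (j : Fin d)
    (k : Fin d → ℤ) :
    ‖velCoef (fun i j k => m i j k - m' i j k) a j k‖
      ≤ symbolGap m m' k * (freqAbs k * ‖a k‖) := by
  unfold velCoef
  refine (norm_sum_le _ _).trans ?_
  unfold symbolGap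
  rw [Finset.sum_mul]
  refine Finset.sum_le_sum fun i _ => ?_
  have h1 : ‖m i j k - m' i j k‖ ≤ ∑ j, ‖m i j k - m' i j k‖ :=
    Finset.single_le_sum (f := fun j => ‖m i j k - m' i j k‖) (fun _ _ => norm_nonneg _)
      (Finset.mem_univ j)
  rw [norm_mul, norm_mul, norm_mul, Complex.norm_I, one_mul, Complex.norm_intCast]
  have h2 := abs_coord_le_freqAbs k i
  have h3 := freqAbs_nonneg k
  calc |(k i : ℝ)| * (‖m i j k - m' i j k‖ * ‖a k‖)
      ≤ freqAbs k * ((∑ j, ‖m i j k - m' i j k‖) * ‖a k‖) := by gcongr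
    _ = _ := by ring

/-- Gevrey-class solutions: decay of the coefficients and the classical equation for them. -/
lemma IsGevreySolution.flow {m : SymbolMatrix d} (hm : DoubleDivFree m) {C : ℝ}
    (hC : ∀ i j k, ‖m i j k‖ ≤ C) {θ₀ S : Torus d → ℝ} {s r T τ : ℝ} (hs : 1 ≤ s) (hr : 0 ≤ r)
    (hT : 0 < T) (hτ : 0 < τ) {θ : ℝ → Torus d → ℝ} (h : IsGevreySolution m θ₀ S s r T τ θ)
    (h₀ : IsL2MeanZero θ₀) (hS : IsL2MeanZero S) {k : Fin d → ℤ} {t : ℝ}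
    (ht : t ∈ Set.Icc 0 T) :
    HasDerivWithinAt (fun t => fourierCoef (θ t) k)
      (fourierCoef S k - advection (velCoef m (fourierCoef (θ t))) (fourierCoef (θ t)) k)
      (Set.Icc 0 T) t := by
  obtain ⟨hsol, M, hM⟩ := h
  have hd0 : (0 : ℝ) ≤ d * |C| := by positivity
  have hC' : ∀ i j k, ‖m i j k‖ ≤ |C| := fun i j k => (hC i j k).trans (le_abs_self C)
  have hq : (0 : ℝ) < 1 / s := by positivity
  -- One majorant for both purposes: the first summand bounds the coefficients of θ, the second,
  -- with its extra factor |k|, those of the velocity.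
  set w : (Fin d → ℤ) → ℝ := fun k => (freqAbs k ^ (0 : ℝ) * Real.exp (-τ * freqAbs k ^ (1 / s))
    + (d * |C|) * (freqAbs k ^ (1 : ℝ) * Real.exp (-τ * freqAbs k ^ (1 / s)))) * |M| with hw
  have hw0 : ∀ k, 0 ≤ w k := fun k => by
    have := freqAbs_nonneg k
    positivity
  have hws : Summable w := ((summable_freqAbs_rpow_mul_exp hτ hq le_rfl).add
    ((summable_freqAbs_rpow_mul_exp hτ hq zero_le_one).mul_left _)).mul_right _
  have hdec : ∀ t ∈ Set.Icc 0 T, ∀ k, k ≠ 0 →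
      ‖fourierCoef (θ t) k‖ ≤ |M| * Real.exp (-τ * freqAbs k ^ (1 / s)) := fun t ht k hk =>
    norm_fourierCoef_le_of_gevreyNorm hr (hM t ht) hk
  have ha0 : ∀ t ∈ Set.Icc 0 T, fourierCoef (θ t) 0 = 0 := fun t ht =>
    (hsol.1 t ht).fourierCoef_zero
  have hvb : ∀ t ∈ Set.Icc 0 T, ∀ j k, ‖velCoef m (fourierCoef (θ t)) j k‖ ≤ w k := by
    intro t ht j k
    refine (norm_velCoef_le_freqAbs hC' _ j k).trans ?_
    by_cases hk : k = 0
    · rw [hk, ha0 t ht]; simpa using hw0 0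
    · have h1 := hdec t ht k hk
      have h2 := freqAbs_nonneg k
      have h3 : (0 : ℝ) ≤ Real.exp (-τ * freqAbs k ^ (1 / s)) * |M| := by positivity
      simp only [hw, Real.rpow_zero, Real.rpow_one, one_mul]
      calc d * |C| * (freqAbs k * ‖fourierCoef (θ t) k‖)
          ≤ d * |C| * (freqAbs k * (|M| * Real.exp (-τ * freqAbs k ^ (1 / s)))) := by gcongr
        _ ≤ _ := by linarith
  refine hsol.hasDerivWithinAt_fourierCoef hm hT h₀ hS (w := w) (summable_sq_of_summable hw0 hws)
    (fun t ht k => ?_) hvb (fun t ht j => ?_) k ht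
  · by_cases hk : k = 0
    · rw [hk, ha0 t ht, norm_zero]; exact hw0 0
    · refine (hdec t ht k hk).trans ?_
      have h2 := freqAbs_nonneg k
      simp only [hw, Real.rpow_zero, one_mul]
      have h3 : (0 : ℝ) ≤ (d * |C|) * (freqAbs k ^ (1 : ℝ) *
        Real.exp (-τ * freqAbs k ^ (1 / s))) * |M| := by positivity
      linarith
  · exact Summable.of_nonneg_of_le (fun k => norm_nonneg _) (fun k => hvb t ht j k) hws

/-- Uniform Gevrey decay and convergence of the coefficients give convergence in Gevrey norm. -/
lemma tendsto_gevreyNorm {s r τ τ' M : ℝ} (hs : 1 ≤ s) (hr : 0 ≤ r) (hττ' : τ < τ')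
    {f : ℝ → Torus d → ℝ} {f₀ : Torus d → ℝ} (hf : ∀ ν ∈ Set.Icc (0 : ℝ) 1, Integrable (f ν) volume)
    (hf₀ : Integrable f₀ volume)
    (hM : ∀ ν ∈ Set.Icc (0 : ℝ) 1, ∀ k, k ≠ 0 →
      ‖fourierCoef (f ν) k - fourierCoef f₀ k‖ ≤ M * Real.exp (-τ' * freqAbs k ^ (1 / s)))
    (hconv : ∀ k, Tendsto (fun ν => fourierCoef (f ν) k) (𝓝[>] 0) (𝓝 (fourierCoef f₀ k))) :
    Tendsto (fun ν => gevreyNorm s r τ (fun x => f ν x - f₀ x)) (𝓝[>] 0) (𝓝 0) := by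
  have hq : (0 : ℝ) < 1 / s := by positivity
  have hIcc : ∀ᶠ ν : ℝ in 𝓝[>] 0, ν ∈ Set.Icc (0 : ℝ) 1 :=
    mem_of_superset (Ioc_mem_nhdsGT one_pos) Set.Ioc_subset_Icc_self
  set x : ℝ → {k : Fin d → ℤ // k ≠ 0} → ℝ := fun ν k =>
    freqAbs k.1 ^ (2 * r) * Real.exp (2 * τ * freqAbs k.1 ^ (1 / s))
      * ‖fourierCoef (f ν) k.1 - fourierCoef f₀ k.1‖ ^ 2 with hx
  have hx0 : ∀ ν k, 0 ≤ x ν k := fun ν k => by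
    have := freqAbs_nonneg k.1
    positivity
  have heq : (fun ν => (∑' k, ENNReal.ofReal (x ν k)) ^ (1 / 2 : ℝ)) =ᶠ[𝓝[>] 0]
      fun ν => gevreyNorm s r τ (fun x => f ν x - f₀ x) := by
    filter_upwards [hIcc] with ν hν
    unfold gevreyNorm
    simp only [hx, fourierCoef_sub (hf ν hν) hf₀]
  refine Tendsto.congr' heq (tendsto_rpow_half_tsum hx0 ?_)
  -- The gap between the radii leaves the factor exp(-2(τ' - τ)|k|^(1/s)), which absorbs |k|^(2r)
  -- and makes the majorant summable.
  set u : {k : Fin d → ℤ // k ≠ 0} → ℝ := fun k =>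
    M ^ 2 * (freqAbs k.1 ^ (2 * r) * Real.exp (-(2 * (τ' - τ)) * freqAbs k.1 ^ (1 / s))) with hu
  have hus : Summable u := ((summable_freqAbs_rpow_mul_exp (d := d) (c := 2 * (τ' - τ))
    (by linarith) hq (by linarith : (0 : ℝ) ≤ 2 * r)).subtype _).mul_left _
  have hbound : ∀ᶠ ν in 𝓝[>] 0, ∀ k, ‖x ν k‖ ≤ u k := by
    filter_upwards [hIcc] with ν hν k
    rw [Real.norm_of_nonneg (hx0 ν k)]
    have h1 := hM ν hν k.1 k.2
    have h2 := freqAbs_nonneg k.1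
    calc x ν k ≤ freqAbs k.1 ^ (2 * r) * Real.exp (2 * τ * freqAbs k.1 ^ (1 / s))
          * (M * Real.exp (-τ' * freqAbs k.1 ^ (1 / s))) ^ 2 := by
          simp only [hx]; gcongr
      _ = u k := by
          simp only [hu]
          rw [mul_pow, ← Real.exp_nat_mul, show -(2 * (τ' - τ)) * freqAbs k.1 ^ (1 / s)
            = 2 * τ * freqAbs k.1 ^ (1 / s) + (2 : ℕ) * (-τ' * freqAbs k.1 ^ (1 / s)) by
              push_cast; ring, Real.exp_add]
          ring
  have hlim : ∀ k, Tendsto (fun ν => x ν k) (𝓝[>] 0) (𝓝 0) := by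
    intro k
    have h1 : Tendsto (fun ν => ‖fourierCoef (f ν) k.1 - fourierCoef f₀ k.1‖ ^ 2) (𝓝[>] 0)
        (𝓝 (‖fourierCoef f₀ k.1 - fourierCoef f₀ k.1‖ ^ 2)) :=
      (((hconv k.1).sub tendsto_const_nhds).norm).pow 2
    rw [sub_self, norm_zero, zero_pow two_ne_zero] at h1
    have h2 := h1.const_mul (freqAbs k.1 ^ (2 * r) * Real.exp (2 * τ * freqAbs k.1 ^ (1 / s)))
    rwa [mul_zero] at h2
  have ht := tendsto_tsum_of_dominated_convergence hus hlim hbound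
  rw [tsum_zero] at ht
  intro ε hε
  filter_upwards [ht.eventually (gt_mem_nhds hε), hbound] with ν h1 h2 F
  have hsx : Summable (x ν) := Summable.of_norm_bounded hus h2
  exact (hsx.sum_le_tsum F fun k _ => hx0 ν k).trans h1.le

/-- Uniform bounds and convergence of the coefficients in the analytic case. -/
lemma analytic_case {m : ℝ → SymbolMatrix d} (hA1 : ∀ ν : ℝ, 0 ≤ ν → DoubleDivFree (m ν))
    (hA4 : SymbolsConverge m) {C : ℝ} (hC0 : 0 < C)
    (hC : ∀ ν ∈ Set.Icc (0 : ℝ) 1, ∀ i j k, ‖m ν i j k‖ ≤ C)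
    {r K₀ τ₀ : ℝ} (hr : 0 ≤ r) (hτ₀ : 0 < τ₀) {θ₀ S : Torus d → ℝ}
    (h₀ : IsL2MeanZero θ₀) (hS : IsL2MeanZero S)
    (hθ₀ : gevreyNorm 1 r τ₀ θ₀ ≤ ENNReal.ofReal K₀) (hSK : gevreyNorm 1 r τ₀ S ≤ ENNReal.ofReal K₀)
    {Tbar τbar : ℝ} (hT : 0 < Tbar) (hτ : 0 < τbar) {θ : ℝ → ℝ → Torus d → ℝ}
    (hθ : ∀ ν ∈ Set.Icc (0 : ℝ) 1, IsGevreySolution (m ν) θ₀ S 1 r Tbar τbar (θ ν)) :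
    ∃ T τ M : ℝ, 0 < T ∧ T < Tbar ∧ 0 < τ ∧ τ < τbar ∧
      (∀ ν ∈ Set.Icc (0 : ℝ) 1, ∀ t ∈ Set.Icc 0 T, ∀ k, k ≠ 0 →
        ‖fourierCoef (θ ν t) k‖ ≤ M * Real.exp (-τ * freqAbs k)) ∧
      ∀ t ∈ Set.Icc 0 T, ∀ k, Tendsto (fun ν => fourierCoef (θ ν t) k) (𝓝[>] 0)
        (𝓝 (fourierCoef (θ 0 t) k)) := by
  -- The radius must be below τ₀ for the data to have finite weighted sums, and below τbar for each
  -- solution to have a summable majorant.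
  set τ₁ : ℝ := min τ₀ τbar / 2 with hτ₁
  have hτ₁0 : 0 < τ₁ := by have := lt_min hτ₀ hτ; positivity
  have hτ₁a : τ₁ < τ₀ := by have := min_le_left τ₀ τbar; linarith [lt_min hτ₀ hτ]
  have hτ₁b : τ₁ < τbar := by have := min_le_right τ₀ τbar; linarith [lt_min hτ₀ hτ]
  have hsum : ∀ f : Torus d → ℝ, gevreyNorm 1 r τ₀ f ≤ ENNReal.ofReal K₀ →
      Summable fun k => freqAbs k * (Real.exp (τ₁ * freqAbs k) * ‖fourierCoef f k‖) := by
    intro f hf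
    have hs := (summable_freqAbs_rpow_mul_exp (d := d) (c := τ₀ - τ₁) (q := 1) (p := 1)
      (by linarith) one_pos zero_le_one).mul_left |K₀|
    refine Summable.of_nonneg_of_le (fun k => mul_nonneg (freqAbs_nonneg k) (by positivity))
      (fun k => ?_) hs
    simp only [Real.rpow_one]
    by_cases hk : k = 0
    · subst hk; simp [freqAbs_zero]
    · have h1 := norm_fourierCoef_le_of_gevreyNorm hr hf hk
      rw [div_one, Real.rpow_one] at h1
      have h2 := freqAbs_nonneg k
      calc _ ≤ freqAbs k * (Real.exp (τ₁ * freqAbs k) * (|K₀| * Real.exp (-τ₀ * freqAbs k))) := by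
            gcongr
        _ = _ := by
            rw [show -(τ₀ - τ₁) * freqAbs k = τ₁ * freqAbs k + -τ₀ * freqAbs k by ring, Real.exp_add]
            ring
  have hs0 := hsum θ₀ hθ₀
  have hsS := hsum S hSK
  set A := ∑' k, freqAbs k * (Real.exp (τ₁ * freqAbs k) * ‖fourierCoef θ₀ k‖)
  set XS := ∑' k, freqAbs k * (Real.exp (τ₁ * freqAbs k) * ‖fourierCoef S k‖)
  have hA0 : 0 ≤ A := tsum_nonneg fun k => mul_nonneg (freqAbs_nonneg k) (by positivity)
  have hXS0 : 0 ≤ XS := tsum_nonneg fun k => mul_nonneg (freqAbs_nonneg k) (by positivity)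
  -- The size of the data, with the whole source counted because T ≤ 1 below; the added 1 makes c
  -- positive.
  set c := A + XS + 1 with hc
  have hc0 : 0 < c := by positivity
  set V : ℝ := d * C with hV
  have hV0 : 0 ≤ V := by positivity
  -- This satisfies both smallness conditions: 4 (d V / B) c < 1 for the a priori bound, and d V
  -- (2c) / B ≤ 1/4 for stability with R = 2c.
  set B := 8 * (d * V * c) + 1 with hBdef
  have hB0 : 0 < B := by positivity
  -- The time is short enough that the radius τ₁ - B t stays at least τ₁/2, and strictly inside the
  -- given interval.
  set T := min (min 1 (Tbar / 2)) (τ₁ / (2 * B)) with hTdef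
  have hT0 : 0 < T := lt_min (lt_min one_pos (by positivity)) (by positivity)
  have hT1 : T ≤ 1 := (min_le_left _ _).trans (min_le_left _ _)
  have hTb : T ≤ Tbar / 2 := (min_le_left _ _).trans (min_le_right _ _)
  have hBT : B * T ≤ τ₁ / 2 := by
    have h1 : T ≤ τ₁ / (2 * B) := min_le_right _ _
    rw [le_div_iff₀ (by positivity)] at h1
    linarith
  have hsub : Set.Icc 0 T ⊆ Set.Icc 0 Tbar := Set.Icc_subset_Icc le_rfl (by linarith)
  have hder : ∀ ν ∈ Set.Icc (0 : ℝ) 1, ∀ k, ∀ t ∈ Set.Icc 0 T,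
      HasDerivWithinAt (fun t => fourierCoef (θ ν t) k)
      (fourierCoef S k - advection (velCoef (m ν) (fourierCoef (θ ν t))) (fourierCoef (θ ν t)) k)
      (Set.Icc 0 T) t := fun ν hν k t ht =>
    ((hθ ν hν).flow (hA1 ν hν.1) (hC ν hν) le_rfl hr hT hτ h₀ hS (hsub ht)).mono hsub
  have hinit : ∀ ν ∈ Set.Icc (0 : ℝ) 1, ∀ k, fourierCoef (θ ν 0) k = fourierCoef θ₀ k :=
    fun ν hν k => (hθ ν hν).1.fourierCoef_zero_time hT.le h₀ k
  have hvel : ∀ ν ∈ Set.Icc (0 : ℝ) 1, ∀ t ∈ Set.Icc 0 T, ∀ j k,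
      ‖velCoef (m ν) (fourierCoef (θ ν t)) j k‖ ≤ V * (freqAbs k * ‖fourierCoef (θ ν t) k‖) :=
    fun ν hν t _ j k => norm_velCoef_le_freqAbs (hC ν hν) _ j k
  have hbd : ∀ ν ∈ Set.Icc (0 : ℝ) 1, ∃ Y : (Fin d → ℤ) → ℝ, (∀ k, 0 ≤ Y k) ∧ Summable Y ∧
      ∑' k, Y k ≤ 2 * c ∧ ∀ t ∈ Set.Icc 0 T, ∀ k,
        freqAbs k * (Real.exp ((τ₁ - B * t) * freqAbs k) * ‖fourierCoef (θ ν t) k‖) ≤ Y k := by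
    intro ν hν
    obtain ⟨M, hM⟩ := (hθ ν hν).2
    refine analytic_bound (τ' := τbar) (V := V) (M := |M|)
      (v := fun t => velCoef (m ν) (fourierCoef (θ ν t))) (a := fun t => fourierCoef (θ ν t))
      (S := fourierCoef S) hT0 hB0 hV0 hτ₁b (by linarith) hc0 ?_ (hder ν hν) (hvel ν hν) ?_ ?_ hsS ?_
    · rw [show 4 * (d * V / B) * c = (4 * (d * V * c)) / B by ring, div_lt_one hB0, hBdef]
      have : 0 ≤ d * V * c := by positivity
      linarith
    · intro t ht k hk
      have h1 := norm_fourierCoef_le_of_gevreyNorm hr (hM t (hsub ht)) hk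
      rwa [div_one, Real.rpow_one] at h1
    · simpa only [hinit ν hν] using hs0
    · simp only [hinit ν hν]
      have : T * XS ≤ 1 * XS := mul_le_mul_of_nonneg_right hT1 hXS0
      change A + T * XS ≤ c
      linarith
  have h01 : (0 : ℝ) ∈ Set.Icc (0 : ℝ) 1 := by simp
  obtain ⟨Y₀, hY₀0, hY₀s, hY₀c, hY₀⟩ := hbd 0 h01
  refine ⟨T, τ₁ / 2, 2 * c, hT0, by linarith, by linarith, by linarith, ?_, ?_⟩
  · intro ν hν t ht k hk
    obtain ⟨Y, hY0, hYs, hYc, hY⟩ := hbd ν hν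
    have h1 := (hY t ht k).trans ((hYs.le_tsum k fun l _ => hY0 l).trans hYc)
    have h2 := one_le_freqAbs hk
    have h3 : Real.exp (τ₁ / 2 * freqAbs k) ≤ Real.exp ((τ₁ - B * t) * freqAbs k) := by
      refine Real.exp_le_exp.mpr (mul_le_mul_of_nonneg_right ?_ (freqAbs_nonneg k))
      have : B * t ≤ B * T := mul_le_mul_of_nonneg_left ht.2 hB0.le
      linarith
    rw [neg_mul, Real.exp_neg, ← div_eq_mul_inv, le_div_iff₀ (Real.exp_pos _), mul_comm]
    calc Real.exp (τ₁ / 2 * freqAbs k) * ‖fourierCoef (θ ν t) k‖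
        ≤ Real.exp ((τ₁ - B * t) * freqAbs k) * ‖fourierCoef (θ ν t) k‖ := by gcongr
      _ ≤ freqAbs k * (Real.exp ((τ₁ - B * t) * freqAbs k) * ‖fourierCoef (θ ν t) k‖) :=
          le_mul_of_one_le_left (by positivity) h2
      _ ≤ 2 * c := h1
  · intro t ht k
    by_cases hk : k = 0
    · subst hk
      have hIcc : ∀ᶠ ν : ℝ in 𝓝[>] 0, ν ∈ Set.Icc (0 : ℝ) 1 :=
        mem_of_superset (Ioc_mem_nhdsGT one_pos) Set.Ioc_subset_Icc_self
      refine tendsto_const_nhds.congr' ?_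
      filter_upwards [hIcc] with ν hν
      rw [((hθ ν hν).1.1 t (hsub ht)).fourierCoef_zero, ((hθ 0 h01).1.1 t (hsub ht)).fourierCoef_zero]
    set W := d * (d * (C + C))
    have hW : ∀ ν ∈ Set.Icc (0 : ℝ) 1, ∀ k, symbolGap (m ν) (m 0) k ≤ W := fun ν hν k =>
      symbolGap_le (fun i j => hC ν hν i j k) fun i j => hC 0 h01 i j k
    have hIcc : ∀ᶠ ν : ℝ in 𝓝[>] 0, ν ∈ Set.Icc (0 : ℝ) 1 :=
      mem_of_superset (Ioc_mem_nhdsGT one_pos) Set.Ioc_subset_Icc_self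
    have hε : Tendsto (fun ν => ∑' k, symbolGap (m ν) (m 0) k * Y₀ k) (𝓝[>] 0) (𝓝 0) := by
      have := tendsto_tsum_of_dominated_convergence (𝓕 := 𝓝[>] (0 : ℝ))
        (f := fun ν k => symbolGap (m ν) (m 0) k * Y₀ k) (g := fun _ => (0 : ℝ))
        (bound := fun k => W * Y₀ k) (hY₀s.mul_left W)
        (fun k => by simpa using (tendsto_symbolGap hA4 k).mul_const (Y₀ k)) (by
          filter_upwards [hIcc] with ν hν k
          rw [Real.norm_of_nonneg (mul_nonneg (symbolGap_nonneg _ _ _) (hY₀0 k))]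
          exact mul_le_mul_of_nonneg_right (hW ν hν k) (hY₀0 k))
      simpa using this
    rw [tendsto_iff_norm_sub_tendsto_zero]
    refine squeeze_zero' (Eventually.of_forall fun ν => norm_nonneg _) ?_
      (by simpa using hε.const_mul (2 * (d * (2 * c) / B)))
    filter_upwards [hIcc] with ν hν
    obtain ⟨Y, hY0, hYs, hYc, hY⟩ := hbd ν hν
    -- The symbol error is weighted with the majorant Y₀ of the limit solution, which does not
    -- depend on ν; this is why it tends to zero.
    have h1 := analytic_difference (τ := τ₁) (B := B) (V := V) (R := 2 * c)
      (v := fun t => velCoef (m ν) (fourierCoef (θ ν t))) (a := fun t => fourierCoef (θ ν t))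
      (v' := fun t => velCoef (m 0) (fourierCoef (θ 0 t))) (a' := fun t => fourierCoef (θ 0 t))
      (S := fourierCoef S) hT0 hB0 hV0 (by linarith) (by
        rw [div_le_iff₀ hB0, hBdef]; linarith) (hder ν hν) (hder 0 h01)
      (fun k => by rw [hinit ν hν, hinit 0 h01]) (hvel ν hν) (hvel 0 h01)
      (δ := symbolGap (m ν) (m 0)) (symbolGap_nonneg _ _) (fun t ht j k => by
        rw [velCoef_sub]
        exact (norm_add_le _ _).trans (add_le_add
          (norm_velCoef_le_freqAbs (hC ν hν) _ j k) (norm_velCoef_gap_le _ _ _ j k)))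
      hYs hY₀s hYc hY₀c
      (Summable.of_nonneg_of_le (fun k => mul_nonneg (symbolGap_nonneg _ _ _) (hY₀0 k))
        (fun k => mul_le_mul_of_nonneg_right (hW ν hν k) (hY₀0 k)) (hY₀s.mul_left W))
      hY hY₀ ht k
    refine le_trans ?_ h1
    have h2 : 1 ≤ Real.exp ((τ₁ - B * t) * freqAbs k) := by
      refine Real.one_le_exp (mul_nonneg ?_ (freqAbs_nonneg k))
      have : B * t ≤ B * T := mul_le_mul_of_nonneg_left ht.2 hB0.le
      linarith
    exact (le_mul_of_one_le_left (norm_nonneg _) h2).trans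
      (le_mul_of_one_le_left (by positivity) (one_le_freqAbs hk))

end GevreyCase

/-! ### Compactness in time and stability of weak solutions under limits. -/

section Compactness

variable {d : ℕ}

/-- Bounded equi-Lipschitz sequences of functions with a countable parameter have subsequences
that converge pointwise. -/
lemma exists_subseq_tendsto_of_lipschitz {K : Type*} [Countable K] {T : ℝ} (hT : 0 ≤ T)
    {f : ℕ → K → ℝ → ℂ} {W L : K → ℝ} (hb : ∀ n k, ∀ t ∈ Set.Icc 0 T, ‖f n k t‖ ≤ W k)
    (hL : ∀ n k, ∀ t ∈ Set.Icc 0 T, ∀ t' ∈ Set.Icc 0 T, ‖f n k t - f n k t'‖ ≤ L k * |t - t'|) :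
    ∃ (φ : ℕ → ℕ) (b : K → ℝ → ℂ), StrictMono φ ∧
      ∀ k, ∀ t ∈ Set.Icc 0 T, Tendsto (fun n => f (φ n) k t) atTop (𝓝 (b k t)) := by
  -- Rational times clamped to [0, T]. Tychonoff's theorem over the countable set of pairs
  -- (frequency, rational) gives one subsequence for all of them; the Lipschitz bounds carry the
  -- convergence to the remaining times.
  set p : ℚ → ℝ := fun q => (Set.projIcc 0 T hT (q : ℝ) : ℝ) with hp
  have hpm : ∀ q, p q ∈ Set.Icc 0 T := fun q => (Set.projIcc 0 T hT (q : ℝ)).2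
  have hcpt : IsCompact (Set.univ.pi fun x : K × ℚ => Metric.closedBall (0 : ℂ) (W x.1)) :=
    isCompact_univ_pi fun x => isCompact_closedBall _ _
  obtain ⟨g, -, φ, hφ, hlim⟩ := hcpt.tendsto_subseq (x := fun n (x : K × ℚ) => f n x.1 (p x.2))
    fun n x _ => by simpa using hb n x.1 _ (hpm x.2)
  rw [tendsto_pi_nhds] at hlim
  have hc : ∀ k, ∀ t ∈ Set.Icc 0 T, ∃ z, Tendsto (fun n => f (φ n) k t) atTop (𝓝 z) := by
    intro k t ht
    refine cauchySeq_tendsto_of_complete (Metric.cauchySeq_iff'.mpr fun ε hε => ?_)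
    set M := max (L k) 0 + 1 with hM
    have hM0 : 0 < M := by positivity
    have hLM : L k ≤ M := (le_max_left _ _).trans (by linarith)
    obtain ⟨q, hq1, hq2⟩ := exists_rat_btwn (show t < t + ε / (4 * M) by
      have : 0 < ε / (4 * M) := by positivity
      linarith)
    have hpt : |t - p q| ≤ ε / (4 * M) := by
      have h1 : |p q - p q| = 0 := by simp
      have h2 := (LipschitzWith.projIcc hT).dist_le_mul t (q : ℝ)
      rw [Set.projIcc_of_mem hT ht, Subtype.dist_eq, NNReal.coe_one, one_mul, Real.dist_eq,
        Real.dist_eq] at h2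
      refine h2.trans ?_
      rw [abs_sub_comm, abs_of_pos (by linarith)]
      linarith
    have hnear : ∀ n, ‖f (φ n) k t - f (φ n) k (p q)‖ ≤ ε / 4 := fun n => by
      refine (hL _ k t ht _ (hpm q)).trans ?_
      calc L k * |t - p q| ≤ M * (ε / (4 * M)) := by gcongr
        _ = ε / 4 := by field_simp
    obtain ⟨N, hN⟩ := Metric.cauchySeq_iff'.mp (hlim (k, q)).cauchySeq (ε / 4) (by positivity)
    refine ⟨N, fun n hn => ?_⟩
    have h3 := hN n hn
    simp only [Function.comp, dist_eq_norm] at h3 ⊢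
    have h4 := hnear n
    have h5 := hnear N
    rw [norm_sub_rev] at h5
    calc ‖f (φ n) k t - f (φ N) k t‖
        = ‖(f (φ n) k t - f (φ n) k (p q)) + (f (φ n) k (p q) - f (φ N) k (p q))
          + (f (φ N) k (p q) - f (φ N) k t)‖ := by congr 1; ring
      _ ≤ ‖f (φ n) k t - f (φ n) k (p q)‖ + ‖f (φ n) k (p q) - f (φ N) k (p q)‖
          + ‖f (φ N) k (p q) - f (φ N) k t‖ := norm_add₃_le
      _ < ε := by linarith
  choose! b hbl using hc
  exact ⟨φ, b, hφ, hbl⟩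

lemma tendsto_synth {c : ℕ → (Fin d → ℤ) → ℂ} {c₀ : (Fin d → ℤ) → ℂ} {W : (Fin d → ℤ) → ℝ}
    (hW : Summable W) (hc : ∀ n k, ‖c n k‖ ≤ W k)
    (hlim : ∀ k, Tendsto (fun n => c n k) atTop (𝓝 (c₀ k))) (x : Torus d) :
    Tendsto (fun n => synth (c n) x) atTop (𝓝 (synth c₀ x)) := by
  unfold synth
  refine (Complex.continuous_re.tendsto _).comp ?_
  refine tendsto_tsum_of_dominated_convergence hW (fun k => (hlim k).mul_const _)
    (Eventually.of_forall fun n k => ?_)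
  rw [norm_mul, norm_wave, mul_one]
  exact hc n k

lemma memLp_synth {c : (Fin d → ℤ) → ℂ} (hc : Summable fun k => ‖c k‖) (p : ℝ≥0∞) :
    MemLp (synth c) p (volume : Measure (Torus d)) :=
  MemLp.of_bound (continuous_synth hc).aestronglyMeasurable _
    (Eventually.of_forall fun x => abs_synth_le hc x)

lemma integral_eq_zero_of_fourierCoef {f : Torus d → ℝ} (h : fourierCoef f 0 = 0) :
    ∫ x, f x = 0 := by
  rw [fourierCoef_zero] at h
  rcases mul_eq_zero.mp h with h | h
  · exact absurd (inv_eq_zero.mp h) two_pi_pow_ne_zero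
  · exact_mod_cast h

lemma exists_abs_le_of_continuous {f : Torus d → ℝ} (hf : Continuous f) : ∃ C, ∀ x, |f x| ≤ C := by
  obtain ⟨C, hC⟩ := (isCompact_range hf).isBounded.exists_norm_le
  exact ⟨C, fun x => hC _ ⟨x, rfl⟩⟩

/-- Solutions whose Fourier coefficients converge, with a common summable bound, converge to a
solution of the limit equation. -/
lemma IsSolution.of_tendsto {m : ℕ → SymbolMatrix d} {m₀ : SymbolMatrix d} {θ₀ S : Torus d → ℝ}
    {T : ℝ} {θ : ℕ → ℝ → Torus d → ℝ} (hT : 0 ≤ T)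
    (hsol : ∀ n, IsSolution (m n) θ₀ S T (θ n)) {W : (Fin d → ℤ) → ℝ} (hW : Summable W)
    (ha : ∀ n, ∀ t ∈ Set.Icc 0 T, ∀ k, ‖fourierCoef (θ n t) k‖ ≤ W k)
    (hv : ∀ n, ∀ t ∈ Set.Icc 0 T, ∀ j k, ‖velCoef (m n) (fourierCoef (θ n t)) j k‖ ≤ W k)
    {b : ℝ → (Fin d → ℤ) → ℂ}
    (halim : ∀ t ∈ Set.Icc 0 T, ∀ k, Tendsto (fun n => fourierCoef (θ n t) k) atTop (𝓝 (b t k)))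
    (hvlim : ∀ t ∈ Set.Icc 0 T, ∀ j k,
      Tendsto (fun n => velCoef (m n) (fourierCoef (θ n t)) j k) atTop (𝓝 (velCoef m₀ (b t) j k))) :
    IsSolution m₀ θ₀ S T (fun t => synth (b t)) ∧
      ∀ t ∈ Set.Icc 0 T, ∀ k, fourierCoef (synth (b t)) k = b t k := by
  choose hL2 u hu hweak using hsol
  have hus : ∀ n, ∀ t ∈ Set.Icc 0 T, ∀ j, fourierCoef (u n t j)
      = velCoef (m n) (fourierCoef (θ n t)) j := fun n t ht j => funext ((hu n t ht j).2)
  have hbW : ∀ t ∈ Set.Icc 0 T, ∀ k, ‖b t k‖ ≤ W k := fun t ht k =>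
    le_of_tendsto (halim t ht k).norm (Eventually.of_forall fun n => ha n t ht k)
  have hvW : ∀ t ∈ Set.Icc 0 T, ∀ j k, ‖velCoef m₀ (b t) j k‖ ≤ W k := fun t ht j k =>
    le_of_tendsto (hvlim t ht j k).norm (Eventually.of_forall fun n => hv n t ht j k)
  have hsa : ∀ n, ∀ t ∈ Set.Icc 0 T, Summable fun k => ‖fourierCoef (θ n t) k‖ := fun n t ht =>
    Summable.of_nonneg_of_le (fun k => norm_nonneg _) (ha n t ht) hW
  have hsv : ∀ n, ∀ t ∈ Set.Icc 0 T, ∀ j, Summable fun k => ‖fourierCoef (u n t j) k‖ :=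
    fun n t ht j => by
      rw [hus n t ht j]
      exact Summable.of_nonneg_of_le (fun k => norm_nonneg _) (hv n t ht j) hW
  have hsb : ∀ t ∈ Set.Icc 0 T, Summable fun k => ‖b t k‖ := fun t ht =>
    Summable.of_nonneg_of_le (fun k => norm_nonneg _) (hbW t ht) hW
  have hsbv : ∀ t ∈ Set.Icc 0 T, ∀ j, Summable fun k => ‖velCoef m₀ (b t) j k‖ := fun t ht j =>
    Summable.of_nonneg_of_le (fun k => norm_nonneg _) (hvW t ht j) hW
  -- Conjugate symmetry passes to the limit, so the limiting coefficients, and likewise those of the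
  -- velocity, are those of real functions.
  have hbconj : ∀ t ∈ Set.Icc 0 T, ∀ k, b t (-k) = conj (b t k) := fun t ht k =>
    tendsto_nhds_unique (halim t ht (-k))
      (((Complex.continuous_conj.tendsto _).comp (halim t ht k)).congr fun n =>
        (fourierCoef_neg (θ n t) k).symm)
  have hvconj : ∀ t ∈ Set.Icc 0 T, ∀ j k, velCoef m₀ (b t) j (-k) = conj (velCoef m₀ (b t) j k) :=
    fun t ht j k => tendsto_nhds_unique (hvlim t ht j (-k))
      (((Complex.continuous_conj.tendsto _).comp (hvlim t ht j k)).congr fun n => by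
        simp only [Function.comp]
        rw [← hus n t ht j, fourierCoef_neg])
  have hcoef : ∀ t ∈ Set.Icc 0 T, ∀ k, fourierCoef (synth (b t)) k = b t k := fun t ht k =>
    fourierCoef_synth (hsb t ht) (hbconj t ht) k
  have hW0 : ∀ k, 0 ≤ W k := fun k =>
    (norm_nonneg _).trans (ha 0 0 (Set.left_mem_Icc.mpr hT) k)
  set R := ∑' k, W k with hR
  have hR0 : 0 ≤ R := tsum_nonneg hW0
  have hsynth : ∀ c : (Fin d → ℤ) → ℂ, (∀ k, ‖c k‖ ≤ W k) → ∀ x, |synth c x| ≤ R := by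
    intro c hc x
    have hs : Summable fun k => ‖c k‖ := Summable.of_nonneg_of_le (fun k => norm_nonneg _) hc hW
    exact (abs_synth_le hs x).trans (hs.tsum_le_tsum hc hW)
  -- Each solution is replaced by the sum of its absolutely convergent series; these sums converge
  -- at every point of the torus and are bounded by R, so dominated convergence applies to the space
  -- integrals and then to the time integral.
  have hθae : ∀ n, ∀ t ∈ Set.Icc 0 T, θ n t =ᵐ[volume] synth (fourierCoef (θ n t)) :=
    fun n t ht => ae_eq_synth (hL2 n t ht).1 (hsa n t ht)
  have huae : ∀ n, ∀ t ∈ Set.Icc 0 T, ∀ j,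
      u n t j =ᵐ[volume] synth (velCoef (m n) (fourierCoef (θ n t)) j) := fun n t ht j => by
    have := ae_eq_synth (hu n t ht j).1 (hsv n t ht j)
    rwa [hus n t ht j] at this
  refine ⟨⟨fun t ht => ⟨memLp_synth (hsb t ht) 2, ?_⟩, fun t j => synth (velCoef m₀ (b t) j),
    fun t ht j => ⟨memLp_synth (hsbv t ht j) 2, fun k => ?_⟩, fun φ hφ => ?_⟩, hcoef⟩
  · refine integral_eq_zero_of_fourierCoef ?_
    rw [hcoef t ht]
    refine tendsto_nhds_unique (halim t ht 0) ?_
    simp only [(hL2 _ t ht).fourierCoef_zero]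
    exact tendsto_const_nhds
  · rw [fourierCoef_synth (hsbv t ht j) (hvconj t ht j)]
    unfold velCoef
    simp only [hcoef t ht]
  obtain ⟨Cφ, hCφ⟩ := exists_abs_le_of_continuous hφ.continuous
  choose D hD using fun j => exists_abs_le_of_continuous (hφ.continuous_partialDeriv j)
  have hlimθ : ∀ t ∈ Set.Icc 0 T, Tendsto (fun n => ∫ x, θ n t x * φ x) atTop
      (𝓝 (∫ x, synth (b t) x * φ x)) := by
    intro t ht
    have h1 : ∀ n, ∫ x, θ n t x * φ x = ∫ x, synth (fourierCoef (θ n t)) x * φ x := fun n =>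
      integral_congr_ae (by filter_upwards [hθae n t ht] with x hx; rw [hx])
    simp only [h1]
    refine tendsto_integral_of_dominated_convergence (fun _ => R * Cφ) (fun n => ?_)
      (integrable_const _) (fun n => Eventually.of_forall fun x => ?_)
      (Eventually.of_forall fun x => (tendsto_synth hW (fun n k => ha n t ht k) (halim t ht) x).mul_const _)
    · exact ((continuous_synth (hsa n t ht)).mul hφ.continuous).aestronglyMeasurable
    · rw [norm_mul]
      exact mul_le_mul (hsynth _ (ha n t ht) x) (hCφ x) (norm_nonneg _) hR0
  set N : ℕ → ℝ → ℝ := fun n σ => ∫ x, θ n σ x * ∑ j, u n σ j x * partialDeriv j φ x with hN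
  set N₀ : ℝ → ℝ := fun σ =>
    ∫ x, synth (b σ) x * ∑ j, synth (velCoef m₀ (b σ) j) x * partialDeriv j φ x with hN₀
  have hN1 : ∀ n, ∀ t ∈ Set.Icc 0 T, N n t = ∫ x, synth (fourierCoef (θ n t)) x *
      ∑ j, synth (velCoef (m n) (fourierCoef (θ n t)) j) x * partialDeriv j φ x := by
    intro n t ht
    refine integral_congr_ae ?_
    filter_upwards [hθae n t ht, ae_all_iff.mpr (huae n t ht)] with x hx hx2
    simp only [hx, hx2]
  have hptw : ∀ n, ∀ t ∈ Set.Icc 0 T, ∀ x, ‖synth (fourierCoef (θ n t)) x *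
      ∑ j, synth (velCoef (m n) (fourierCoef (θ n t)) j) x * partialDeriv j φ x‖
      ≤ R * ∑ j, R * D j := by
    intro n t ht x
    rw [norm_mul]
    refine mul_le_mul (hsynth _ (ha n t ht) x) ((norm_sum_le _ _).trans
      (Finset.sum_le_sum fun j _ => ?_)) (norm_nonneg _) hR0
    rw [norm_mul]
    exact mul_le_mul (hsynth _ (hv n t ht j) x) (hD j x) (norm_nonneg _) hR0
  have hlimN : ∀ t ∈ Set.Icc 0 T, Tendsto (fun n => N n t) atTop (𝓝 (N₀ t)) := by
    intro t ht
    simp only [hN1 _ t ht]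
    refine tendsto_integral_of_dominated_convergence (fun _ => R * ∑ j, R * D j) (fun n => ?_)
      (integrable_const _) (fun n => Eventually.of_forall (hptw n t ht))
      (Eventually.of_forall fun x => ?_)
    · refine Continuous.aestronglyMeasurable ((continuous_synth (hsa n t ht)).mul
        (continuous_finsetSum _ fun j _ => (continuous_synth ?_).mul (hφ.continuous_partialDeriv j)))
      rw [← hus n t ht j]
      exact hsv n t ht j
    · exact (tendsto_synth hW (fun n k => ha n t ht k) (halim t ht) x).mul
        (tendsto_finsetSum _ fun j _ =>
          (tendsto_synth hW (fun n k => hv n t ht j k) (hvlim t ht j) x).mul_const _)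
  set M := ∫ _x : Torus d, R * ∑ j, R * D j with hM
  have hNb : ∀ n, ∀ t ∈ Set.Icc 0 T, ‖N n t‖ ≤ M := by
    intro n t ht
    rw [hN1 n t ht]
    exact norm_integral_le_of_norm_le (integrable_const _) (Eventually.of_forall (hptw n t ht))
  have hIoc : ∀ {t}, t ∈ Set.Icc 0 T → ∀ σ ∈ Set.uIoc 0 t, σ ∈ Set.Icc 0 T := by
    intro t ht σ hσ
    rw [Set.uIoc_of_le ht.1] at hσ
    exact ⟨hσ.1.le, hσ.2.trans ht.2⟩
  have hTT : T ∈ Set.Icc 0 T := Set.right_mem_Icc.mpr hT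
  have hNi : ∀ n, IntervalIntegrable (N n) volume 0 T := fun n => (hweak n φ hφ).1
  have hsubI : ∀ t ∈ Set.Icc 0 T, Set.uIcc 0 t ⊆ Set.uIcc 0 T := fun t ht => by
    rw [Set.uIcc_of_le ht.1, Set.uIcc_of_le hT]
    exact Set.Icc_subset_Icc le_rfl ht.2
  have hN₀i : IntervalIntegrable N₀ volume 0 T := by
    have hmeas : AEStronglyMeasurable N₀ (volume.restrict (Set.uIoc 0 T)) := by
      refine aestronglyMeasurable_of_tendsto_ae atTop (f := N)
        (fun n => (hNi n).aestronglyMeasurable_restrict_uIoc) ?_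
      exact (ae_restrict_iff' measurableSet_uIoc).mpr
        (Eventually.of_forall fun σ hσ => hlimN σ (hIoc hTT σ hσ))
    refine (intervalIntegrable_const (c := M)).mono_fun hmeas ?_
    refine (ae_restrict_iff' measurableSet_uIoc).mpr (Eventually.of_forall fun σ hσ => ?_)
    exact (le_of_tendsto (hlimN σ (hIoc hTT σ hσ)).norm
      (Eventually.of_forall fun n => hNb n σ (hIoc hTT σ hσ))).trans (le_abs_self M)
  refine ⟨hN₀i, fun t ht => tendsto_nhds_unique (hlimθ t ht) ?_⟩
  have h1 : ∀ n, ∫ x, θ n t x * φ x = (∫ x, θ₀ x * φ x)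
      + ∫ σ in (0 : ℝ)..t, (N n σ + ∫ x, S x * φ x) := fun n => (hweak n φ hφ).2 t ht
  simp only [h1]
  refine tendsto_const_nhds.add ?_
  refine intervalIntegral.tendsto_integral_filter_of_dominated_convergence
    (fun _ => M + |∫ x, S x * φ x|) (Eventually.of_forall fun n => ?_)
    (Eventually.of_forall fun n => Eventually.of_forall fun σ hσ => ?_)
    intervalIntegrable_const (Eventually.of_forall fun σ hσ => ?_)
  · exact (((hNi n).mono_set (hsubI t ht)).add
      intervalIntegrable_const).aestronglyMeasurable_restrict_uIoc
  · exact (norm_add_le _ _).trans (add_le_add (hNb n σ (hIoc ht σ hσ)) le_rfl)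
  · exact (hlimN σ (hIoc ht σ hσ)).add tendsto_const_nhds

end Compactness

/-! ### Convergence of coefficients from compactness and uniqueness of the limit. -/

section Uniqueness

variable {d : ℕ}

lemma tendsto_velCoef {m : ℝ → SymbolMatrix d} (hm : SymbolsConverge m) {ν : ℕ → ℝ}
    (hν : Tendsto ν atTop (𝓝[>] 0)) {a : ℕ → (Fin d → ℤ) → ℂ} {b : (Fin d → ℤ) → ℂ}
    {k : Fin d → ℤ} (hab : Tendsto (fun n => a n k) atTop (𝓝 (b k))) (j : Fin d) :
    Tendsto (fun n => velCoef (m (ν n)) (a n) j k) atTop (𝓝 (velCoef (m 0) b j k)) := by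
  unfold velCoef
  refine tendsto_finsetSum _ fun i _ => Tendsto.const_mul _ (Tendsto.mul ?_ hab)
  exact tendsto_iff_norm_sub_tendsto_zero.mpr ((hm.tendsto i j k).comp hν)

/-- The Gevrey norm is lower semicontinuous along convergence of coefficients. -/
lemma gevreyNorm_le_of_tendsto {s r τ C : ℝ} {f : ℕ → Torus d → ℝ} {g : Torus d → ℝ}
    (hf : ∀ n, gevreyNorm s r τ (f n) ≤ ENNReal.ofReal C)
    (hlim : ∀ k, Tendsto (fun n => fourierCoef (f n) k) atTop (𝓝 (fourierCoef g k))) :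
    gevreyNorm s r τ g ≤ ENNReal.ofReal |C| := by
  have h0 : ∀ (f : Torus d → ℝ) (k : {k : Fin d → ℤ // k ≠ 0}),
      0 ≤ freqAbs k.1 ^ (2 * r) * Real.exp (2 * τ * freqAbs k.1 ^ (1 / s))
      * ‖fourierCoef f k.1‖ ^ 2 := fun f k => by
    have := freqAbs_nonneg k.1
    positivity
  refine rpow_half_le_of_le_sq (abs_nonneg C) ?_
  rw [sq_abs, tsum_ofReal_le_iff (h0 g) (sq_nonneg C)]
  intro F
  refine le_of_tendsto (tendsto_finsetSum F fun k _ =>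
    (((hlim k.1).norm.pow 2).const_mul _)) (Eventually.of_forall fun n => ?_)
  exact (tsum_ofReal_le_iff (h0 (f n)) (sq_nonneg C)).mp (le_sq_of_rpow_half_le (hf n)) F

/-- Convergence of the coefficients under a common Gevrey bound, if the limit problem has a unique
solution. -/
lemma tendsto_of_unique {m : ℝ → SymbolMatrix d} (hA1 : ∀ ν : ℝ, 0 ≤ ν → DoubleDivFree (m ν))
    (hA4 : SymbolsConverge m) {C : ℝ} (hC0 : 0 < C)
    (hC : ∀ ν ∈ Set.Icc (0 : ℝ) 1, ∀ i j k, ‖m ν i j k‖ ≤ C)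
    {s r : ℝ} (hs : 1 ≤ s) (hr : 0 ≤ r) {θ₀ S : Torus d → ℝ}
    (h₀ : IsL2MeanZero θ₀) (hS : IsL2MeanZero S)
    {T τ : ℝ} (hT : 0 < T) (hτ : 0 < τ) {θ : ℝ → ℝ → Torus d → ℝ}
    (hθ : ∀ ν ∈ Set.Icc (0 : ℝ) 1, IsGevreySolution (m ν) θ₀ S s r T τ (θ ν))
    {M : ℝ} (hM : ∀ ν ∈ Set.Icc (0 : ℝ) 1, ∀ t ∈ Set.Icc 0 T,
      gevreyNorm s r τ (θ ν t) ≤ ENNReal.ofReal M)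
    (huniq : ∀ θ' : ℝ → Torus d → ℝ, IsGevreySolution (m 0) θ₀ S s r T τ θ' →
          ∀ t ∈ Set.Icc 0 T, θ' t =ᵐ[volume] θ 0 t)
    {t : ℝ} (ht : t ∈ Set.Icc 0 T) (k : Fin d → ℤ) :
    Tendsto (fun ν => fourierCoef (θ ν t) k) (𝓝[>] 0) (𝓝 (fourierCoef (θ 0 t) k)) := by
  have hq : (0 : ℝ) < 1 / s := by positivity
  set V : ℝ := d * C with hV
  have hV0 : 0 ≤ V := by positivity
  set E : (Fin d → ℤ) → ℝ := fun k => Real.exp (-τ * freqAbs k ^ (1 / s)) with hE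
  have hEs : Summable E := by
    have := summable_freqAbs_rpow_mul_exp (d := d) hτ hq (le_refl (0 : ℝ))
    simpa only [Real.rpow_zero, one_mul] using this
  have hnEs : Summable fun k => freqAbs k * E k := by
    have := summable_freqAbs_rpow_mul_exp (d := d) hτ hq zero_le_one
    simpa only [Real.rpow_one] using this
  have hE0 : ∀ k, 0 ≤ E k := fun k => (Real.exp_pos _).le
  have hnE0 : ∀ k, 0 ≤ freqAbs k * E k := fun k => mul_nonneg (freqAbs_nonneg k) (hE0 k)
  have ha : ∀ ν ∈ Set.Icc (0 : ℝ) 1, ∀ t ∈ Set.Icc 0 T, ∀ k,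
      ‖fourierCoef (θ ν t) k‖ ≤ |M| * E k := by
    intro ν hν t ht k
    by_cases hk : k = 0
    · rw [hk, ((hθ ν hν).1.1 t ht).fourierCoef_zero, norm_zero]
      exact mul_nonneg (abs_nonneg M) (hE0 0)
    · exact norm_fourierCoef_le_of_gevreyNorm hr (hM ν hν t ht) hk
  set P : (Fin d → ℤ) → ℝ := fun k => V * |M| * (freqAbs k * E k) with hP
  have hPs : Summable P := hnEs.mul_left _
  have hP0 : ∀ k, 0 ≤ P k := fun k => mul_nonneg (by positivity) (hnE0 k)
  have hna : ∀ ν ∈ Set.Icc (0 : ℝ) 1, ∀ t ∈ Set.Icc 0 T, ∀ k,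
      freqAbs k * ‖fourierCoef (θ ν t) k‖ ≤ |M| * (freqAbs k * E k) := by
    intro ν hν t ht k
    have h1 := mul_le_mul_of_nonneg_left (ha ν hν t ht k) (freqAbs_nonneg k)
    linarith
  have hv : ∀ ν ∈ Set.Icc (0 : ℝ) 1, ∀ t ∈ Set.Icc 0 T, ∀ j k,
      ‖velCoef (m ν) (fourierCoef (θ ν t)) j k‖ ≤ P k := by
    intro ν hν t ht j k
    refine (norm_velCoef_le_freqAbs (hC ν hν) _ j k).trans ?_
    have := mul_le_mul_of_nonneg_left (hna ν hν t ht k) hV0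
    simp only [hP]
    linarith
  -- A bound for the time derivative of the k-th coefficient that is independent of ν; the advection
  -- part is the weighted estimate with radius 0.
  set L : (Fin d → ℤ) → ℝ := fun k =>
    ‖fourierCoef S k‖ + d * conv P (fun k => |M| * (freqAbs k * E k)) k with hLdef
  have hL : ∀ ν ∈ Set.Icc (0 : ℝ) 1, ∀ k, ∀ t ∈ Set.Icc 0 T, ∀ t' ∈ Set.Icc 0 T,
      ‖fourierCoef (θ ν t) k - fourierCoef (θ ν t') k‖ ≤ L k * |t - t'| := by
    intro ν hν k t ht t' ht'
    refine Convex.norm_image_sub_le_of_norm_hasDerivWithin_le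
      (f := fun t => fourierCoef (θ ν t) k)
      (fun x hx => (hθ ν hν).flow (hA1 ν hν.1) (hC ν hν) hs hr hT hτ h₀ hS hx)
      (fun x hx => ?_) (convex_Icc 0 T) ht' ht
    have := exp_mul_norm_advection_le (v := velCoef (m ν) (fourierCoef (θ ν x)))
      (b := fourierCoef (θ ν x)) (le_refl (0 : ℝ)) hP0 hPs (hnEs.mul_left |M|)
      (fun j k => by simpa using hv ν hν x hx j k) (fun k => by simpa using hna ν hν x hx k) k
    simp only [zero_mul, Real.exp_zero, one_mul] at this
    exact (norm_sub_le _ _).trans (add_le_add le_rfl this)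
  have hW : Summable fun k => |M| * E k + P k := (hEs.mul_left _).add hPs
  -- It suffices that every sequence ν_n → 0 has a subsequence with the right limit. The shift by N
  -- below keeps the parameters in [0, 1], where the bounds hold.
  refine tendsto_of_subseq_tendsto fun ns hns => ?_
  obtain ⟨N, hN⟩ := eventually_atTop.mp
    (hns.eventually (mem_of_superset (Ioc_mem_nhdsGT one_pos) Set.Ioc_subset_Icc_self :
      Set.Icc (0 : ℝ) 1 ∈ 𝓝[>] 0))
  have hN' : ∀ n, ns (n + N) ∈ Set.Icc (0 : ℝ) 1 := fun n => hN _ (Nat.le_add_left _ _)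
  obtain ⟨φ, b, hφ, hlim⟩ := exists_subseq_tendsto_of_lipschitz hT.le
    (f := fun n k t => fourierCoef (θ (ns (n + N)) t) k)
    (fun n k t ht => ha _ (hN' n) t ht k) (fun n k t ht t' ht' => hL _ (hN' n) k t ht t' ht')
  have hφN : Tendsto (fun n => φ n + N) atTop atTop :=
    (tendsto_add_atTop_nat N).comp hφ.tendsto_atTop
  refine ⟨fun n => φ n + N, ?_⟩
  obtain ⟨hsol, hcoef⟩ := IsSolution.of_tendsto (m := fun n => m (ns (φ n + N))) (m₀ := m 0)
    (θ := fun n => θ (ns (φ n + N))) (b := fun t k => b k t) hT.le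
    (fun n => (hθ _ (hN' (φ n))).1) hW
    (fun n t ht k => (ha _ (hN' (φ n)) t ht k).trans (le_add_of_nonneg_right (hP0 k)))
    (fun n t ht j k => (hv _ (hN' (φ n)) t ht j k).trans
      (le_add_of_nonneg_left (mul_nonneg (abs_nonneg M) (hE0 k))))
    (fun t ht k => hlim k t ht)
    (fun t ht j k => tendsto_velCoef hA4 (hns.comp hφN) (hlim k t ht) j)
  have hgev : IsGevreySolution (m 0) θ₀ S s r T τ (fun t => synth fun k => b k t) :=
    ⟨hsol, |M|, fun t ht => gevreyNorm_le_of_tendsto (fun n => hM _ (hN' (φ n)) t ht) fun k => by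
      rw [hcoef t ht k]; exact hlim k t ht⟩
  rw [← fourierCoef_congr (huniq _ hgev t ht) k, hcoef t ht k]
  exact hlim k t ht

end Uniqueness

/-! ### Conclusion in Gevrey classes. -/

section GevreyConclusion

variable {d : ℕ}

/-- Convergence of Gevrey-class solutions. -/
theorem gevrey_convergence {m : ℝ → SymbolMatrix d} (hA1 : ∀ ν : ℝ, 0 ≤ ν → DoubleDivFree (m ν))
    (hA4 : SymbolsConverge m) (hA5 : UniformlyBoundedSymbols m)
    {s r K₀ τ₀ : ℝ} (hs : 1 ≤ s) (hr : 0 ≤ r) (hτ₀ : 0 < τ₀) {θ₀ S : Torus d → ℝ}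
    (h₀ : IsL2MeanZero θ₀) (hS : IsL2MeanZero S)
    (hθ₀ : gevreyNorm s r τ₀ θ₀ ≤ ENNReal.ofReal K₀) (hSK : gevreyNorm s r τ₀ S ≤ ENNReal.ofReal K₀)
    {Tbar τbar : ℝ} (hT : 0 < Tbar) (hτ : 0 < τbar) {θ : ℝ → ℝ → Torus d → ℝ}
    (hθ : ∀ ν ∈ Set.Icc (0 : ℝ) 1, IsGevreySolution (m ν) θ₀ S s r Tbar τbar (θ ν))
    (hs1 : 1 < s →
        (∃ C : ℝ, ∀ ν ∈ Set.Icc (0 : ℝ) 1, ∀ t ∈ Set.Icc 0 Tbar,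
          gevreyNorm s r τbar (θ ν t) ≤ ENNReal.ofReal C) ∧
        (∀ θ' : ℝ → Torus d → ℝ, IsGevreySolution (m 0) θ₀ S s r Tbar τbar θ' →
          ∀ t ∈ Set.Icc 0 Tbar, θ' t =ᵐ[volume] θ 0 t)) :
    ∃ (T : ℝ) (τ : ℝ → ℝ), 0 < T ∧ T < Tbar ∧ (∀ t ∈ Set.Icc 0 T, 0 < τ t ∧ τ t < τbar) ∧
        ∀ t ∈ Set.Icc 0 T,
          Tendsto (fun ν : ℝ => gevreyNorm s r (τ t) (fun x => θ ν t x - θ 0 t x))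
            (𝓝[>] 0) (𝓝 0) := by
  obtain ⟨C, hC0, hCb⟩ := hA5
  have hC : ∀ ν ∈ Set.Icc (0 : ℝ) 1, ∀ i j k, ‖m ν i j k‖ ≤ C := by
    intro ν hν i j k
    rcases hν.1.eq_or_lt with h | h
    · rw [← h]; exact (hCb i j k).2
    · exact (hCb i j k).1 ν h hν.2
  have h01 : (0 : ℝ) ∈ Set.Icc (0 : ℝ) 1 := by simp
  -- Common decay with some radius τ and convergence of each coefficient are enough: the norm is
  -- then measured with the constant radius τ/2.
  suffices h : ∃ T τ M : ℝ, 0 < T ∧ T < Tbar ∧ 0 < τ ∧ τ ≤ τbar ∧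
      (∀ ν ∈ Set.Icc (0 : ℝ) 1, ∀ t ∈ Set.Icc 0 T, ∀ k, k ≠ 0 →
        ‖fourierCoef (θ ν t) k‖ ≤ M * Real.exp (-τ * freqAbs k ^ (1 / s))) ∧
      ∀ t ∈ Set.Icc 0 T, ∀ k, Tendsto (fun ν => fourierCoef (θ ν t) k) (𝓝[>] 0)
        (𝓝 (fourierCoef (θ 0 t) k)) by
    obtain ⟨T, τ, M, hT0, hTT, hτ0, hττ, hM, hlim⟩ := h
    refine ⟨T, fun _ => τ / 2, hT0, hTT, fun t _ => ⟨by linarith, by linarith⟩, fun t ht => ?_⟩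
    have htT : t ∈ Set.Icc 0 Tbar := ⟨ht.1, ht.2.trans hTT.le⟩
    refine tendsto_gevreyNorm (τ' := τ) (M := M + M) hs hr (by linarith)
      (f := fun ν => θ ν t) (fun ν hν => ((hθ ν hν).1.1 t htT).1.integrable one_le_two)
      (((hθ 0 h01).1.1 t htT).1.integrable one_le_two) (fun ν hν k hk => ?_) (hlim t ht)
    rw [add_mul]
    exact (norm_sub_le _ _).trans (add_le_add (hM ν hν t ht k hk) (hM 0 h01 t ht k hk))
  rcases hs.eq_or_lt with h | h
  · subst h
    obtain ⟨T, τ, M, hT0, hTT, hτ0, hττ, hM, hlim⟩ :=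
      analytic_case hA1 hA4 hC0 hC hr hτ₀ h₀ hS hθ₀ hSK hT hτ hθ
    refine ⟨T, τ, M, hT0, hTT, hτ0, hττ.le, fun ν hν t ht k hk => ?_, hlim⟩
    rw [div_one, Real.rpow_one]
    exact hM ν hν t ht k hk
  · obtain ⟨⟨M, hM⟩, huniq⟩ := hs1 h
    have hsub : Set.Icc 0 (Tbar / 2) ⊆ Set.Icc 0 Tbar := Set.Icc_subset_Icc le_rfl (by linarith)
    -- The time is halved only because T must be strictly smaller than Tbar; the estimates hold on
    -- the whole interval.
    exact ⟨Tbar / 2, τbar, |M|, by linarith, by linarith, hτ, le_rfl,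
      fun ν hν t ht k hk => norm_fourierCoef_le_of_gevreyNorm hr (hM ν hν t (hsub ht)) hk,
      fun t ht k => tendsto_of_unique hA1 hA4 hC0 hC hs hr h₀ hS hT hτ hθ hM huniq (hsub ht) k⟩

end GevreyConclusion

/-! ### Commutator bounds for truncated power weights. -/

section Weights

/-- A Lipschitz cutoff, supported in `x ≤ N`. -/
noncomputable def cutoff (N x : ℝ) : ℝ := max 0 (1 - x / N)

lemma cutoff_nonneg (N x : ℝ) : 0 ≤ cutoff N x := le_max_left _ _

lemma cutoff_le_one {N x : ℝ} (hN : 0 < N) (hx : 0 ≤ x) : cutoff N x ≤ 1 := by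
  have : 0 ≤ x / N := by positivity
  exact max_le zero_le_one (by linarith)

lemma cutoff_eq_zero {N x : ℝ} (hN : 0 < N) (hx : N ≤ x) : cutoff N x = 0 := by
  have : 1 ≤ x / N := (one_le_div hN).mpr hx
  exact max_eq_left (by linarith)

lemma abs_cutoff_sub_le {N : ℝ} (hN : 0 < N) (x y : ℝ) :
    |cutoff N x - cutoff N y| ≤ |x - y| / N := by
  unfold cutoff
  refine (abs_max_sub_max_le_max _ _ _ _).trans ?_
  rw [sub_self, abs_zero, show 1 - x / N - (1 - y / N) = -((x - y) / N) by ring, abs_neg, abs_div,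
    abs_of_pos hN]
  exact max_le (by positivity) le_rfl

/-- Bernoulli's inequality applied to (x/y)^p, with y the larger of the two, takes the place of the
mean value theorem. -/
lemma abs_rpow_sub_rpow_le {p x y : ℝ} (hp : 1 ≤ p) (hx : 0 ≤ x) (hy : 0 ≤ y) :
    |x ^ p - y ^ p| ≤ p * max x y ^ (p - 1) * |x - y| := by
  wlog h : x ≤ y generalizing x y
  · rw [abs_sub_comm, abs_sub_comm x y, max_comm]
    exact this hy hx (le_of_not_ge h)
  rcases hy.eq_or_lt with hy0 | hy0
  · have : x = y := le_antisymm h (hy0 ▸ hx)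
    rw [this]; simp
  have h1 := one_add_mul_self_le_rpow_one_add (s := (x - y) / y) (by
    rw [le_div_iff₀ hy0]; linarith) hp
  have h2 : 1 + (x - y) / y = x / y := by field_simp; ring
  rw [h2, Real.div_rpow hx hy, le_div_iff₀ (by positivity)] at h1
  have h3 : (1 + p * ((x - y) / y)) * y ^ p = y ^ p - p * y ^ (p - 1) * (y - x) := by
    rw [Real.rpow_sub_one hy0.ne']
    field_simp
    ring
  rw [max_eq_right h, abs_of_nonpos (sub_nonpos.mpr (Real.rpow_le_rpow hx h (by linarith))),
    abs_of_nonpos (sub_nonpos.mpr h)]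
  linarith

/-- Three regimes, with a bound independent of N: for y ≤ 2z the cutoffs differ by at most 1; for y
> 2z and y ≥ 2N also x ≥ N, and both cutoffs vanish; otherwise y < 2N meets the Lipschitz constant
1/N. -/
lemma mul_abs_cutoff_sub_le {N x y z : ℝ} (hN : 0 < N) (hx : 0 ≤ x) (hy : 0 ≤ y)
    (hxy : |x - y| ≤ z) : y * |cutoff N x - cutoff N y| ≤ 2 * z := by
  have hz : 0 ≤ z := (abs_nonneg _).trans hxy
  have h1 : |cutoff N x - cutoff N y| ≤ 1 := by
    have := cutoff_nonneg N x; have := cutoff_nonneg N y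
    have := cutoff_le_one hN hx; have := cutoff_le_one hN hy
    rw [abs_le]; constructor <;> linarith
  rcases le_or_gt y (2 * z) with h | h
  · calc y * |cutoff N x - cutoff N y| ≤ y * 1 := by gcongr
      _ ≤ 2 * z := by linarith
  · rcases le_or_gt (2 * N) y with h2 | h2
    · have h3 := (abs_le.mp hxy).1
      rw [cutoff_eq_zero hN (by linarith), cutoff_eq_zero hN (by linarith)]
      simpa using hz
    · calc y * |cutoff N x - cutoff N y| ≤ (2 * N) * (z / N) := by
            gcongr
            exact (abs_cutoff_sub_le hN x y).trans (by gcongr)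
        _ = 2 * z := by field_simp

/-- The commutator estimate behind the H^s bound. With x = |k|, y = |l|, z = |k - l| it moves the
derivative at frequency l onto the velocity when y > 2z, and all p derivatives onto the velocity
when y ≤ 2z. The constant does not depend on the truncation N. -/
lemma mul_abs_weight_sub_le {p N x y z : ℝ} (hp : 1 ≤ p) (hN : 0 < N) (hx : 0 ≤ x) (hy : 0 ≤ y)
    (hxy : |x - y| ≤ z) :
    y * |x ^ p * cutoff N x - y ^ p * cutoff N y|
      ≤ (3 ^ p * (1 + p) + 2) * (z * y ^ p + z ^ p * y) := by
  have hz : 0 ≤ z := (abs_nonneg _).trans hxy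
  have hcx := cutoff_nonneg N x
  have hcy := cutoff_nonneg N y
  have hcx1 := cutoff_le_one hN hx
  have hcy1 := cutoff_le_one hN hy
  have hxy' := abs_le.mp hxy
  have h3p : (0 : ℝ) ≤ 3 ^ p := by positivity
  have hzyp : 0 ≤ z * y ^ p := by positivity
  have hzpy : 0 ≤ z ^ p * y := by positivity
  rcases le_or_gt y (2 * z) with h | h
  · have h1 : x ^ p * cutoff N x ≤ 3 ^ p * z ^ p := by
      rw [← Real.mul_rpow (by norm_num) hz]
      calc x ^ p * cutoff N x ≤ x ^ p * 1 := by gcongr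
        _ ≤ (3 * z) ^ p := by rw [mul_one]; exact Real.rpow_le_rpow hx (by linarith) (by linarith)
    have h2 : y ^ p * cutoff N y ≤ 3 ^ p * z ^ p := by
      rw [← Real.mul_rpow (by norm_num) hz]
      calc y ^ p * cutoff N y ≤ y ^ p * 1 := by gcongr
        _ ≤ (3 * z) ^ p := by rw [mul_one]; exact Real.rpow_le_rpow hy (by linarith) (by linarith)
    have h4 : 0 ≤ x ^ p * cutoff N x := by positivity
    have h5 : 0 ≤ y ^ p * cutoff N y := by positivity
    have h6 : |x ^ p * cutoff N x - y ^ p * cutoff N y| ≤ 3 ^ p * z ^ p := by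
      rw [abs_le]; constructor <;> linarith
    calc y * |x ^ p * cutoff N x - y ^ p * cutoff N y| ≤ y * (3 ^ p * z ^ p) := by gcongr
      _ = 3 ^ p * (z ^ p * y) := by ring
      _ ≤ (3 ^ p * (1 + p) + 2) * (z ^ p * y) := by
          refine mul_le_mul_of_nonneg_right ?_ hzpy
          nlinarith
      _ ≤ _ := by
          refine mul_le_mul_of_nonneg_left (by linarith) (by positivity)
  · rcases le_or_gt (2 * N) y with h2 | h2
    · rw [cutoff_eq_zero hN (by linarith), cutoff_eq_zero hN (by linarith)]
      simp only [mul_zero, sub_self, abs_zero]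
      positivity
    · have hy0 : 0 < y := by linarith
      have hmax : max x y ≤ 3 * y := max_le (by linarith) (by linarith)
      have h4 : |x ^ p - y ^ p| ≤ p * (3 ^ p * y ^ (p - 1)) * z := by
        refine (abs_rpow_sub_rpow_le hp hx hy).trans ?_
        have h5 : max x y ^ (p - 1) ≤ 3 ^ p * y ^ (p - 1) := by
          calc max x y ^ (p - 1) ≤ (3 * y) ^ (p - 1) :=
                Real.rpow_le_rpow (le_max_of_le_left hx) hmax (by linarith)
            _ = 3 ^ (p - 1) * y ^ (p - 1) := Real.mul_rpow (by norm_num) hy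
            _ ≤ 3 ^ p * y ^ (p - 1) := by
                gcongr
                · norm_num
                · linarith
        gcongr
      have h6 : |x ^ p * cutoff N x - y ^ p * cutoff N y|
          ≤ |x ^ p - y ^ p| + y ^ p * (z / N) := by
        rw [show x ^ p * cutoff N x - y ^ p * cutoff N y
          = (x ^ p - y ^ p) * cutoff N x + y ^ p * (cutoff N x - cutoff N y) by ring]
        refine (abs_add_le _ _).trans ?_
        rw [abs_mul, abs_mul, abs_of_nonneg hcx, abs_of_nonneg (Real.rpow_nonneg hy p)]
        refine add_le_add (mul_le_of_le_one_right (abs_nonneg _) hcx1) ?_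
        gcongr
        exact (abs_cutoff_sub_le hN x y).trans (by gcongr)
      have h7 : y * y ^ (p - 1) = y ^ p := by
        rw [Real.rpow_sub_one hy0.ne']; field_simp
      calc y * |x ^ p * cutoff N x - y ^ p * cutoff N y|
          ≤ y * (p * (3 ^ p * y ^ (p - 1)) * z + y ^ p * (z / N)) := by
            gcongr; exact h6.trans (by linarith)
        _ = p * 3 ^ p * (z * (y * y ^ (p - 1))) + (y / N) * (z * y ^ p) := by ring
        _ = p * 3 ^ p * (z * y ^ p) + (y / N) * (z * y ^ p) := by rw [h7]
        _ ≤ p * 3 ^ p * (z * y ^ p) + 2 * (z * y ^ p) := by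
            gcongr
            rw [div_le_iff₀ hN]; linarith
        _ ≤ (3 ^ p * (1 + p) + 2) * (z * y ^ p) := by
            nlinarith
        _ ≤ _ := by
            refine mul_le_mul_of_nonneg_left (by linarith) (by positivity)

end Weights

/-! ### The weighted energy form of the advection term. -/

section Trilinear

variable {d : ℕ}

/-- Young's inequality `ℓ¹ * ℓ² ⊆ ℓ²`, tested against a finitely supported sequence. -/
lemma sum_mul_conv_le {P Q X : (Fin d → ℤ) → ℝ} (hP0 : ∀ k, 0 ≤ P k) (hP : Summable P)
    {q : ℝ} (hq : 0 ≤ q)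
    (hQ : ∀ F : Finset (Fin d → ℤ), ∑ k ∈ F, Q k ^ 2 ≤ q ^ 2)
    (F : Finset (Fin d → ℤ)) :
    ∑ k ∈ F, X k * ∑' l, P (k - l) * Q l ≤ √(∑ k ∈ F, X k ^ 2) * ((∑' k, P k) * q) := by
  have hQb : ∀ k, |Q k| ≤ q := fun k => by
    have := hQ {k}
    rw [Finset.sum_singleton] at this
    exact abs_le_of_sq_le_sq this hq
  have hs : ∀ k, Summable fun j => P j * Q (k - j) := fun k =>
    Summable.of_norm_bounded (hP.mul_right q) fun j => by
      rw [norm_mul, Real.norm_of_nonneg (hP0 j)]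
      exact mul_le_mul_of_nonneg_left (hQb _) (hP0 j)
  have h1 : ∀ k, ∑' l, P (k - l) * Q l = ∑' j, P j * Q (k - j) := fun k => by
    rw [← (Equiv.subLeft k).tsum_eq]
    simp
  -- With the summable factor put at a fixed frequency j, Cauchy–Schwarz applies to X and the
  -- translate of Q; it remains to sum over j.
  have h2 : ∀ j, ∑ k ∈ F, X k * (P j * Q (k - j)) ≤ P j * (√(∑ k ∈ F, X k ^ 2) * q) := by
    intro j
    have h3 : ∑ k ∈ F, X k * (P j * Q (k - j)) = P j * ∑ k ∈ F, X k * Q (k - j) := by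
      rw [Finset.mul_sum]; exact Finset.sum_congr rfl fun k _ => by ring
    rw [h3]
    refine mul_le_mul_of_nonneg_left ?_ (hP0 j)
    refine (Real.sum_mul_le_sqrt_mul_sqrt F X fun k => Q (k - j)).trans ?_
    refine mul_le_mul_of_nonneg_left ?_ (Real.sqrt_nonneg _)
    refine Real.sqrt_le_iff.mpr ⟨hq, ?_⟩
    have h4 := hQ (F.map (Equiv.subRight j).toEmbedding)
    simpa using h4
  simp only [h1]
  have h5 : ∀ k ∈ F, X k * ∑' j, P j * Q (k - j) = ∑' j, X k * (P j * Q (k - j)) :=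
    fun k _ => tsum_mul_left.symm
  rw [Finset.sum_congr rfl h5, ← Summable.tsum_finsetSum fun k _ => (hs k).mul_left (X k)]
  refine ((summable_sum fun k _ => (hs k).mul_left (X k)).tsum_le_tsum h2
    (hP.mul_right _)).trans (le_of_eq ?_)
  rw [tsum_mul_right]; ring

/-- The advection kernel is antisymmetric when the velocity is real and divergence free. -/
lemma conj_kernel {v : Fin d → (Fin d → ℤ) → ℂ} (hconj : ∀ j k, v j (-k) = conj (v j k))
    (hdiv : ∀ k, ∑ j, v j k * (k j : ℂ) = 0) (k l : Fin d → ℤ) :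
    conj (∑ j, v j (l - k) * (Complex.I * (k j : ℂ)))
      = -∑ j, v j (k - l) * (Complex.I * (l j : ℂ)) := by
  have h := hdiv (k - l)
  simp only [Pi.sub_apply, Int.cast_sub, mul_sub, Finset.sum_sub_distrib, sub_eq_zero] at h
  have h1 : ∀ x : Fin d → ℤ, ∑ j, v j (k - l) * (Complex.I * (x j : ℂ))
      = Complex.I * ∑ j, v j (k - l) * (x j : ℂ) := fun x => by
    rw [Finset.mul_sum]; exact Finset.sum_congr rfl fun j _ => by ring
  have h2 : conj (∑ j, v j (l - k) * (Complex.I * (k j : ℂ)))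
      = -∑ j, v j (k - l) * (Complex.I * (k j : ℂ)) := by
    rw [map_sum, ← Finset.sum_neg_distrib]
    refine Finset.sum_congr rfl fun j _ => ?_
    rw [map_mul, ← hconj, neg_sub, map_mul, Complex.conj_I, map_intCast]
    ring
  rw [h2, h1, h1, h]

/-- The weighted energy estimate for the advection term. -/
lemma abs_re_sum_advection_le {v : Fin d → (Fin d → ℤ) → ℂ} {a : (Fin d → ℤ) → ℂ}
    (hconj : ∀ j k, v j (-k) = conj (v j k)) (hdiv : ∀ k, ∑ j, v j k * (k j : ℂ) = 0)
    {q : (Fin d → ℤ) → ℝ} (hv : ∀ j k, ‖v j k‖ ≤ q k) (hqs : Summable q)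
    (hq : Summable fun k => freqAbs k * q k) (ha : Summable fun k => freqAbs k * ‖a k‖)
    {wt g h : (Fin d → ℤ) → ℝ} {K : ℝ} (hK : 0 ≤ K) (hw0 : ∀ k, 0 ≤ wt k)
    (hg0 : ∀ k, 0 ≤ g k) (hh0 : ∀ k, 0 ≤ h k) {F : Finset (Fin d → ℤ)}
    (hwF : ∀ k ∉ F, wt k = 0) (hq0 : ∀ k, 0 ≤ q k)
    (hw : ∀ k l, freqAbs l * |wt k - wt l| ≤ K * (freqAbs (k - l) * g l + h (k - l) * freqAbs l))
    {x y : ℝ} (hx : 0 ≤ x) (hy : 0 ≤ y)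
    (hga : ∀ F : Finset (Fin d → ℤ), ∑ k ∈ F, (g k * ‖a k‖) ^ 2 ≤ x ^ 2)
    (hhq : ∀ F : Finset (Fin d → ℤ), ∑ k ∈ F, (h k * q k) ^ 2 ≤ y ^ 2) :
    |(∑ k ∈ F, (wt k : ℂ) ^ 2 * (conj (a k) * advection v a k)).re|
      ≤ d * K * √(∑ k ∈ F, (wt k * ‖a k‖) ^ 2)
        * ((∑' k, freqAbs k * q k) * x + (∑' k, freqAbs k * ‖a k‖) * y) := by
  set b : (Fin d → ℤ) → (Fin d → ℤ) → ℂ :=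
    fun k l => (∑ j, v j (k - l) * (Complex.I * (l j : ℂ))) * a l with hb
  have hbs : ∀ k, Summable fun l => b k l := fun k =>
    summable_advection hq0 hqs ha hv (fun _ => le_rfl) k
  have hanti : ∀ k l, conj (∑ j, v j (l - k) * (Complex.I * (k j : ℂ)))
      = -∑ j, v j (k - l) * (Complex.I * (l j : ℂ)) := conj_kernel hconj hdiv
  -- The symmetric main part, with one factor wt at k and one at l. Antisymmetry of the kernel makes
  -- it purely imaginary, so only the commutator wt k - wt l contributes to the energy.
  set Z : ℂ := ∑ k ∈ F, ∑ l ∈ F, (wt k : ℂ) * (wt l : ℂ) * (conj (a k) * b k l) with hZ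
  have hZ0 : Z.re = 0 := by
    have h1 : conj Z = -Z := by
      rw [hZ]
      simp only [map_sum]
      rw [Finset.sum_comm, ← Finset.sum_neg_distrib]
      refine Finset.sum_congr rfl fun k _ => ?_
      rw [← Finset.sum_neg_distrib]
      refine Finset.sum_congr rfl fun l _ => ?_
      simp only [hb]
      rw [map_mul, map_mul, map_mul, map_mul, hanti k l, Complex.conj_ofReal, Complex.conj_ofReal,
        Complex.conj_conj]
      ring
    have h2 := congrArg Complex.re h1
    rw [Complex.conj_re, Complex.neg_re] at h2
    linarith
  have hwb : ∀ k, ∑ l ∈ F, (wt l : ℂ) * b k l = ∑' l, (wt l : ℂ) * b k l := fun k =>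
    (tsum_eq_sum fun l hl => by rw [hwF l hl]; simp).symm
  have hwbs : ∀ k, Summable fun l => (wt l : ℂ) * b k l := fun k =>
    summable_of_ne_finset_zero (s := F) fun l hl => by rw [hwF l hl]; simp
  have hsplit : ∑ k ∈ F, (wt k : ℂ) ^ 2 * (conj (a k) * advection v a k)
      = ∑ k ∈ F, (wt k : ℂ) * conj (a k) * (∑' l, ((wt k - wt l : ℝ) : ℂ) * b k l) + Z := by
    rw [hZ, ← Finset.sum_add_distrib]
    refine Finset.sum_congr rfl fun k _ => ?_
    have h1 : ∑ l ∈ F, (wt k : ℂ) * (wt l : ℂ) * (conj (a k) * b k l)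
        = (wt k : ℂ) * conj (a k) * ∑' l, (wt l : ℂ) * b k l := by
      rw [← hwb, Finset.mul_sum]
      exact Finset.sum_congr rfl fun l _ => by ring
    have h2 : ∑' l, ((wt k - wt l : ℝ) : ℂ) * b k l
        = (wt k : ℂ) * advection v a k - ∑' l, (wt l : ℂ) * b k l := by
      unfold advection
      rw [← tsum_mul_left, ← ((hbs k).mul_left _).tsum_sub (hwbs k)]
      congr 1; ext l
      push_cast; ring
    rw [h1, h2]; ring
  rw [hsplit, Complex.add_re, hZ0, add_zero]
  set P : (Fin d → ℤ) → ℝ := fun k => freqAbs k * q k with hPdef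
  set P' : (Fin d → ℤ) → ℝ := fun k => freqAbs k * ‖a k‖ with hPdef'
  have hP0 : ∀ k, 0 ≤ P k := fun k => mul_nonneg (freqAbs_nonneg k) (hq0 k)
  have hP0' : ∀ k, 0 ≤ P' k := fun k => mul_nonneg (freqAbs_nonneg k) (norm_nonneg _)
  have hgab : ∀ k, g k * ‖a k‖ ≤ x := fun k => by
    have := hga {k}
    rw [Finset.sum_singleton] at this
    exact abs_le_of_sq_le_sq' this hx |>.2
  have hhqb : ∀ k, h k * q k ≤ y := fun k => by
    have := hhq {k}
    rw [Finset.sum_singleton] at this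
    exact abs_le_of_sq_le_sq' this hy |>.2
  have hs1 : ∀ k, Summable fun l => P (k - l) * (g l * ‖a l‖) := fun k => by
    have h1 : Summable fun l => P (k - l) := (Equiv.subLeft k).summable_iff.mpr hq
    exact Summable.of_nonneg_of_le
      (fun l => mul_nonneg (hP0 _) (mul_nonneg (hg0 l) (norm_nonneg _)))
      (fun l => mul_le_mul_of_nonneg_left (hgab l) (hP0 _)) (h1.mul_right x)
  have hs2 : ∀ k, Summable fun l => (h (k - l) * q (k - l)) * P' l := fun k =>
    Summable.of_nonneg_of_le (fun l => mul_nonneg (mul_nonneg (hh0 _) (hq0 _)) (hP0' l))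
      (fun l => mul_le_mul_of_nonneg_right (hhqb _) (hP0' l)) (ha.mul_left y)
  have hterm : ∀ k l, ‖((wt k - wt l : ℝ) : ℂ) * b k l‖
      ≤ d * K * (P (k - l) * (g l * ‖a l‖) + (h (k - l) * q (k - l)) * P' l) := by
    intro k l
    rw [norm_mul, Complex.norm_real, Real.norm_eq_abs, hb]
    simp only
    rw [norm_mul]
    have h1 := norm_advection_kernel_le (l := l) (v := v) (k := k - l) fun j => hv j (k - l)
    have h2 := hw k l
    have h3 := hq0 (k - l)
    calc |wt k - wt l| * (‖∑ j, v j (k - l) * (Complex.I * (l j : ℂ))‖ * ‖a l‖)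
        ≤ |wt k - wt l| * ((d * q (k - l) * freqAbs l) * ‖a l‖) := by gcongr
      _ = d * q (k - l) * ‖a l‖ * (freqAbs l * |wt k - wt l|) := by ring
      _ ≤ d * q (k - l) * ‖a l‖ *
          (K * (freqAbs (k - l) * g l + h (k - l) * freqAbs l)) := by gcongr
      _ = _ := by simp only [hPdef, hPdef']; ring
  have hinner : ∀ k, ‖∑' l, ((wt k - wt l : ℝ) : ℂ) * b k l‖
      ≤ d * K * (∑' l, P (k - l) * (g l * ‖a l‖) + ∑' l, P' (k - l) * (h l * q l)) := by
    intro k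
    have h1 := tsum_of_norm_bounded (((hs1 k).add (hs2 k)).mul_left (d * K)).hasSum (hterm k)
    rw [tsum_mul_left, (hs1 k).tsum_add (hs2 k)] at h1
    -- The convolution is reflected so that in both terms the absolutely summable factor sits at k -
    -- l and the square summable one at l, as Young's inequality is stated.
    have h2 : ∑' l, (h (k - l) * q (k - l)) * P' l = ∑' l, P' (k - l) * (h l * q l) := by
      rw [← (Equiv.subLeft k).tsum_eq]
      simp [mul_comm]
    rwa [h2] at h1
  have hX0 : ∀ k, 0 ≤ wt k * ‖a k‖ := fun k => mul_nonneg (hw0 k) (norm_nonneg _)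
  have hY1 := sum_mul_conv_le (X := fun k => wt k * ‖a k‖) hP0 hq hx hga F
  have hY2 := sum_mul_conv_le (X := fun k => wt k * ‖a k‖) hP0' ha hy hhq F
  calc |(∑ k ∈ F, (wt k : ℂ) * conj (a k) * (∑' l, ((wt k - wt l : ℝ) : ℂ) * b k l)).re|
      ≤ ‖∑ k ∈ F, (wt k : ℂ) * conj (a k) * (∑' l, ((wt k - wt l : ℝ) : ℂ) * b k l)‖ :=
        Complex.abs_re_le_norm _
    _ ≤ ∑ k ∈ F, (wt k * ‖a k‖) * (d * K *
          (∑' l, P (k - l) * (g l * ‖a l‖) + ∑' l, P' (k - l) * (h l * q l))) := by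
        refine (norm_sum_le _ _).trans (Finset.sum_le_sum fun k _ => ?_)
        rw [norm_mul, norm_mul, Complex.norm_real, Real.norm_of_nonneg (hw0 k), RCLike.norm_conj]
        exact mul_le_mul_of_nonneg_left (hinner k) (hX0 k)
    _ = d * K * (∑ k ∈ F, (wt k * ‖a k‖) * ∑' l, P (k - l) * (g l * ‖a l‖)
          + ∑ k ∈ F, (wt k * ‖a k‖) * ∑' l, P' (k - l) * (h l * q l)) := by
        rw [← Finset.sum_add_distrib, Finset.mul_sum]
        exact Finset.sum_congr rfl fun k _ => by ring
    _ ≤ d * K * (√(∑ k ∈ F, (wt k * ‖a k‖) ^ 2) * ((∑' k, P k) * x)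
          + √(∑ k ∈ F, (wt k * ‖a k‖) ^ 2) * ((∑' k, P' k) * y)) := by gcongr
    _ = _ := by ring

end Trilinear

/-! ### Grönwall's inequality with truncated weights. -/

section Gronwall

/-- If `E' ≤ 2 √E G'` then `√E` grows at most like `G`. -/
lemma sqrt_le_of_deriv_le {E E' G G' : ℝ → ℝ} {T : ℝ} (hE0 : ∀ t ∈ Set.Icc 0 T, 0 ≤ E t)
    (hE : ∀ t ∈ Set.Icc 0 T, HasDerivWithinAt E (E' t) (Set.Icc 0 T) t)
    (hG : ∀ t, HasDerivAt G (G' t) t) (hG0 : ∀ t ∈ Set.Icc 0 T, 0 ≤ G' t)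
    (h : ∀ t ∈ Set.Icc 0 T, E' t ≤ 2 * (√(E t) * G' t)) {t : ℝ} (ht : t ∈ Set.Icc 0 T) :
    √(E t) ≤ √(E 0) + (G t - G 0) := by
  have h0 : (0 : ℝ) ∈ Set.Icc 0 T := ⟨le_rfl, ht.1.trans ht.2⟩
  -- The square root need not be differentiable where E vanishes, so E + δ² is used and δ tends to
  -- 0.
  refine le_of_forall_pos_le_add fun δ hδ => ?_
  have hpos : ∀ t ∈ Set.Icc 0 T, 0 < E t + δ ^ 2 := fun t ht => by
    have := hE0 t ht; positivity
  have hd : ∀ t ∈ Set.Icc 0 T, HasDerivWithinAt (fun t => √(E t + δ ^ 2))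
      (E' t / (2 * √(E t + δ ^ 2))) (Set.Icc 0 T) t := fun t ht =>
    ((hE t ht).add_const (δ ^ 2)).sqrt (hpos t ht).ne'
  have key := image_le_of_deriv_right_le_deriv_boundary (f := fun t => √(E t + δ ^ 2))
    (f' := fun t => E' t / (2 * √(E t + δ ^ 2))) (a := 0) (b := T)
    (B := fun t => √(E 0) + δ + (G t - G 0)) (B' := G')
    (fun x hx => (hd x hx).continuousWithinAt)
    (fun x hx => (hd x (Set.Ico_subset_Icc_self hx)).mono_of_mem_nhdsWithin
      (Icc_mem_nhdsGE_of_mem hx)) (by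
        simp only [sub_self, add_zero]
        refine Real.sqrt_le_iff.mpr ⟨by positivity, ?_⟩
        have := Real.sq_sqrt (hE0 0 h0)
        have : 0 ≤ √(E 0) * δ := by positivity
        nlinarith)
    (fun x _ => (((hG x).sub_const _).const_add _).continuousAt.continuousWithinAt)
    (fun x _ => (((hG x).sub_const _).const_add _).hasDerivWithinAt) (fun x hx => by
      have hx' := Set.Ico_subset_Icc_self hx
      have h1 := hpos x hx'
      have h2 : √(E x) ≤ √(E x + δ ^ 2) := Real.sqrt_le_sqrt (by nlinarith)
      rw [div_le_iff₀ (by positivity)]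
      refine (h x hx').trans ?_
      have := mul_le_mul_of_nonneg_right h2 (hG0 x hx')
      linarith) ht
  have h3 : √(E t) ≤ √(E t + δ ^ 2) := Real.sqrt_le_sqrt (by nlinarith)
  linarith

variable {ι : Type*}

/-- Grönwall's inequality for weighted `ℓ²` norms, from estimates for truncated weights. -/
lemma weighted_gronwall {a a' : ℝ → ι → ℂ} {g : ι → ℝ} {wt : ℕ → ι → ℝ}
    {F : ℕ → Finset ι} {T α β x₀ M : ℝ} (hα : 0 ≤ α) (hβ : 0 ≤ β) (hx₀ : 0 ≤ x₀) (hM : 0 ≤ M)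
    (hw0 : ∀ N k, 0 ≤ wt N k) (hwg : ∀ N k, wt N k ≤ g k)
    (hlim : ∀ k, Tendsto (fun N => wt N k) atTop (𝓝 (g k))) (hF : ∀ N, ∀ k ∉ F N, wt N k = 0)
    (ha : ∀ k, ∀ t ∈ Set.Icc 0 T, HasDerivWithinAt (fun t => a t k) (a' t k) (Set.Icc 0 T) t)
    (hstart : ∀ s : Finset ι, ∑ k ∈ s, (g k * ‖a 0 k‖) ^ 2 ≤ x₀ ^ 2)
    (hbd : ∀ t ∈ Set.Icc 0 T, ∀ s : Finset ι, ∑ k ∈ s, (g k * ‖a t k‖) ^ 2 ≤ M ^ 2)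
    (henergy : ∀ t ∈ Set.Icc 0 T, ∀ x : ℝ, 0 ≤ x →
      (∀ s : Finset ι, ∑ k ∈ s, (g k * ‖a t k‖) ^ 2 ≤ x ^ 2) → ∀ N,
      ∑ k ∈ F N, wt N k ^ 2 * (conj (a t k) * a' t k).re
        ≤ √(∑ k ∈ F N, (wt N k * ‖a t k‖) ^ 2) * (α * x + β))
    {t : ℝ} (ht : t ∈ Set.Icc 0 T) (s : Finset ι) :
    ∑ k ∈ s, (g k * ‖a t k‖) ^ 2 ≤ (2 * (x₀ + β * T) * Real.exp (2 * α * T)) ^ 2 := by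
  have hT : 0 ≤ T := ht.1.trans ht.2
  set B := x₀ + β * T with hB
  have hB0 : 0 ≤ B := by positivity
  -- The energy inequality bounds a truncated norm by the full one, so it is not a closed
  -- inequality. Instead, a bound c exp(2αt) for the full norm is improved to (B + c/2) exp(2αt):
  -- integrating α c exp(2αt) produces the factor 1/2. Iteration from the a priori bound M leads to
  -- 2B, and M disappears.
  have hstep : ∀ c, 0 ≤ c → (∀ t ∈ Set.Icc 0 T, ∀ s : Finset ι,
      ∑ k ∈ s, (g k * ‖a t k‖) ^ 2 ≤ (c * Real.exp (2 * α * t)) ^ 2) →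
      ∀ t ∈ Set.Icc 0 T, ∀ s : Finset ι,
      ∑ k ∈ s, (g k * ‖a t k‖) ^ 2 ≤ ((B + c / 2) * Real.exp (2 * α * t)) ^ 2 := by
    intro c hc hy t ht s
    have hN : ∀ N, ∑ k ∈ F N, (wt N k * ‖a t k‖) ^ 2
        ≤ ((B + c / 2) * Real.exp (2 * α * t)) ^ 2 := by
      intro N
      have hd : ∀ t ∈ Set.Icc 0 T, HasDerivWithinAt (fun t => ∑ k ∈ F N, (wt N k * ‖a t k‖) ^ 2)
          (2 * ∑ k ∈ F N, wt N k ^ 2 * (conj (a t k) * a' t k).re) (Set.Icc 0 T) t := by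
        intro t ht
        have h1 := HasDerivWithinAt.fun_sum (u := F N) fun k _ =>
          ((ha k t ht).norm_sq).const_mul (wt N k ^ 2)
        refine (h1.congr_deriv ?_).congr_of_mem (fun t _ => ?_) ht
        · rw [Finset.mul_sum]
          refine Finset.sum_congr rfl fun k _ => ?_
          rw [Complex.inner, mul_comm (a' t k)]; ring
        · exact Finset.sum_congr rfl fun k _ => by ring
      have hG : ∀ t, HasDerivAt (fun t => β * t + c / 2 * Real.exp (2 * α * t))
          (α * (c * Real.exp (2 * α * t)) + β) t := by
        intro t
        have h1 := (((hasDerivAt_id t).const_mul (2 * α)).exp).const_mul (c / 2)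
        have h2 := ((hasDerivAt_id t).const_mul β).add h1
        refine h2.congr_deriv ?_
        simp only [id]; ring
      have key := sqrt_le_of_deriv_le (fun t _ => Finset.sum_nonneg fun k _ => sq_nonneg _) hd hG
        (fun t _ => by positivity) (fun t ht => by
          have := henergy t ht _ (by positivity) (hy t ht) N
          linarith) ht
      have h0 : √(∑ k ∈ F N, (wt N k * ‖a 0 k‖) ^ 2) ≤ x₀ := by
        refine Real.sqrt_le_iff.mpr ⟨hx₀, (Finset.sum_le_sum fun k _ => ?_).trans (hstart (F N))⟩
        have := hw0 N k
        have := hwg N k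
        gcongr
      have h1 : 1 ≤ Real.exp (2 * α * t) :=
        Real.one_le_exp (mul_nonneg (by positivity) ht.1)
      have h2 : β * t ≤ β * T := mul_le_mul_of_nonneg_left ht.2 hβ
      have h3 : B ≤ B * Real.exp (2 * α * t) := le_mul_of_one_le_right hB0 h1
      have h4 : √(∑ k ∈ F N, (wt N k * ‖a t k‖) ^ 2) ≤ (B + c / 2) * Real.exp (2 * α * t) := by
        simp only [mul_zero, Real.exp_zero, mul_one] at key
        linarith
      exact (Real.sqrt_le_left (by positivity)).mp h4
    -- The truncation is removed with the finite set s held fixed; terms of s outside F N have zero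
    -- weight.
    refine le_of_tendsto (tendsto_finsetSum s fun k _ =>
      (((hlim k).mul_const ‖a t k‖).pow 2)) (Eventually.of_forall fun N => le_trans ?_ (hN N))
    classical
    calc ∑ k ∈ s, (wt N k * ‖a t k‖) ^ 2 ≤ ∑ k ∈ s ∪ F N, (wt N k * ‖a t k‖) ^ 2 :=
          Finset.sum_le_sum_of_subset_of_nonneg Finset.subset_union_left
            fun _ _ _ => sq_nonneg _
      _ = ∑ k ∈ F N, (wt N k * ‖a t k‖) ^ 2 :=
          (Finset.sum_subset Finset.subset_union_right fun k _ hk => by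
            rw [hF N k hk]; simp).symm
  have hall : ∀ n : ℕ, ∀ t ∈ Set.Icc 0 T, ∀ s : Finset ι,
      ∑ k ∈ s, (g k * ‖a t k‖) ^ 2 ≤ ((2 * B + M * (1 / 2) ^ n) * Real.exp (2 * α * t)) ^ 2 := by
    intro n
    induction n with
    | zero =>
      intro t ht s
      refine (hbd t ht s).trans ?_
      have h1 : 1 ≤ Real.exp (2 * α * t) :=
        Real.one_le_exp (mul_nonneg (by positivity) ht.1)
      have : M ≤ (2 * B + M * (1 / 2) ^ 0) * Real.exp (2 * α * t) := by
        have := le_mul_of_one_le_right hM h1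
        have : 0 ≤ 2 * B * Real.exp (2 * α * t) := by positivity
        linarith
      gcongr
    | succ n ih =>
      intro t ht s
      refine (hstep _ (by positivity) ih t ht s).trans (le_of_eq ?_)
      rw [pow_succ]; ring
  have hlimn : Tendsto (fun n : ℕ => ((2 * B + M * (1 / 2) ^ n) * Real.exp (2 * α * t)) ^ 2) atTop
      (𝓝 (((2 * B + M * 0) * Real.exp (2 * α * t)) ^ 2)) :=
    ((((tendsto_pow_atTop_nhds_zero_of_lt_one (by norm_num) (by norm_num)).const_mul M).const_add
      (2 * B)).mul_const _).pow 2
  refine (ge_of_tendsto' hlimn fun n => hall n t ht s).trans ?_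
  rw [mul_zero, add_zero]
  have := ht.2
  gcongr

end Gronwall

/-! ### Truncated weights on the lattice. -/

section TruncatedWeights

variable {d : ℕ}

/-- The weight `|k|^p`, cut off at `|k| = N + 1`. -/
noncomputable def truncWeight (p : ℝ) (N : ℕ) (k : Fin d → ℤ) : ℝ :=
  freqAbs k ^ p * cutoff (N + 1) (freqAbs k)

/-- The cube of frequencies with coordinates at most `N + 1`. -/
noncomputable def freqBox (d N : ℕ) : Finset (Fin d → ℤ) :=
  Finset.Icc (fun _ => -((N : ℤ) + 1)) (fun _ => (N : ℤ) + 1)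

lemma truncWeight_nonneg (p : ℝ) (N : ℕ) (k : Fin d → ℤ) : 0 ≤ truncWeight p N k :=
  mul_nonneg (Real.rpow_nonneg (freqAbs_nonneg k) p) (cutoff_nonneg _ _)

lemma truncWeight_le (p : ℝ) (N : ℕ) (k : Fin d → ℤ) : truncWeight p N k ≤ freqAbs k ^ p :=
  mul_le_of_le_one_right (Real.rpow_nonneg (freqAbs_nonneg k) p)
    (cutoff_le_one (by positivity) (freqAbs_nonneg k))

lemma le_freqAbs_of_notMem_freqBox {N : ℕ} {k : Fin d → ℤ} (hk : k ∉ freqBox d N) :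
    (N : ℝ) + 1 ≤ freqAbs k := by
  by_contra! h
  refine hk (Finset.mem_Icc.mpr ?_)
  have h1 : ∀ i, |k i| ≤ (N : ℤ) + 1 := fun i => by
    have := (abs_coord_le_freqAbs k i).trans h.le
    exact_mod_cast this
  exact ⟨fun i => (abs_le.mp (h1 i)).1, fun i => (abs_le.mp (h1 i)).2⟩

lemma truncWeight_eq_zero (p : ℝ) {N : ℕ} {k : Fin d → ℤ} (hk : k ∉ freqBox d N) :
    truncWeight p N k = 0 := by
  unfold truncWeight
  rw [cutoff_eq_zero (by positivity) (le_freqAbs_of_notMem_freqBox hk), mul_zero]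

lemma tendsto_truncWeight (p : ℝ) (k : Fin d → ℤ) :
    Tendsto (fun N => truncWeight p N k) atTop (𝓝 (freqAbs k ^ p)) := by
  have h1 : Tendsto (fun N : ℕ => freqAbs k / ((N : ℝ) + 1)) atTop (𝓝 0) :=
    tendsto_const_nhds.div_atTop (tendsto_natCast_atTop_atTop.atTop_add tendsto_const_nhds)
  have h2 : Tendsto (fun N : ℕ => max 0 (1 - freqAbs k / ((N : ℝ) + 1))) atTop
      (𝓝 (max 0 (1 - 0))) := tendsto_const_nhds.max (h1.const_sub 1)
  have h3 := h2.const_mul (freqAbs k ^ p)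
  rw [sub_zero, max_eq_right zero_le_one, mul_one] at h3
  exact h3

lemma mul_abs_truncWeight_sub_le {p : ℝ} (hp : 1 ≤ p) (N : ℕ) (k l : Fin d → ℤ) :
    freqAbs l * |truncWeight p N k - truncWeight p N l|
      ≤ (3 ^ p * (1 + p) + 2)
        * (freqAbs (k - l) * freqAbs l ^ p + freqAbs (k - l) ^ p * freqAbs l) :=
  mul_abs_weight_sub_le hp (by positivity) (freqAbs_nonneg k) (freqAbs_nonneg l)
    (abs_freqAbs_sub_le k l)

/-- For p = 0 the commutator has no term that differentiates the velocity to high order, so the L²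
estimate can be used with h = 0. -/
lemma mul_abs_truncWeight_zero_sub_le (N : ℕ) (k l : Fin d → ℤ) :
    freqAbs l * |truncWeight 0 N k - truncWeight 0 N l| ≤ 2 * freqAbs (k - l) := by
  simp only [truncWeight, Real.rpow_zero, one_mul]
  exact mul_abs_cutoff_sub_le (by positivity) (freqAbs_nonneg k) (freqAbs_nonneg l)
    (abs_freqAbs_sub_le k l)

end TruncatedWeights

/-! ### Energy inequality for transport with forcing. -/

section Energy

variable {d : ℕ}

/-- The weighted energy inequality for a transport equation with a real divergence free velocity. -/
lemma weighted_energy {a f : ℝ → (Fin d → ℤ) → ℂ} {v : ℝ → Fin d → (Fin d → ℤ) → ℂ}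
    {q : ℝ → (Fin d → ℤ) → ℝ} {h : (Fin d → ℤ) → ℝ} {p T K Q R V γ β x₀ M : ℝ}
    (hK : 0 ≤ K) (hV : 0 ≤ V) (hQ : 0 ≤ Q) (hR : 0 ≤ R) (hγ : 0 ≤ γ) (hβ : 0 ≤ β) (hx₀ : 0 ≤ x₀)
    (hM : 0 ≤ M) (hh0 : ∀ k, 0 ≤ h k)
    (hker : ∀ N k l, freqAbs l * |truncWeight p N k - truncWeight p N l|
      ≤ K * (freqAbs (k - l) * freqAbs l ^ p + h (k - l) * freqAbs l))
    (hder : ∀ k, ∀ t ∈ Set.Icc 0 T, HasDerivWithinAt (fun t => a t k)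
      (f t k - advection (v t) (a t) k) (Set.Icc 0 T) t)
    (hconj : ∀ t ∈ Set.Icc 0 T, ∀ j k, v t j (-k) = conj (v t j k))
    (hdiv : ∀ t ∈ Set.Icc 0 T, ∀ k, ∑ j, v t j k * (k j : ℂ) = 0)
    (hv : ∀ t ∈ Set.Icc 0 T, ∀ j k, ‖v t j k‖ ≤ q t k) (hq0 : ∀ t ∈ Set.Icc 0 T, ∀ k, 0 ≤ q t k)
    (hqs : ∀ t ∈ Set.Icc 0 T, Summable (q t))
    (hqn : ∀ t ∈ Set.Icc 0 T, Summable fun k => freqAbs k * q t k)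
    (hqQ : ∀ t ∈ Set.Icc 0 T, ∑' k, freqAbs k * q t k ≤ Q)
    (han : ∀ t ∈ Set.Icc 0 T, Summable fun k => freqAbs k * ‖a t k‖)
    (haR : ∀ t ∈ Set.Icc 0 T, ∑' k, freqAbs k * ‖a t k‖ ≤ R)
    (hhq : ∀ t ∈ Set.Icc 0 T, ∀ x : ℝ, 0 ≤ x →
      (∀ F : Finset (Fin d → ℤ), ∑ k ∈ F, (freqAbs k ^ p * ‖a t k‖) ^ 2 ≤ x ^ 2) →
      ∀ F : Finset (Fin d → ℤ), ∑ k ∈ F, (h k * q t k) ^ 2 ≤ (V * x) ^ 2)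
    (hf : ∀ t ∈ Set.Icc 0 T, ∀ x : ℝ, 0 ≤ x →
      (∀ F : Finset (Fin d → ℤ), ∑ k ∈ F, (freqAbs k ^ p * ‖a t k‖) ^ 2 ≤ x ^ 2) →
      ∀ F : Finset (Fin d → ℤ), ∑ k ∈ F, (freqAbs k ^ p * ‖f t k‖) ^ 2 ≤ (γ * x + β) ^ 2)
    (hstart : ∀ F : Finset (Fin d → ℤ), ∑ k ∈ F, (freqAbs k ^ p * ‖a 0 k‖) ^ 2 ≤ x₀ ^ 2)
    (hbd : ∀ t ∈ Set.Icc 0 T, ∀ F : Finset (Fin d → ℤ),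
      ∑ k ∈ F, (freqAbs k ^ p * ‖a t k‖) ^ 2 ≤ M ^ 2)
    {t : ℝ} (ht : t ∈ Set.Icc 0 T) (F : Finset (Fin d → ℤ)) :
    ∑ k ∈ F, (freqAbs k ^ p * ‖a t k‖) ^ 2
      ≤ (2 * (x₀ + β * T) * Real.exp (2 * (d * K * (Q + R * V) + γ) * T)) ^ 2 := by
  refine weighted_gronwall (wt := truncWeight p) (F := freqBox d) (by positivity) hβ hx₀ hM
    (truncWeight_nonneg p) (truncWeight_le p) (tendsto_truncWeight p)
    (fun N k hk => truncWeight_eq_zero p hk) hder hstart hbd ?_ ht F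
  intro t ht x hx hax N
  have hadv := abs_re_sum_advection_le (hconj t ht) (hdiv t ht) (hv t ht) (hqs t ht) (hqn t ht)
    (han t ht) hK (truncWeight_nonneg p N) (fun k => Real.rpow_nonneg (freqAbs_nonneg k) p) hh0
    (F := freqBox d N) (fun k hk => truncWeight_eq_zero p hk) (hq0 t ht) (hker N) hx
    (mul_nonneg hV hx) hax (hhq t ht x hx hax)
  set E := √(∑ k ∈ freqBox d N, (truncWeight p N k * ‖a t k‖) ^ 2) with hE
  have hE0 : 0 ≤ E := Real.sqrt_nonneg _
  have hforce : ∑ k ∈ freqBox d N, truncWeight p N k ^ 2 * (conj (a t k) * f t k).re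
      ≤ E * (γ * x + β) := by
    calc ∑ k ∈ freqBox d N, truncWeight p N k ^ 2 * (conj (a t k) * f t k).re
        ≤ ∑ k ∈ freqBox d N, (truncWeight p N k * ‖a t k‖) * (truncWeight p N k * ‖f t k‖) := by
          refine Finset.sum_le_sum fun k _ => ?_
          have h1 : (conj (a t k) * f t k).re ≤ ‖a t k‖ * ‖f t k‖ := by
            refine (Complex.re_le_norm _).trans ?_
            rw [norm_mul, RCLike.norm_conj]
          have h2 := mul_le_mul_of_nonneg_left h1 (sq_nonneg (truncWeight p N k))
          linarith
      _ ≤ E * √(∑ k ∈ freqBox d N, (truncWeight p N k * ‖f t k‖) ^ 2) :=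
          Real.sum_mul_le_sqrt_mul_sqrt _ _ _
      _ ≤ E * (γ * x + β) := by
          refine mul_le_mul_of_nonneg_left (Real.sqrt_le_iff.mpr ⟨by positivity, ?_⟩) hE0
          refine (Finset.sum_le_sum fun k _ => ?_).trans (hf t ht x hx hax (freqBox d N))
          have := truncWeight_nonneg p N k
          have := truncWeight_le p N k
          gcongr
  have hsplit : ∑ k ∈ freqBox d N, truncWeight p N k ^ 2 *
        (conj (a t k) * (f t k - advection (v t) (a t) k)).re
      = ∑ k ∈ freqBox d N, truncWeight p N k ^ 2 * (conj (a t k) * f t k).re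
        - (∑ k ∈ freqBox d N, (truncWeight p N k : ℂ) ^ 2 *
          (conj (a t k) * advection (v t) (a t) k)).re := by
    rw [Complex.re_sum, ← Finset.sum_sub_distrib]
    refine Finset.sum_congr rfl fun k _ => ?_
    rw [← Complex.ofReal_pow, Complex.re_ofReal_mul, mul_sub, Complex.sub_re]
    ring
  rw [hsplit]
  have h1 : d * K * E * ((∑' k, freqAbs k * q t k) * x + (∑' k, freqAbs k * ‖a t k‖) * (V * x))
      ≤ d * K * E * (Q * x + R * (V * x)) := by
    have := hqQ t ht
    have := haR t ht
    gcongr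
  have h2 := (abs_le.mp hadv).1
  calc _ ≤ E * (γ * x + β) + d * K * E * (Q * x + R * (V * x)) := by linarith
    _ = _ := by ring

/-- Minkowski's inequality for finite `ℓ²` sums. -/
lemma sum_add_sq_le {ι : Type*} {F : Finset ι} {P Q : ι → ℝ} {x y : ℝ} (hx : 0 ≤ x) (hy : 0 ≤ y)
    (hP : ∑ k ∈ F, P k ^ 2 ≤ x ^ 2) (hQ : ∑ k ∈ F, Q k ^ 2 ≤ y ^ 2) :
    ∑ k ∈ F, (P k + Q k) ^ 2 ≤ (x + y) ^ 2 := by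
  have h1 := Real.sum_mul_le_sqrt_mul_sqrt F P Q
  have h2 : √(∑ k ∈ F, P k ^ 2) * √(∑ k ∈ F, Q k ^ 2) ≤ x * y :=
    mul_le_mul (Real.sqrt_le_iff.mpr ⟨hx, hP⟩) (Real.sqrt_le_iff.mpr ⟨hy, hQ⟩)
      (Real.sqrt_nonneg _) hx
  have h3 : ∑ k ∈ F, (P k + Q k) ^ 2
      = ∑ k ∈ F, P k ^ 2 + 2 * ∑ k ∈ F, P k * Q k + ∑ k ∈ F, Q k ^ 2 := by
    rw [Finset.mul_sum, ← Finset.sum_add_distrib, ← Finset.sum_add_distrib]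
    exact Finset.sum_congr rfl fun k _ => by ring
  rw [h3]
  nlinarith

lemma sum_weighted_sub_sq_le {ι : Type*} {g : ι → ℝ} {a b : ι → ℂ} {x y : ℝ} (hx : 0 ≤ x)
    (hy : 0 ≤ y) (ha : ∀ F : Finset ι, ∑ k ∈ F, (g k * ‖a k‖) ^ 2 ≤ x ^ 2)
    (hb : ∀ F : Finset ι, ∑ k ∈ F, (g k * ‖b k‖) ^ 2 ≤ y ^ 2) (F : Finset ι) :
    ∑ k ∈ F, (g k * ‖a k - b k‖) ^ 2 ≤ (x + y) ^ 2 := by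
  refine (Finset.sum_le_sum fun k _ => ?_).trans (sum_add_sq_le (P := fun k => |g k| * ‖a k‖)
    (Q := fun k => |g k| * ‖b k‖) hx hy ?_ ?_)
  · rw [← mul_add, mul_pow, mul_pow, sq_abs]
    have := norm_sub_le (a k) (b k)
    gcongr
  · simpa only [mul_pow, sq_abs] using ha F
  · simpa only [mul_pow, sq_abs] using hb F

/-- The `L²` bound for the advection of a function with absolutely summable gradient. -/
lemma sum_norm_advection_sq_le {v : Fin d → (Fin d → ℤ) → ℂ} {b : (Fin d → ℤ) → ℂ}
    {q : (Fin d → ℤ) → ℝ} {x R : ℝ} (hx : 0 ≤ x) (hq0 : ∀ k, 0 ≤ q k) (hqs : Summable q)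
    (hv : ∀ j k, ‖v j k‖ ≤ q k) (hb : Summable fun k => freqAbs k * ‖b k‖)
    (hbR : ∑' k, freqAbs k * ‖b k‖ ≤ R)
    (hq : ∀ F : Finset (Fin d → ℤ), ∑ k ∈ F, q k ^ 2 ≤ x ^ 2) (F : Finset (Fin d → ℤ)) :
    ∑ k ∈ F, ‖advection v b k‖ ^ 2 ≤ (d * R * x) ^ 2 := by
  have hb0 : ∀ k, 0 ≤ freqAbs k * ‖b k‖ := fun k => mul_nonneg (freqAbs_nonneg k) (norm_nonneg _)
  have hR0 : 0 ≤ R := (tsum_nonneg hb0).trans hbR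
  have h1 : ∀ k, ‖advection v b k‖ ≤ d * ∑' l, (freqAbs (k - l) * ‖b (k - l)‖) * q l := by
    intro k
    have h2 := exp_mul_norm_advection_le (v := v) (b := b) (le_refl (0 : ℝ)) hq0 hqs hb
      (fun j k => by simpa using hv j k) (fun k => by simp) k
    simp only [zero_mul, Real.exp_zero, one_mul] at h2
    refine h2.trans (le_of_eq ?_)
    unfold conv
    rw [← (Equiv.subLeft k).tsum_eq]
    simp [mul_comm]
  set X := √(∑ k ∈ F, ‖advection v b k‖ ^ 2) with hX
  have hXs : X ^ 2 = ∑ k ∈ F, ‖advection v b k‖ ^ 2 :=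
    Real.sq_sqrt (Finset.sum_nonneg fun _ _ => sq_nonneg _)
  have hX0 : 0 ≤ X := Real.sqrt_nonneg _
  -- Duality: the convolution inequality is tested with the sequence of norms itself, and one factor
  -- X is cancelled.
  have h3 : X ^ 2 ≤ X * (d * R * x) := by
    rw [hXs]
    calc ∑ k ∈ F, ‖advection v b k‖ ^ 2
        ≤ ∑ k ∈ F, d * (‖advection v b k‖ * ∑' l, (freqAbs (k - l) * ‖b (k - l)‖) * q l) := by
          refine Finset.sum_le_sum fun k _ => ?_
          have := mul_le_mul_of_nonneg_left (h1 k) (norm_nonneg (advection v b k))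
          linarith
      _ ≤ d * (X * ((∑' k, freqAbs k * ‖b k‖) * x)) := by
          rw [← Finset.mul_sum]
          exact mul_le_mul_of_nonneg_left
            (sum_mul_conv_le (X := fun k => ‖advection v b k‖) hb0 hb hx hq F) (Nat.cast_nonneg d)
      _ ≤ d * (X * (R * x)) := by gcongr
      _ = X * (d * R * x) := by ring
  rw [← hXs]
  have hY : 0 ≤ d * R * x := by positivity
  rcases hX0.eq_or_lt with h0 | h0
  · rw [← h0, zero_pow two_ne_zero]; positivity
  · have : X ≤ d * R * x := by nlinarith
    gcongr

end Energy

/-! ### Sobolev embedding and interpolation for sequences. -/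

section SobolevSequences

variable {d : ℕ}

lemma freqAbs_mul_eq {s : ℝ} (k : Fin d → ℤ) (y : ℝ) :
    freqAbs k * y = freqAbs k ^ (1 - s) * (freqAbs k ^ s * y) := by
  by_cases hk : k = 0
  · subst hk
    rw [freqAbs_zero]
    by_cases hs : s = 0
    · subst hs; simp
    · rw [Real.zero_rpow hs]; simp
  · rw [← mul_assoc, ← Real.rpow_add (freqAbs_pos hk), sub_add_cancel, Real.rpow_one]

lemma freqAbs_rpow_sq (s : ℝ) (k : Fin d → ℤ) : (freqAbs k ^ s) ^ 2 = freqAbs k ^ (2 * s) := by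
  rw [mul_comm, Real.rpow_mul (freqAbs_nonneg k), Real.rpow_two]

lemma summable_freqAbs_rpow_one_sub_sq {s : ℝ} (hs : (d : ℝ) / 2 + 1 < s) :
    Summable fun k : Fin d → ℤ => (freqAbs k ^ (1 - s)) ^ 2 := by
  refine (summable_freqAbs_rpow (d := d) (p := 2 * s - 2) (by linarith)).congr fun k => ?_
  rw [freqAbs_rpow_sq]; congr 1; ring

/-- Cauchy–Schwarz after writing |k| = |k|^(1-s) |k|^s. Keeping the finite sum of weights, rather
than its limit, makes the tail estimates below possible. -/
lemma sum_freqAbs_mul_le {s x : ℝ} {b : (Fin d → ℤ) → ℂ} (hx : 0 ≤ x)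
    (hb : ∀ F : Finset (Fin d → ℤ), ∑ k ∈ F, (freqAbs k ^ s * ‖b k‖) ^ 2 ≤ x ^ 2)
    (F : Finset (Fin d → ℤ)) :
    ∑ k ∈ F, freqAbs k * ‖b k‖ ≤ √(∑ k ∈ F, (freqAbs k ^ (1 - s)) ^ 2) * x := by
  calc ∑ k ∈ F, freqAbs k * ‖b k‖
      = ∑ k ∈ F, freqAbs k ^ (1 - s) * (freqAbs k ^ s * ‖b k‖) :=
        Finset.sum_congr rfl fun k _ => freqAbs_mul_eq k _
    _ ≤ _ := Real.sum_mul_le_sqrt_mul_sqrt _ _ _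
    _ ≤ _ := mul_le_mul_of_nonneg_left (Real.sqrt_le_iff.mpr ⟨hx, hb F⟩) (Real.sqrt_nonneg _)

/-- The Sobolev embedding `H^s ⊆ W^{1,∞}` on the Fourier side. -/
lemma summable_freqAbs_mul {s x : ℝ} (hs : (d : ℝ) / 2 + 1 < s) {b : (Fin d → ℤ) → ℂ} (hx : 0 ≤ x)
    (hb : ∀ F : Finset (Fin d → ℤ), ∑ k ∈ F, (freqAbs k ^ s * ‖b k‖) ^ 2 ≤ x ^ 2) :
    Summable (fun k => freqAbs k * ‖b k‖) ∧
      ∑' k, freqAbs k * ‖b k‖ ≤ √(∑' k : Fin d → ℤ, (freqAbs k ^ (1 - s)) ^ 2) * x := by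
  have h1 : ∀ F : Finset (Fin d → ℤ), ∑ k ∈ F, freqAbs k * ‖b k‖
      ≤ √(∑' k : Fin d → ℤ, (freqAbs k ^ (1 - s)) ^ 2) * x := fun F =>
    (sum_freqAbs_mul_le hx hb F).trans (mul_le_mul_of_nonneg_right (Real.sqrt_le_sqrt
      ((summable_freqAbs_rpow_one_sub_sq hs).sum_le_tsum F fun _ _ => sq_nonneg _)) hx)
  have h2 : Summable (fun k => freqAbs k * ‖b k‖) :=
    summable_of_sum_le (fun k => mul_nonneg (freqAbs_nonneg k) (norm_nonneg _)) h1
  exact ⟨h2, h2.tsum_le_of_sum_le h1⟩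

lemma summable_norm_of_freqAbs_mul {b : (Fin d → ℤ) → ℂ} (h0 : b 0 = 0)
    (hb : Summable fun k => freqAbs k * ‖b k‖) : Summable fun k => ‖b k‖ := by
  refine Summable.of_nonneg_of_le (fun k => norm_nonneg _) (fun k => ?_) hb
  by_cases hk : k = 0
  · rw [hk, h0, norm_zero, mul_zero]
  · exact le_mul_of_one_le_left (norm_nonneg _) (one_le_freqAbs hk)

/-- On bounded sets of `H^s`, the `W^{1,∞}` norm is controlled by finitely many coefficients. -/
lemma exists_finset_tsum_freqAbs_mul_le {s M ε : ℝ} (hs : (d : ℝ) / 2 + 1 < s) (hM : 0 ≤ M)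
    (hε : 0 < ε) : ∃ F : Finset (Fin d → ℤ), ∃ δ : ℝ, 0 < δ ∧ ∀ b : (Fin d → ℤ) → ℂ,
      (∀ F : Finset (Fin d → ℤ), ∑ k ∈ F, (freqAbs k ^ s * ‖b k‖) ^ 2 ≤ M ^ 2) →
      (∀ k ∈ F, ‖b k‖ ≤ δ) → ∑' k, freqAbs k * ‖b k‖ ≤ ε := by
  classical
  have hη : 0 < ε / (2 * (M + 1)) := by positivity
  -- Outside F the weights |k|^(2-2s) have small sum, which handles the tail for every b in the
  -- ball; on F the size of the coefficients decides, and δ is chosen accordingly.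
  obtain ⟨F, hF⟩ := summable_iff_vanishing_norm.mp (summable_freqAbs_rpow_one_sub_sq hs)
    ((ε / (2 * (M + 1))) ^ 2) (by positivity)
  have hS : 0 ≤ ∑ k ∈ F, freqAbs k := Finset.sum_nonneg fun k _ => freqAbs_nonneg k
  refine ⟨F, ε / (2 * (∑ k ∈ F, freqAbs k + 1)), by positivity, fun b hb hbF => ?_⟩
  refine (summable_freqAbs_mul hs hM hb).1.tsum_le_of_sum_le fun G => ?_
  have hn : ∀ k, 0 ≤ freqAbs k * ‖b k‖ := fun k => mul_nonneg (freqAbs_nonneg k) (norm_nonneg _)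
  have h1 : ∑ k ∈ F, freqAbs k * ‖b k‖ ≤ ε / 2 := by
    calc ∑ k ∈ F, freqAbs k * ‖b k‖
        ≤ ∑ k ∈ F, freqAbs k * (ε / (2 * (∑ k ∈ F, freqAbs k + 1))) :=
          Finset.sum_le_sum fun k hk => mul_le_mul_of_nonneg_left (hbF k hk) (freqAbs_nonneg k)
      _ = (∑ k ∈ F, freqAbs k) * (ε / (2 * (∑ k ∈ F, freqAbs k + 1))) := by rw [Finset.sum_mul]
      _ ≤ (∑ k ∈ F, freqAbs k + 1) * (ε / (2 * (∑ k ∈ F, freqAbs k + 1))) := by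
          gcongr; linarith
      _ = ε / 2 := by field_simp
  have h2 : ∑ k ∈ G \ F, freqAbs k * ‖b k‖ ≤ ε / 2 := by
    have h3 := hF (G \ F) Finset.sdiff_disjoint
    rw [Real.norm_of_nonneg (Finset.sum_nonneg fun k _ => sq_nonneg _)] at h3
    calc ∑ k ∈ G \ F, freqAbs k * ‖b k‖
        ≤ √(∑ k ∈ G \ F, (freqAbs k ^ (1 - s)) ^ 2) * M := sum_freqAbs_mul_le hM hb _
      _ ≤ (ε / (2 * (M + 1))) * (M + 1) := by
          have := Real.sqrt_le_iff.mpr ⟨hη.le, h3.le⟩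
          gcongr; linarith
      _ = ε / 2 := by field_simp
  calc ∑ k ∈ G, freqAbs k * ‖b k‖ ≤ ∑ k ∈ G ∪ F, freqAbs k * ‖b k‖ :=
        Finset.sum_le_sum_of_subset_of_nonneg Finset.subset_union_left fun k _ _ => hn k
    _ = ∑ k ∈ G \ F, freqAbs k * ‖b k‖ + ∑ k ∈ F, freqAbs k * ‖b k‖ := by
        rw [← Finset.sdiff_union_self_eq_union, Finset.sum_union Finset.sdiff_disjoint]
    _ ≤ ε := by linarith

/-- On bounded sets of `H^s`, the `H^{s-1}` norm is controlled by finitely many coefficients. -/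
lemma exists_finset_sum_sq_le {s M ε : ℝ} (hs : 1 ≤ s)
    (hε : 0 < ε) : ∃ F : Finset (Fin d → ℤ), ∃ δ : ℝ, 0 < δ ∧ ∀ b : (Fin d → ℤ) → ℂ, b 0 = 0 →
      (∀ F : Finset (Fin d → ℤ), ∑ k ∈ F, (freqAbs k ^ s * ‖b k‖) ^ 2 ≤ M ^ 2) →
      (∀ k ∈ F, ‖b k‖ ≤ δ) → ∀ G : Finset (Fin d → ℤ),
        ∑ k ∈ G, (1 + freqAbs k ^ 2) ^ (s - 1) * ‖b k‖ ^ 2 ≤ ε := by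
  classical
  -- Beyond the box of size N + 1 the H^{s-1} weight is at most 2^(s-1)/(N+1) times the H^s weight.
  obtain ⟨N, hN⟩ := exists_nat_gt (2 ^ (s - 1) * M ^ 2 / (ε / 2))
  set W := ∑ k ∈ freqBox d N, (1 + freqAbs k ^ 2) ^ (s - 1) with hW
  have hn : ∀ k : Fin d → ℤ, 0 ≤ (1 + freqAbs k ^ 2) ^ (s - 1) := fun k => by positivity
  have hW0 : 0 ≤ W := Finset.sum_nonneg fun k _ => hn k
  have hδ : 0 < ε / (2 * (W + 1)) := by positivity
  refine ⟨freqBox d N, √(ε / (2 * (W + 1))), Real.sqrt_pos.mpr hδ, fun b hb0 hb hbF G => ?_⟩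
  have h1 : ∑ k ∈ freqBox d N, (1 + freqAbs k ^ 2) ^ (s - 1) * ‖b k‖ ^ 2 ≤ ε / 2 := by
    calc _ ≤ ∑ k ∈ freqBox d N, (1 + freqAbs k ^ 2) ^ (s - 1) * (ε / (2 * (W + 1))) := by
          refine Finset.sum_le_sum fun k hk => mul_le_mul_of_nonneg_left ?_ (hn k)
          rw [← Real.sq_sqrt hδ.le]
          have := hbF k hk
          gcongr
      _ = W * (ε / (2 * (W + 1))) := by rw [← Finset.sum_mul]
      _ ≤ (W + 1) * (ε / (2 * (W + 1))) := by gcongr; linarith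
      _ = ε / 2 := by field_simp
  have h2 : ∑ k ∈ G \ freqBox d N, (1 + freqAbs k ^ 2) ^ (s - 1) * ‖b k‖ ^ 2 ≤ ε / 2 := by
    have h3 : ∀ k ∈ G \ freqBox d N, (1 + freqAbs k ^ 2) ^ (s - 1) * ‖b k‖ ^ 2
        ≤ (2 ^ (s - 1) / (N + 1)) * (freqAbs k ^ s * ‖b k‖) ^ 2 := by
      intro k hk
      have hk2 : (N : ℝ) + 1 ≤ freqAbs k := le_freqAbs_of_notMem_freqBox (Finset.mem_sdiff.mp hk).2
      have hN0 : (0 : ℝ) ≤ N := Nat.cast_nonneg N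
      have hk0 : 0 < freqAbs k := by linarith
      have hk1 : 1 ≤ freqAbs k := by linarith
      have h4 : (1 + freqAbs k ^ 2) ^ (s - 1) ≤ 2 ^ (s - 1) * freqAbs k ^ (2 * s) / freqAbs k ^ 2 := by
        calc (1 + freqAbs k ^ 2) ^ (s - 1) ≤ (2 * freqAbs k ^ 2) ^ (s - 1) :=
              Real.rpow_le_rpow (by positivity) (by nlinarith) (by linarith)
          _ = 2 ^ (s - 1) * freqAbs k ^ (2 * s) / freqAbs k ^ 2 := by
              rw [Real.mul_rpow (by norm_num) (by positivity), mul_div_assoc, ← Real.rpow_two,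
                ← Real.rpow_mul hk0.le, ← Real.rpow_sub hk0]
              congr 2; ring
      have h5 : (N : ℝ) + 1 ≤ freqAbs k ^ 2 := by nlinarith
      rw [mul_pow, freqAbs_rpow_sq]
      calc (1 + freqAbs k ^ 2) ^ (s - 1) * ‖b k‖ ^ 2
          ≤ (2 ^ (s - 1) * freqAbs k ^ (2 * s) / freqAbs k ^ 2) * ‖b k‖ ^ 2 := by gcongr
        _ ≤ (2 ^ (s - 1) * freqAbs k ^ (2 * s) / (N + 1)) * ‖b k‖ ^ 2 := by gcongr
        _ = _ := by ring
    refine (Finset.sum_le_sum h3).trans ?_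
    rw [← Finset.mul_sum]
    calc (2 ^ (s - 1) / ((N : ℝ) + 1)) * ∑ k ∈ G \ freqBox d N, (freqAbs k ^ s * ‖b k‖) ^ 2
        ≤ (2 ^ (s - 1) / ((N : ℝ) + 1)) * M ^ 2 := by gcongr; exact hb _
      _ ≤ ε / 2 := by
          rw [div_lt_iff₀ (by positivity)] at hN
          rw [div_mul_eq_mul_div, div_le_iff₀ (by positivity)]
          linarith
  calc _ ≤ ∑ k ∈ G ∪ freqBox d N, (1 + freqAbs k ^ 2) ^ (s - 1) * ‖b k‖ ^ 2 :=
        Finset.sum_le_sum_of_subset_of_nonneg Finset.subset_union_left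
          fun k _ _ => mul_nonneg (hn k) (sq_nonneg _)
    _ = ∑ k ∈ G \ freqBox d N, (1 + freqAbs k ^ 2) ^ (s - 1) * ‖b k‖ ^ 2
        + ∑ k ∈ freqBox d N, (1 + freqAbs k ^ 2) ^ (s - 1) * ‖b k‖ ^ 2 := by
        rw [← Finset.sdiff_union_self_eq_union, Finset.sum_union Finset.sdiff_disjoint]
    _ ≤ ε := by linarith

/-- The `W^{1,∞}` norm of a curve bounded in `H^s` with continuous coefficients is continuous. -/
lemma continuousOn_tsum_freqAbs_mul {s M T : ℝ} (hs : (d : ℝ) / 2 + 1 < s) (hM : 0 ≤ M)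
    {a : ℝ → (Fin d → ℤ) → ℂ}
    (hb : ∀ t ∈ Set.Icc 0 T, ∀ F : Finset (Fin d → ℤ),
      ∑ k ∈ F, (freqAbs k ^ s * ‖a t k‖) ^ 2 ≤ M ^ 2)
    (hc : ∀ k, ContinuousOn (fun t => a t k) (Set.Icc 0 T)) :
    ContinuousOn (fun t => ∑' k, freqAbs k * ‖a t k‖) (Set.Icc 0 T) := by
  intro t ht
  rw [ContinuousWithinAt, Metric.tendsto_nhds]
  intro ε hε
  obtain ⟨F, δ, hδ, hF⟩ := exists_finset_tsum_freqAbs_mul_le hs (by positivity : 0 ≤ M + M)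
    (half_pos hε)
  have hev : ∀ᶠ t' in 𝓝[Set.Icc 0 T] t, ∀ k ∈ F, ‖a t' k - a t k‖ ≤ δ := by
    refine (Filter.eventually_all_finset F).mpr fun k _ => ?_
    have := (Metric.tendsto_nhds.mp (hc k t ht)) δ hδ
    filter_upwards [this] with t' h
    rw [dist_eq_norm] at h
    exact h.le
  filter_upwards [hev, self_mem_nhdsWithin] with t' h1 ht'
  have hdiff : ∀ G : Finset (Fin d → ℤ),
      ∑ k ∈ G, (freqAbs k ^ s * ‖a t' k - a t k‖) ^ 2 ≤ (M + M) ^ 2 := fun G =>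
    sum_weighted_sub_sq_le hM hM (hb t' ht') (hb t ht) G
  have h2 := hF (fun k => a t' k - a t k) hdiff h1
  have hs1 := (summable_freqAbs_mul hs hM (hb t' ht')).1
  have hs2 := (summable_freqAbs_mul hs hM (hb t ht)).1
  have hs3 := (summable_freqAbs_mul hs (by positivity : 0 ≤ M + M)
    (b := fun k => a t' k - a t k) hdiff).1
  have h3 : ‖∑' k, (freqAbs k * ‖a t' k‖ - freqAbs k * ‖a t k‖)‖
      ≤ ∑' k, freqAbs k * ‖a t' k - a t k‖ := by
    refine tsum_of_norm_bounded hs3.hasSum fun k => ?_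
    rw [← mul_sub, norm_mul, Real.norm_of_nonneg (freqAbs_nonneg k)]
    exact mul_le_mul_of_nonneg_left (abs_norm_sub_norm_le _ _) (freqAbs_nonneg k)
  rw [hs1.tsum_sub hs2] at h3
  rw [Real.dist_eq]
  rw [Real.norm_eq_abs] at h3
  linarith

end SobolevSequences

/-- A continuity argument. -/
lemma lt_of_continuous_induction {A : ℝ → ℝ} {T R : ℝ} (hA : ContinuousOn A (Set.Icc 0 T))
    (h0 : A 0 ≤ R)
    (hstep : ∀ t ∈ Set.Icc 0 T, (∀ σ ∈ Set.Icc 0 t, A σ ≤ R) → A t < R)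
    {t : ℝ} (ht : t ∈ Set.Icc 0 T) : A t < R := by
  obtain ⟨y, hy, hyA, hyex⟩ := exists_running_max (ht.1.trans ht.2) hA
  have h00 : (0 : ℝ) ∈ Set.Icc 0 T := ⟨le_rfl, ht.1.trans ht.2⟩
  -- The running maximum never equals R: at the point where it is attained the step gives a strict
  -- inequality. Starting at most at R, it can then not cross.
  have hne : ∀ τ ∈ Set.Icc 0 T, y τ ≠ R := by
    intro τ hτ hyR
    obtain ⟨σ, hσ, hyσ⟩ := hyex τ hτ
    have := hstep σ ⟨hσ.1, hσ.2.trans hτ.2⟩ fun ρ hρ =>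
      hyR ▸ hyA τ hτ ρ ⟨hρ.1, hρ.2.trans hσ.2⟩
    linarith
  have hy0 : y 0 ≤ R := by
    obtain ⟨σ, hσ, hyσ⟩ := hyex 0 h00
    rw [hyσ, le_antisymm hσ.2 hσ.1]; exact h0
  refine (hyA t ht t ⟨ht.1, le_rfl⟩).trans_lt ?_
  by_contra! hR
  obtain ⟨τ, hτ, hτR⟩ := intermediate_value_Icc ht.1
    (hy.mono (Set.Icc_subset_Icc le_rfl ht.2)) ⟨hy0, hR⟩
  exact hne τ ⟨hτ.1, hτ.2.trans ht.2⟩ hτR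

/-! ### H^s bound, L² stability and flow for Sobolev solutions. -/

section SobolevEstimates

variable {d : ℕ}

/-- The `H^s` bound for a solution in terms of its `W^{1,∞}` norm. -/
lemma sobolev_bound {a : ℝ → (Fin d → ℤ) → ℂ} {v : ℝ → Fin d → (Fin d → ℤ) → ℂ}
    {S : (Fin d → ℤ) → ℂ} {s T V R β x₀ M : ℝ} (hs : 1 ≤ s) (hV : 0 ≤ V) (hR : 0 ≤ R)
    (hβ : 0 ≤ β) (hx₀ : 0 ≤ x₀) (hM : 0 ≤ M)
    (hder : ∀ k, ∀ t ∈ Set.Icc 0 T, HasDerivWithinAt (fun t => a t k)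
      (S k - advection (v t) (a t) k) (Set.Icc 0 T) t)
    (hconj : ∀ t ∈ Set.Icc 0 T, ∀ j k, v t j (-k) = conj (v t j k))
    (hdiv : ∀ t ∈ Set.Icc 0 T, ∀ k, ∑ j, v t j k * (k j : ℂ) = 0)
    (hv : ∀ t ∈ Set.Icc 0 T, ∀ j k, ‖v t j k‖ ≤ V * ‖a t k‖)
    (has : ∀ t ∈ Set.Icc 0 T, Summable fun k => ‖a t k‖)
    (han : ∀ t ∈ Set.Icc 0 T, Summable fun k => freqAbs k * ‖a t k‖)
    (haR : ∀ t ∈ Set.Icc 0 T, ∑' k, freqAbs k * ‖a t k‖ ≤ R)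
    (hS : ∀ F : Finset (Fin d → ℤ), ∑ k ∈ F, (freqAbs k ^ s * ‖S k‖) ^ 2 ≤ β ^ 2)
    (hstart : ∀ F : Finset (Fin d → ℤ), ∑ k ∈ F, (freqAbs k ^ s * ‖a 0 k‖) ^ 2 ≤ x₀ ^ 2)
    (hbd : ∀ t ∈ Set.Icc 0 T, ∀ F : Finset (Fin d → ℤ),
      ∑ k ∈ F, (freqAbs k ^ s * ‖a t k‖) ^ 2 ≤ M ^ 2)
    {t : ℝ} (ht : t ∈ Set.Icc 0 T) (F : Finset (Fin d → ℤ)) :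
    ∑ k ∈ F, (freqAbs k ^ s * ‖a t k‖) ^ 2 ≤ (2 * (x₀ + β * T) *
      Real.exp (2 * (d * (3 ^ s * (1 + s) + 2) * (V * R + R * V) + 0) * T)) ^ 2 := by
  have hq : ∀ t, (fun k => freqAbs k * (V * ‖a t k‖)) = fun k => V * (freqAbs k * ‖a t k‖) :=
    fun t => funext fun k => by ring
  refine weighted_energy (f := fun _ => S) (v := v) (q := fun t k => V * ‖a t k‖)
    (h := fun k => freqAbs k ^ s) (by positivity) hV (by positivity) hR le_rfl hβ hx₀ hM
    (fun k => Real.rpow_nonneg (freqAbs_nonneg k) s) (mul_abs_truncWeight_sub_le hs)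
    hder hconj hdiv hv (fun t _ k => by positivity) (fun t ht => (has t ht).mul_left V)
    (fun t ht => ?_) (fun t ht => ?_) han haR (fun t _ x _ hax F => ?_) (fun t _ x _ _ F => ?_)
    hstart hbd ht F
  · rw [hq]; exact (han t ht).mul_left V
  · rw [hq, tsum_mul_left]; exact mul_le_mul_of_nonneg_left (haR t ht) hV
  · rw [mul_pow]
    refine le_trans (le_of_eq ?_) (mul_le_mul_of_nonneg_left (hax F) (sq_nonneg V))
    rw [Finset.mul_sum]
    exact Finset.sum_congr rfl fun k _ => by ring
  · simpa using hS F

/-- The `L²` stability estimate for two transport equations. -/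
lemma l2_stability {a b : ℝ → (Fin d → ℤ) → ℂ} {v w : ℝ → Fin d → (Fin d → ℤ) → ℂ}
    {S : (Fin d → ℤ) → ℂ} {e : ℝ → (Fin d → ℤ) → ℝ} {T V R R' ε M : ℝ} (hV : 0 ≤ V) (hR : 0 ≤ R)
    (hR' : 0 ≤ R') (hε : 0 ≤ ε) (hM : 0 ≤ M)
    (ha : ∀ k, ∀ t ∈ Set.Icc 0 T, HasDerivWithinAt (fun t => a t k)
      (S k - advection (v t) (a t) k) (Set.Icc 0 T) t)
    (hb : ∀ k, ∀ t ∈ Set.Icc 0 T, HasDerivWithinAt (fun t => b t k)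
      (S k - advection (w t) (b t) k) (Set.Icc 0 T) t)
    (hab : ∀ k, a 0 k = b 0 k)
    (hconj : ∀ t ∈ Set.Icc 0 T, ∀ j k, v t j (-k) = conj (v t j k))
    (hdiv : ∀ t ∈ Set.Icc 0 T, ∀ k, ∑ j, v t j k * (k j : ℂ) = 0)
    (hv : ∀ t ∈ Set.Icc 0 T, ∀ j k, ‖v t j k‖ ≤ V * ‖a t k‖)
    (hw : ∀ t ∈ Set.Icc 0 T, ∀ j k, ‖w t j k‖ ≤ V * ‖b t k‖)
    (hvw : ∀ t ∈ Set.Icc 0 T, ∀ j k, ‖v t j k - w t j k‖ ≤ V * ‖a t k - b t k‖ + e t k)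
    (he0 : ∀ t ∈ Set.Icc 0 T, ∀ k, 0 ≤ e t k) (hes : ∀ t ∈ Set.Icc 0 T, Summable (e t))
    (heε : ∀ t ∈ Set.Icc 0 T, ∀ F : Finset (Fin d → ℤ), ∑ k ∈ F, e t k ^ 2 ≤ ε ^ 2)
    (has : ∀ t ∈ Set.Icc 0 T, Summable fun k => ‖a t k‖)
    (hbs : ∀ t ∈ Set.Icc 0 T, Summable fun k => ‖b t k‖)
    (han : ∀ t ∈ Set.Icc 0 T, Summable fun k => freqAbs k * ‖a t k‖)
    (hbn : ∀ t ∈ Set.Icc 0 T, Summable fun k => freqAbs k * ‖b t k‖)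
    (haR : ∀ t ∈ Set.Icc 0 T, ∑' k, freqAbs k * ‖a t k‖ ≤ R)
    (hbR : ∀ t ∈ Set.Icc 0 T, ∑' k, freqAbs k * ‖b t k‖ ≤ R')
    (hbd : ∀ t ∈ Set.Icc 0 T, ∀ F : Finset (Fin d → ℤ), ∑ k ∈ F, ‖a t k - b t k‖ ^ 2 ≤ M ^ 2)
    {t : ℝ} (ht : t ∈ Set.Icc 0 T) (k : Fin d → ℤ) :
    ‖a t k - b t k‖ ≤ 2 * (d * R' * ε * T) *
      Real.exp (2 * (d * 2 * (V * R + (R + R') * 0) + d * R' * V) * T) := by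
  have hT : 0 ≤ T := ht.1.trans ht.2
  have hq : ∀ t, (fun k => freqAbs k * (V * ‖a t k‖)) = fun k => V * (freqAbs k * ‖a t k‖) :=
    fun t => funext fun k => by ring
  have hφs : ∀ t ∈ Set.Icc 0 T, Summable fun k => ‖a t k - b t k‖ := fun t ht =>
    Summable.of_nonneg_of_le (fun k => norm_nonneg _) (fun k => norm_sub_le _ _)
      ((has t ht).add (hbs t ht))
  have hφle : ∀ t k, freqAbs k * ‖a t k - b t k‖
      ≤ freqAbs k * ‖a t k‖ + freqAbs k * ‖b t k‖ := fun t k => by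
    rw [← mul_add]
    exact mul_le_mul_of_nonneg_left (norm_sub_le _ _) (freqAbs_nonneg k)
  have hφn : ∀ t ∈ Set.Icc 0 T, Summable fun k => freqAbs k * ‖a t k - b t k‖ := fun t ht =>
    Summable.of_nonneg_of_le (fun k => mul_nonneg (freqAbs_nonneg k) (norm_nonneg _)) (hφle t)
      ((han t ht).add (hbn t ht))
  have hder : ∀ k, ∀ t ∈ Set.Icc 0 T, HasDerivWithinAt (fun t => a t k - b t k)
      (-advection (fun j l => v t j l - w t j l) (b t) k
        - advection (v t) (fun l => a t l - b t l) k) (Set.Icc 0 T) t := by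
    intro k t ht
    refine ((ha k t ht).sub (hb k t ht)).congr_deriv ?_
    have h1 := advection_sub (k := k)
      (summable_advection (v := v t) (b := a t) (fun k => by positivity) ((has t ht).mul_left V)
        (han t ht) (hv t ht) (fun _ => le_rfl) k)
      (summable_advection (v := w t) (b := b t) (fun k => by positivity) ((hbs t ht).mul_left V)
        (hbn t ht) (hw t ht) (fun _ => le_rfl) k)
      (summable_advection (v := v t) (b := b t) (fun k => by positivity) ((has t ht).mul_left V)
        (hbn t ht) (hv t ht) (fun _ => le_rfl) k)
    linear_combination -h1
  -- The difference is transported by v and forced by -(v - w) · ∇b. The forcing is bounded in L²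
  -- through the gradient of b: its part linear in the difference gives γ, the symbol error gives β.
  -- The weight is p = 0, and the initial difference vanishes.
  have key := weighted_energy (a := fun t k => a t k - b t k)
    (f := fun t k => -advection (fun j l => v t j l - w t j l) (b t) k) (v := v)
    (q := fun t k => V * ‖a t k‖) (h := fun _ => 0) (p := 0) (T := T) (K := 2) (Q := V * R)
    (R := R + R') (V := 0) (γ := d * R' * V) (β := d * R' * ε) (x₀ := 0) (M := M)
    (by norm_num) le_rfl (by positivity) (by positivity) (by positivity) (by positivity) le_rfl hM
    (fun _ => le_rfl)
    (fun N k l => by simpa using mul_abs_truncWeight_zero_sub_le N k l) hder hconj hdiv hv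
    (fun t _ k => by positivity) (fun t ht => (has t ht).mul_left V)
    (fun t ht => by rw [hq]; exact (han t ht).mul_left V)
    (fun t ht => by rw [hq, tsum_mul_left]; exact mul_le_mul_of_nonneg_left (haR t ht) hV) hφn
    (fun t ht => ((hφn t ht).tsum_le_tsum (hφle t) ((han t ht).add (hbn t ht))).trans (by
      rw [(han t ht).tsum_add (hbn t ht)]; exact add_le_add (haR t ht) (hbR t ht)))
    (fun t _ x _ _ F => by simp)
    (fun t ht x hx hax F => by
      simp only [Real.rpow_zero, one_mul] at hax
      simp only [Real.rpow_zero, one_mul, norm_neg]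
      refine (sum_norm_advection_sq_le (x := V * x + ε) (R := R') (by positivity)
        (fun k => add_nonneg (by positivity) (he0 t ht k))
        (((hφs t ht).mul_left V).add (hes t ht)) (hvw t ht) (hbn t ht) (hbR t ht)
        (fun F => ?_) F).trans (le_of_eq (by ring))
      refine sum_add_sq_le (by positivity) hε ?_ (heε t ht F)
      have := mul_le_mul_of_nonneg_left (hax F) (sq_nonneg V)
      simpa only [mul_pow, Finset.mul_sum] using this)
    (fun F => by simp [hab])
    (fun t ht F => by simpa using hbd t ht F) ht {k}
  simp only [Finset.sum_singleton, Real.rpow_zero, one_mul, zero_add] at key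
  exact abs_le_of_sq_le_sq' key (by positivity) |>.2

/-- The velocity of a solution is real. -/
lemma IsSolution.velCoef_neg {m : SymbolMatrix d} {θ₀ S : Torus d → ℝ} {T : ℝ}
    {θ : ℝ → Torus d → ℝ} (h : IsSolution m θ₀ S T θ) {t : ℝ} (ht : t ∈ Set.Icc 0 T) (j : Fin d)
    (k : Fin d → ℤ) : velCoef m (fourierCoef (θ t)) j (-k)
      = conj (velCoef m (fourierCoef (θ t)) j k) := by
  obtain ⟨-, u, hu, -⟩ := h
  have h1 : ∀ k, fourierCoef (u t j) k = velCoef m (fourierCoef (θ t)) j k := (hu t ht j).2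
  rw [← h1, ← h1, fourierCoef_neg]

lemma sum_sq_le_of_sobolevNorm {s M : ℝ} (hs : 0 ≤ s) {f : Torus d → ℝ}
    (h : sobolevNorm s f ≤ ENNReal.ofReal M) (F : Finset (Fin d → ℤ)) :
    ∑ k ∈ F, (freqAbs k ^ s * ‖fourierCoef f k‖) ^ 2 ≤ M ^ 2 := by
  refine (Finset.sum_le_sum fun k _ => ?_).trans (sum_le_of_sobolevNorm h F)
  rw [mul_pow, freqAbs_rpow_sq, Real.rpow_mul (freqAbs_nonneg k), Real.rpow_two]
  refine mul_le_mul_of_nonneg_right (Real.rpow_le_rpow (sq_nonneg _) ?_ hs) (sq_nonneg _)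
  linarith

lemma norm_le_mul_rpow_neg {s M : ℝ} (hM : 0 ≤ M) {b : (Fin d → ℤ) → ℂ} (h0 : b 0 = 0)
    (hb : ∀ F : Finset (Fin d → ℤ), ∑ k ∈ F, (freqAbs k ^ s * ‖b k‖) ^ 2 ≤ M ^ 2)
    (k : Fin d → ℤ) : ‖b k‖ ≤ M * freqAbs k ^ (-s) := by
  by_cases hk : k = 0
  · rw [hk, h0, norm_zero]
    exact mul_nonneg hM (Real.rpow_nonneg (freqAbs_nonneg 0) _)
  · have h1 := hb {k}
    rw [Finset.sum_singleton] at h1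
    have h2 := abs_le_of_sq_le_sq' h1 hM |>.2
    have h3 := freqAbs_pos hk
    rw [Real.rpow_neg h3.le, ← div_eq_mul_inv, le_div_iff₀ (by positivity), mul_comm]
    exact h2

/-- Sobolev solutions: the classical equation for the coefficients. -/
lemma IsSobolevSolution.flow {m : SymbolMatrix d} (hm : DoubleDivFree m) {V : ℝ} (hV : 0 ≤ V)
    (hvel : ∀ (a : (Fin d → ℤ) → ℂ) j k, ‖velCoef m a j k‖ ≤ V * ‖a k‖)
    {θ₀ S : Torus d → ℝ} {s T : ℝ} (hs : (d : ℝ) / 2 + 1 < s) (hT : 0 < T)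
    {θ : ℝ → Torus d → ℝ} (h : IsSobolevSolution m θ₀ S s T θ)
    (h₀ : IsL2MeanZero θ₀) (hS : IsL2MeanZero S) :
    (∃ M : ℝ, 0 ≤ M ∧ ∀ t ∈ Set.Icc 0 T, ∀ F : Finset (Fin d → ℤ),
      ∑ k ∈ F, (freqAbs k ^ s * ‖fourierCoef (θ t) k‖) ^ 2 ≤ M ^ 2) ∧
    ∀ k, ∀ t ∈ Set.Icc 0 T, HasDerivWithinAt (fun t => fourierCoef (θ t) k)
      (fourierCoef S k - advection (velCoef m (fourierCoef (θ t))) (fourierCoef (θ t)) k)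
      (Set.Icc 0 T) t := by
  obtain ⟨hsol, M, hM⟩ := h
  have hd : (0 : ℝ) ≤ d := Nat.cast_nonneg d
  have hs0 : 0 ≤ s := by linarith
  have hb : ∀ t ∈ Set.Icc 0 T, ∀ F : Finset (Fin d → ℤ),
      ∑ k ∈ F, (freqAbs k ^ s * ‖fourierCoef (θ t) k‖) ^ 2 ≤ |M| ^ 2 := fun t ht F => by
    rw [sq_abs]; exact sum_sq_le_of_sobolevNorm hs0 (hM t ht) F
  refine ⟨⟨|M|, abs_nonneg M, hb⟩, fun k t ht => ?_⟩
  have ha0 : ∀ t ∈ Set.Icc 0 T, fourierCoef (θ t) 0 = 0 := fun t ht =>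
    (hsol.1 t ht).fourierCoef_zero
  have hdec : ∀ t ∈ Set.Icc 0 T, ∀ k, ‖fourierCoef (θ t) k‖ ≤ |M| * freqAbs k ^ (-s) :=
    fun t ht => norm_le_mul_rpow_neg (abs_nonneg M) (ha0 t ht) (hb t ht)
  have hws : Summable fun k : Fin d → ℤ => ((1 + V) * (|M| * freqAbs k ^ (-s))) ^ 2 := by
    refine ((summable_freqAbs_rpow (d := d) (p := 2 * s) (by linarith)).mul_left
      (((1 + V) * |M|) ^ 2)).congr fun k => ?_
    rw [← mul_assoc, mul_pow _ (freqAbs k ^ (-s)), freqAbs_rpow_sq, mul_neg]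
  have hw0 : ∀ k : Fin d → ℤ, 0 ≤ |M| * freqAbs k ^ (-s) := fun k =>
    mul_nonneg (abs_nonneg M) (Real.rpow_nonneg (freqAbs_nonneg k) _)
  refine hsol.hasDerivWithinAt_fourierCoef hm hT h₀ hS hws (fun t ht k => ?_)
    (fun t ht j k => ?_) (fun t ht j => ?_) k ht
  · have := hdec t ht k
    have := mul_nonneg hV (hw0 k)
    linarith
  · have := mul_le_mul_of_nonneg_left (hdec t ht k) hV
    have := hvel (fourierCoef (θ t)) j k
    have := hw0 k
    linarith
  · have h1 := (summable_freqAbs_mul hs (abs_nonneg M) (hb t ht)).1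
    exact Summable.of_nonneg_of_le (fun k => norm_nonneg _) (fun k => hvel _ j k)
      ((summable_norm_of_freqAbs_mul (ha0 t ht) h1).mul_left V)

end SobolevEstimates

/-! ### The bootstrap and the conclusion in Sobolev spaces. -/

section SobolevConclusion

variable {d : ℕ}

/-- The total difference of the symbols of `∂_i T_ij` at a frequency. -/
noncomputable def gradGap (m m' : SymbolMatrix d) (k : Fin d → ℤ) : ℝ :=
  ∑ i, ∑ j, ‖(k i : ℂ) * (m i j k - m' i j k)‖

lemma gradGap_nonneg (m m' : SymbolMatrix d) (k : Fin d → ℤ) : 0 ≤ gradGap m m' k :=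
  Finset.sum_nonneg fun _ _ => Finset.sum_nonneg fun _ _ => norm_nonneg _

lemma gradGap_le {m m' : SymbolMatrix d} {C : ℝ} {k : Fin d → ℤ}
    (h : ∀ i j, ‖(k i : ℂ) * m i j k‖ ≤ C) (h' : ∀ i j, ‖(k i : ℂ) * m' i j k‖ ≤ C) :
    gradGap m m' k ≤ d * (d * (C + C)) := by
  calc gradGap m m' k ≤ ∑ _i : Fin d, ∑ _j : Fin d, (C + C) :=
        Finset.sum_le_sum fun i _ => Finset.sum_le_sum fun j _ => by
          rw [mul_sub]
          exact (norm_sub_le _ _).trans (add_le_add (h i j) (h' i j))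
    _ = d * (d * (C + C)) := by simp [mul_add]

lemma tendsto_gradGap {m : ℝ → SymbolMatrix d} (hm : SymbolsConverge m) (k : Fin d → ℤ) :
    Tendsto (fun ν => gradGap (m ν) (m 0) k) (𝓝[>] 0) (𝓝 0) := by
  have : Tendsto (fun ν => ∑ i, ∑ j, ‖(k i : ℂ)‖ * ‖m ν i j k - m 0 i j k‖) (𝓝[>] 0)
      (𝓝 (∑ i : Fin d, ∑ _j : Fin d, ‖(k i : ℂ)‖ * (0 : ℝ))) :=
    tendsto_finsetSum _ fun i _ => tendsto_finsetSum _ fun j _ => (hm.tendsto i j k).const_mul _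
  simpa [gradGap] using this

lemma norm_velCoef_sub_le (m m' : SymbolMatrix d) (a : (Fin d → ℤ) → ℂ) (j : Fin d)
    (k : Fin d → ℤ) :
    ‖velCoef (fun i j k => m i j k - m' i j k) a j k‖ ≤ gradGap m m' k * ‖a k‖ := by
  unfold velCoef gradGap
  refine (norm_sum_le _ _).trans ?_
  rw [Finset.sum_mul]
  refine Finset.sum_le_sum fun i _ => ?_
  have h1 : ‖(k i : ℂ) * (m i j k - m' i j k)‖ ≤ ∑ j, ‖(k i : ℂ) * (m i j k - m' i j k)‖ :=
    Finset.single_le_sum (f := fun j => ‖(k i : ℂ) * (m i j k - m' i j k)‖)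
      (fun _ _ => norm_nonneg _) (Finset.mem_univ j)
  rw [show Complex.I * (k i : ℂ) * ((m i j k - m' i j k) * a k)
    = Complex.I * (((k i : ℂ) * (m i j k - m' i j k)) * a k) by ring, norm_mul, Complex.norm_I,
    one_mul, norm_mul]
  exact mul_le_mul_of_nonneg_right h1 (norm_nonneg _)

/-- Dominated convergence. With w a majorant of the limit solution at all times, the symbol error in
the equation tends to zero in L² uniformly in time. -/
lemma tendsto_tsum_gradGap {m : ℝ → SymbolMatrix d} (hm : SymbolsConverge m) {C : ℝ}
    (hC : ∀ ν ∈ Set.Icc (0 : ℝ) 1, ∀ i j (k : Fin d → ℤ), ‖(k i : ℂ) * m ν i j k‖ ≤ C)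
    {w : (Fin d → ℤ) → ℝ} (hw : Summable fun k => w k ^ 2) :
    Tendsto (fun ν => ∑' k, (gradGap (m ν) (m 0) k * w k) ^ 2) (𝓝[>] 0) (𝓝 0) := by
  have hIcc : ∀ᶠ ν : ℝ in 𝓝[>] 0, ν ∈ Set.Icc (0 : ℝ) 1 :=
    mem_of_superset (Ioc_mem_nhdsGT one_pos) Set.Ioc_subset_Icc_self
  have h := tendsto_tsum_of_dominated_convergence (𝓕 := 𝓝[>] (0 : ℝ))
    (f := fun ν k => (gradGap (m ν) (m 0) k * w k) ^ 2) (g := fun _ => (0 : ℝ))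
    (hw.mul_left ((d * (d * (C + C))) ^ 2)) (fun k => by
      have := ((tendsto_gradGap hm k).mul_const (w k)).pow 2
      simpa using this) (by
      filter_upwards [hIcc] with ν hν k
      rw [Real.norm_of_nonneg (sq_nonneg _), mul_pow]
      have h1 := gradGap_le (k := k) (fun i j => hC ν hν i j k)
        (fun i j => hC 0 (by simp) i j k)
      have h2 := gradGap_nonneg (m ν) (m 0) k
      gcongr)
  simpa using h

/-- Convergence of Sobolev solutions. -/
theorem sobolev_convergence {m : ℝ → SymbolMatrix d} (hA1 : ∀ ν : ℝ, 0 ≤ ν → DoubleDivFree (m ν))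
    (hA4 : SymbolsConverge m) (hA5 : UniformlyBoundedGradSymbols m)
    {s : ℝ} (hs : (d : ℝ) / 2 + 1 < s) {θ₀ S : Torus d → ℝ}
    (h₀ : IsL2MeanZero θ₀) (hS : IsL2MeanZero S) (hSs : sobolevNorm s S < ⊤)
    {T : ℝ} (hT : 0 < T) {θ : ℝ → ℝ → Torus d → ℝ}
    (hθ : ∀ ν ∈ Set.Icc (0 : ℝ) 1, IsSobolevSolution (m ν) θ₀ S s T (θ ν))
    {t : ℝ} (ht : t ∈ Set.Icc 0 T) :
    Tendsto (fun ν : ℝ => sobolevNorm (s - 1) (fun x => θ ν t x - θ 0 t x)) (𝓝[>] 0) (𝓝 0) := by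
  obtain ⟨C, hC0, hCb⟩ := hA5
  have hd0 : (0 : ℝ) ≤ d := Nat.cast_nonneg d
  have hs1 : 1 ≤ s := by linarith
  have h01 : (0 : ℝ) ∈ Set.Icc (0 : ℝ) 1 := by simp
  have hIcc : ∀ᶠ ν : ℝ in 𝓝[>] 0, ν ∈ Set.Icc (0 : ℝ) 1 :=
    mem_of_superset (Ioc_mem_nhdsGT one_pos) Set.Ioc_subset_Icc_self
  have hC : ∀ ν ∈ Set.Icc (0 : ℝ) 1, ∀ i j (k : Fin d → ℤ), ‖(k i : ℂ) * m ν i j k‖ ≤ C := by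
    intro ν hν i j k
    rcases hν.1.eq_or_lt with h | h
    · rw [← h]; exact (hCb i j k).2
    · exact (hCb i j k).1 ν h hν.2
  set V : ℝ := d * C with hV
  have hV0 : 0 ≤ V := by positivity
  have hvel : ∀ ν ∈ Set.Icc (0 : ℝ) 1, ∀ (a : (Fin d → ℤ) → ℂ) j k,
      ‖velCoef (m ν) a j k‖ ≤ V * ‖a k‖ := fun ν hν a j k =>
    norm_velCoef_le a j k fun i => hC ν hν i j k
  set a : ℝ → ℝ → (Fin d → ℤ) → ℂ := fun ν t => fourierCoef (θ ν t) with ha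
  have hflow := fun ν hν => (hθ ν hν).flow (hA1 ν hν.1) hV0 (hvel ν hν) hs hT h₀ hS
  have hder : ∀ ν ∈ Set.Icc (0 : ℝ) 1, ∀ τ ≤ T, ∀ k, ∀ t ∈ Set.Icc 0 τ,
      HasDerivWithinAt (fun t => a ν t k)
      (fourierCoef S k - advection (velCoef (m ν) (a ν t)) (a ν t) k) (Set.Icc 0 τ) t :=
    fun ν hν τ hτ k t ht => ((hflow ν hν).2 k t ⟨ht.1, ht.2.trans hτ⟩).mono
      (Set.Icc_subset_Icc le_rfl hτ)
  have hz : ∀ ν ∈ Set.Icc (0 : ℝ) 1, ∀ t ∈ Set.Icc 0 T, a ν t 0 = 0 := fun ν hν t ht =>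
    ((hθ ν hν).1.1 t ht).fourierCoef_zero
  have hinit : ∀ ν ∈ Set.Icc (0 : ℝ) 1, ∀ k, a ν 0 k = a 0 0 k := fun ν hν k => by
    simp only [ha]
    rw [(hθ ν hν).1.fourierCoef_zero_time hT.le h₀, (hθ 0 h01).1.fourierCoef_zero_time hT.le h₀]
  have hgrad : ∀ ν ∈ Set.Icc (0 : ℝ) 1, ∀ t ∈ Set.Icc 0 T,
      Summable fun k => freqAbs k * ‖a ν t k‖ := fun ν hν t ht => by
    obtain ⟨M, hM, hb⟩ := (hflow ν hν).1
    exact (summable_freqAbs_mul hs hM (hb t ht)).1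
  have hsum : ∀ ν ∈ Set.Icc (0 : ℝ) 1, ∀ t ∈ Set.Icc 0 T, Summable fun k => ‖a ν t k‖ :=
    fun ν hν t ht => summable_norm_of_freqAbs_mul (hz ν hν t ht) (hgrad ν hν t ht)
  obtain ⟨M₀, hM₀, hb₀⟩ := (hflow 0 h01).1
  set R' : ℝ := √(∑' k : Fin d → ℤ, (freqAbs k ^ (1 - s)) ^ 2) * M₀ with hR'
  have hR'0 : 0 ≤ R' := by positivity
  have hgrad₀ : ∀ t ∈ Set.Icc 0 T, ∑' k, freqAbs k * ‖a 0 t k‖ ≤ R' := fun t ht =>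
    (summable_freqAbs_mul hs hM₀ (hb₀ t ht)).2
  -- The bootstrap threshold: the gradient sum of the limit solution with a margin of 1, half of
  -- which is spent on the difference.
  set R := R' + 1 with hR
  have hR0 : 0 ≤ R := by positivity
  set β := (sobolevNorm s S).toReal with hβ
  have hβ0 : 0 ≤ β := ENNReal.toReal_nonneg
  have hSβ : ∀ F : Finset (Fin d → ℤ), ∑ k ∈ F, (freqAbs k ^ s * ‖fourierCoef S k‖) ^ 2 ≤ β ^ 2 :=
    sum_sq_le_of_sobolevNorm (by linarith) (ENNReal.ofReal_toReal hSs.ne).ge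
  -- The H^s bound that holds as long as the gradient sum stays at most R. It contains only M₀, the
  -- source and R, not the H^s bound of the individual solution.
  set K := 2 * (M₀ + β * T) *
    Real.exp (2 * (d * (3 ^ s * (1 + s) + 2) * (V * R + R * V) + 0) * T) with hK
  have hK0 : 0 ≤ K := by positivity
  have hHs : ∀ ν ∈ Set.Icc (0 : ℝ) 1, ∀ τ ∈ Set.Icc 0 T,
      (∀ σ ∈ Set.Icc 0 τ, ∑' k, freqAbs k * ‖a ν σ k‖ ≤ R) → ∀ F : Finset (Fin d → ℤ),
      ∑ k ∈ F, (freqAbs k ^ s * ‖a ν τ k‖) ^ 2 ≤ K ^ 2 := by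
    intro ν hν τ hτ hA F
    have hsub : Set.Icc 0 τ ⊆ Set.Icc 0 T := Set.Icc_subset_Icc le_rfl hτ.2
    obtain ⟨M, hM, hb⟩ := (hflow ν hν).1
    refine (sobolev_bound (T := τ) (v := fun t => velCoef (m ν) (a ν t)) hs1 hV0 hR0 hβ0 hM₀ hM
      (hder ν hν τ hτ.2) (fun t ht => (hθ ν hν).1.velCoef_neg (hsub ht))
      (fun t _ => (hA1 ν hν.1).velCoef_div _) (fun t _ => hvel ν hν _)
      (fun t ht => hsum ν hν t (hsub ht)) (fun t ht => hgrad ν hν t (hsub ht)) hA hSβ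
      (fun F => ?_) (fun t ht => hb t (hsub ht)) ⟨hτ.1, le_rfl⟩ F).trans ?_
    · simp only [hinit ν hν]
      exact hb₀ 0 ⟨le_rfl, hT.le⟩ F
    · have h0 := hτ.1
      have h1 := hτ.2
      rw [hK]
      gcongr
  set w : (Fin d → ℤ) → ℝ := fun k => M₀ * freqAbs k ^ (-s) with hw
  have hws : Summable fun k => w k ^ 2 := by
    refine ((summable_freqAbs_rpow (d := d) (p := 2 * s) (by linarith)).mul_left
      (M₀ ^ 2)).congr fun k => ?_
    rw [hw, mul_pow, freqAbs_rpow_sq, mul_neg]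
  have haw : ∀ t ∈ Set.Icc 0 T, ∀ k, ‖a 0 t k‖ ≤ w k := fun t ht =>
    norm_le_mul_rpow_neg hM₀ (hz 0 h01 t ht) (hb₀ t ht)
  set gap : ℝ → ℝ := fun ν => √(∑' k, (gradGap (m ν) (m 0) k * w k) ^ 2) with hgap
  have hgapt : Tendsto gap (𝓝[>] 0) (𝓝 0) := by
    have := (Real.continuous_sqrt.tendsto 0).comp (tendsto_tsum_gradGap hA4 hC hws)
    rwa [Real.sqrt_zero] at this
  have hW : ∀ ν ∈ Set.Icc (0 : ℝ) 1, ∀ k, gradGap (m ν) (m 0) k ≤ d * (d * (C + C)) :=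
    fun ν hν k => gradGap_le (fun i j => hC ν hν i j k) (fun i j => hC 0 h01 i j k)
  have hgaps : ∀ ν ∈ Set.Icc (0 : ℝ) 1, ∀ t ∈ Set.Icc 0 T, ∀ F : Finset (Fin d → ℤ),
      ∑ k ∈ F, (gradGap (m ν) (m 0) k * ‖a 0 t k‖) ^ 2 ≤ gap ν ^ 2 := by
    intro ν hν t ht F
    have h0 : ∀ k, 0 ≤ (gradGap (m ν) (m 0) k * w k) ^ 2 := fun k => sq_nonneg _
    have h1 : Summable fun k => (gradGap (m ν) (m 0) k * w k) ^ 2 := by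
      refine Summable.of_nonneg_of_le h0 (fun k => ?_) (hws.mul_left ((d * (d * (C + C))) ^ 2))
      have := hW ν hν k
      have := gradGap_nonneg (m ν) (m 0) k
      rw [mul_pow]
      gcongr
    simp only [hgap]
    rw [Real.sq_sqrt (tsum_nonneg h0)]
    refine (Finset.sum_le_sum fun k _ => ?_).trans (h1.sum_le_tsum F fun k _ => h0 k)
    have := haw t ht k
    have := gradGap_nonneg (m ν) (m 0) k
    gcongr
  set L := 2 * (d * R' * T) *
      Real.exp (2 * (d * 2 * (V * R + (R + R') * 0) + d * R' * V) * T) with hL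
  have hL2 : ∀ ν ∈ Set.Icc (0 : ℝ) 1, ∀ τ ∈ Set.Icc 0 T,
      (∀ σ ∈ Set.Icc 0 τ, ∑' k, freqAbs k * ‖a ν σ k‖ ≤ R) → ∀ k,
      ‖a ν τ k - a 0 τ k‖ ≤ L * gap ν := by
    intro ν hν τ hτ hA k
    have hsub : Set.Icc 0 τ ⊆ Set.Icc 0 T := Set.Icc_subset_Icc le_rfl hτ.2
    have hg0 : 0 ≤ gap ν := Real.sqrt_nonneg _
    obtain ⟨M, hM, hb⟩ := (hflow ν hν).1
    have hl2 : ∀ ν ∈ Set.Icc (0 : ℝ) 1, ∀ (M : ℝ), 0 ≤ M →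
        (∀ t ∈ Set.Icc 0 T, ∀ F : Finset (Fin d → ℤ),
          ∑ k ∈ F, (freqAbs k ^ s * ‖a ν t k‖) ^ 2 ≤ M ^ 2) →
        ∀ t ∈ Set.Icc 0 T, ∀ F : Finset (Fin d → ℤ), ∑ k ∈ F, (1 * ‖a ν t k‖) ^ 2 ≤ M ^ 2 := by
      intro ν hν M hM hb t ht F
      refine (Finset.sum_le_sum fun k _ => ?_).trans (hb t ht F)
      by_cases hk : k = 0
      · rw [hk, hz ν hν t ht]; simp
      · have := Real.one_le_rpow (one_le_freqAbs hk) (by linarith : 0 ≤ s)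
        gcongr
    have key := l2_stability (T := τ) (a := a ν) (b := a 0)
      (v := fun t => velCoef (m ν) (a ν t)) (w := fun t => velCoef (m 0) (a 0 t))
      (e := fun t k => gradGap (m ν) (m 0) k * ‖a 0 t k‖) (ε := gap ν) (M := M + M₀)
      hV0 hR0 hR'0 hg0 (by positivity) (hder ν hν τ hτ.2) (hder 0 h01 τ hτ.2) (hinit ν hν)
      (fun t ht => (hθ ν hν).1.velCoef_neg (hsub ht))
      (fun t _ => (hA1 ν hν.1).velCoef_div _) (fun t _ => hvel ν hν _) (fun t _ => hvel 0 h01 _)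
      (fun t _ j k => by
        rw [velCoef_sub]
        exact (norm_add_le _ _).trans (add_le_add (hvel ν hν _ j k) (norm_velCoef_sub_le _ _ _ j k)))
      (fun t _ k => mul_nonneg (gradGap_nonneg _ _ _) (norm_nonneg _))
      (fun t ht => Summable.of_nonneg_of_le
        (fun k => mul_nonneg (gradGap_nonneg _ _ _) (norm_nonneg _))
        (fun k => mul_le_mul_of_nonneg_right (hW ν hν k) (norm_nonneg _))
        ((hsum 0 h01 t (hsub ht)).mul_left _))
      (fun t ht => hgaps ν hν t (hsub ht))
      (fun t ht => hsum ν hν t (hsub ht)) (fun t ht => hsum 0 h01 t (hsub ht))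
      (fun t ht => hgrad ν hν t (hsub ht)) (fun t ht => hgrad 0 h01 t (hsub ht))
      hA (fun t ht => hgrad₀ t (hsub ht))
      (fun t ht F => by
        simpa only [one_mul] using sum_weighted_sub_sq_le (g := fun _ => 1) hM hM₀
          (hl2 ν hν M hM hb t (hsub ht)) (hl2 0 h01 M₀ hM₀ hb₀ t (hsub ht)) F)
      ⟨hτ.1, le_rfl⟩ k
    refine key.trans ?_
    have h0 := hτ.1
    have h1 := hτ.2
    rw [hL]
    calc _ ≤ 2 * (d * R' * gap ν * T) *
          Real.exp (2 * (d * 2 * (V * R + (R + R') * 0) + d * R' * V) * T) := by gcongr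
      _ = _ := by ring
  -- On the ball of radius K + M₀ in H^s, coefficients below δ₁ force the gradient sum of the
  -- difference below 1/2. Since K does not depend on ν, neither does δ₁.
  obtain ⟨F₁, δ₁, hδ₁, hF₁⟩ := exists_finset_tsum_freqAbs_mul_le (d := d) hs
    (by positivity : 0 ≤ K + M₀) (half_pos one_pos)
  have hA : ∀ ν ∈ Set.Icc (0 : ℝ) 1, L * gap ν ≤ δ₁ → ∀ t ∈ Set.Icc 0 T,
      ∑' k, freqAbs k * ‖a ν t k‖ < R := by
    intro ν hν hsmall t ht
    obtain ⟨M, hM, hb⟩ := (hflow ν hν).1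
    refine lt_of_continuous_induction (A := fun t => ∑' k, freqAbs k * ‖a ν t k‖)
      (continuousOn_tsum_freqAbs_mul hs hM hb fun k t ht =>
        ((hflow ν hν).2 k t ht).continuousWithinAt) ?_ (fun τ hτ hAτ => ?_) ht
    · simp only [hinit ν hν]
      have := hgrad₀ 0 ⟨le_rfl, hT.le⟩
      linarith
    · have hφ : ∀ F : Finset (Fin d → ℤ),
          ∑ k ∈ F, (freqAbs k ^ s * ‖a ν τ k - a 0 τ k‖) ^ 2 ≤ (K + M₀) ^ 2 :=
        sum_weighted_sub_sq_le hK0 hM₀ (hHs ν hν τ hτ hAτ) (hb₀ τ hτ)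
      have h1 := hF₁ (fun k => a ν τ k - a 0 τ k) hφ fun k _ =>
        (hL2 ν hν τ hτ hAτ k).trans hsmall
      have h2 := (summable_freqAbs_mul hs (by positivity : 0 ≤ K + M₀)
        (b := fun k => a ν τ k - a 0 τ k) hφ).1
      have h3 : ∑' k, freqAbs k * ‖a ν τ k‖
          ≤ ∑' k, (freqAbs k * ‖a 0 τ k‖ + freqAbs k * ‖a ν τ k - a 0 τ k‖) := by
        refine (hgrad ν hν τ hτ).tsum_le_tsum (fun k => ?_) ((hgrad 0 h01 τ hτ).add h2)
        rw [← mul_add]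
        refine mul_le_mul_of_nonneg_left ?_ (freqAbs_nonneg k)
        have := norm_add_le (a 0 τ k) (a ν τ k - a 0 τ k)
        rwa [add_sub_cancel] at this
      rw [(hgrad 0 h01 τ hτ).tsum_add h2] at h3
      have := hgrad₀ τ hτ
      linarith
  have heq : (fun ν => (∑' k : Fin d → ℤ, ENNReal.ofReal ((1 + freqAbs k ^ 2) ^ (s - 1) *
      ‖a ν t k - a 0 t k‖ ^ 2)) ^ (1 / 2 : ℝ)) =ᶠ[𝓝[>] 0]
      fun ν => sobolevNorm (s - 1) (fun x => θ ν t x - θ 0 t x) := by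
    filter_upwards [hIcc] with ν hν
    unfold sobolevNorm
    simp only [ha, fourierCoef_sub (((hθ ν hν).1.1 t ht).1.integrable one_le_two)
      (((hθ 0 h01).1.1 t ht).1.integrable one_le_two)]
  refine Tendsto.congr' heq (tendsto_rpow_half_tsum (fun ν k => by positivity) fun ε hε => ?_)
  obtain ⟨F₂, δ₂, hδ₂, hF₂⟩ := exists_finset_sum_sq_le (d := d) (M := K + M₀) hs1 hε
  have hLt : Tendsto (fun ν => L * gap ν) (𝓝[>] 0) (𝓝 0) := by
    simpa using hgapt.const_mul L
  filter_upwards [hIcc, hLt.eventually (ge_mem_nhds hδ₁), hLt.eventually (ge_mem_nhds hδ₂)]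
    with ν hν h1 h2
  have hAt : ∀ σ ∈ Set.Icc 0 t, ∑' k, freqAbs k * ‖a ν σ k‖ ≤ R := fun σ hσ =>
    (hA ν hν h1 σ ⟨hσ.1, hσ.2.trans ht.2⟩).le
  exact hF₂ (fun k => a ν t k - a 0 t k) (by simp only [hz ν hν t ht, hz 0 h01 t ht, sub_zero])
    (sum_weighted_sub_sq_le hK0 hM₀ (hHs ν hν t ht hAt) (hb₀ t ht))
    fun k _ => (hL2 ν hν t ht hAt k).trans h2

end SobolevConclusion

theorem theorem2p5 {d : ℕ} (hd : 2 ≤ d) (m : ℝ → SymbolMatrix d)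
    (hA1 : ∀ ν : ℝ, 0 ≤ ν → DoubleDivFree (m ν))
    (hA2 : ∀ ν : ℝ, 0 ≤ ν → ∀ i j, MapsLinftyToBMO (m ν i j))
    (hA3 : ∀ ν : ℝ, 0 < ν → SmoothingSymbol (m ν))
    (hA4 : SymbolsConverge m) :
    -- first case: uniformly bounded symbols, Gevrey-class solutions
    (UniformlyBoundedSymbols m →
      ∀ (s r K₀ τ₀ : ℝ), 1 ≤ s → (d : ℝ) / 2 + 3 / 2 < r → 0 < K₀ → 0 < τ₀ →
      ∀ θ₀ S : Torus d → ℝ, IsL2MeanZero θ₀ → IsL2MeanZero S →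
      gevreyNorm s r τ₀ θ₀ ≤ ENNReal.ofReal K₀ → gevreyNorm s r τ₀ S ≤ ENNReal.ofReal K₀ →
      ∀ (Tbar τbar : ℝ), 0 < Tbar → 0 < τbar →
      ∀ θ : ℝ → ℝ → Torus d → ℝ,
      (∀ ν ∈ Set.Icc (0 : ℝ) 1, IsGevreySolution (m ν) θ₀ S s r Tbar τbar (θ ν)) →
      -- for `s > 1`: the common bound on the solutions, and uniqueness of the limit solution
      (1 < s →
        (∃ C : ℝ, ∀ ν ∈ Set.Icc (0 : ℝ) 1, ∀ t ∈ Set.Icc 0 Tbar,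
          gevreyNorm s r τbar (θ ν t) ≤ ENNReal.ofReal C) ∧
        (∀ θ' : ℝ → Torus d → ℝ, IsGevreySolution (m 0) θ₀ S s r Tbar τbar θ' →
          ∀ t ∈ Set.Icc 0 Tbar, θ' t =ᵐ[volume] θ 0 t)) →
      ∃ (T : ℝ) (τ : ℝ → ℝ), 0 < T ∧ T < Tbar ∧ (∀ t ∈ Set.Icc 0 T, 0 < τ t ∧ τ t < τbar) ∧
        ∀ t ∈ Set.Icc 0 T,
          Tendsto (fun ν : ℝ => gevreyNorm s r (τ t) (fun x => θ ν t x - θ 0 t x))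
            (𝓝[>] 0) (𝓝 0)) ∧
    -- second case: uniformly bounded gradient symbols, Sobolev solutions
    (UniformlyBoundedGradSymbols m →
      ∀ s : ℝ, (d : ℝ) / 2 + 1 < s →
      ∀ θ₀ S : Torus d → ℝ, IsL2MeanZero θ₀ → IsL2MeanZero S →
      sobolevNorm s θ₀ < ⊤ → sobolevNorm s S < ⊤ →
      ∀ T : ℝ, 0 < T →
      ∀ θ : ℝ → ℝ → Torus d → ℝ,
      (∀ ν ∈ Set.Icc (0 : ℝ) 1, IsSobolevSolution (m ν) θ₀ S s T (θ ν)) →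
      ∀ t ∈ Set.Icc 0 T,
        Tendsto (fun ν : ℝ => sobolevNorm (s - 1) (fun x => θ ν t x - θ 0 t x))
          (𝓝[>] 0) (𝓝 0)) := by
  refine ⟨?_, ?_⟩
  · intro hA5 s r K₀ τ₀ hs hr _ hτ₀ θ₀ S h₀ hS hθ₀ hSK Tbar τbar hT hτ θ hθ hs1
    have hd0 : (0 : ℝ) ≤ d := Nat.cast_nonneg d
    exact gevrey_convergence hA1 hA4 hA5 hs (by linarith) hτ₀ h₀ hS hθ₀ hSK hT hτ hθ hs1
  · intro hA5 s hs θ₀ S h₀ hS _ hSs T hT θ hθ t ht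
    exact sobolev_convergence hA1 hA4 hA5 hs h₀ hS hSs hT hθ ht
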